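/- For a prime $q$ and $p\in[0,1]$ let $\mathrm{Ber}_q(p)$ be the distribution on $\mathbb F_q$ that is uniform on $\mathbb F_q$ with probability $p$ and equal to $0$ otherwise. In the search problem $\mathsf{LPN}^{=w}_{q,\eta,N,m}$ one is given $(A, As+e)$, where $s\in\mathbb F_q^N$ is uniform, the $m$ rows of $A$ are independent uniform vectors of $\mathbb F_q^N$ of Hamming weight exactly $w$, and $e$ has $m$ independent $\mathrm{Ber}_q(\eta)$ entries; the goal is to output $s$. The problem $\mathsf{LPN}^{\approx w}_{q,\eta,N,m}$ is the same except that all entries of $A$ are independent $\mathrm{Ber}_q\big(\frac{qw}{(q-1)N}\big)$. A (possibly randomised) algorithm solves the problem with success probability $\alpha$ if it outputs $s$ with probability at least $\alpha$ over $s$, $A$, $e$ and its own randomness. **Theorem.** There are a single randomised oracle program $P$ and constants $C,d$ such that the following holds for every prime $q$. Let $m,n,k,\sigma$ be positive integers with $\frac{q\sigma}{(q-1)n}\le 1$ and $m\ge\max\big(\frac{48n^3\log q}{\sigma^2},\,1200n\big)$, and set $M=\lceil 3\sqrt\sigma\,m\rceil$. Let $\varepsilon>0$, $\delta>6\cdot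 2^{-(2n-1)}$, $\eta\in(0,1/8)$, and let $k$ satisfy $\frac{192}{\delta}\log\frac{16}{\varepsilon}<k<2^{2n-2}\varepsilon$ (logarithms are natural). If $\mathcal O$ is an oracle, using fresh randomness in each call, that solves $\mathsf{LPN}^{=k\sigma}_{q,\,1-(1-\eta)^k,\,kn,\,m}$ with success probability $\varepsilon$, then $P$ with oracle $\mathcal O$ solves $\mathsf{LPN}^{\approx\sigma}_{q,\eta,n,M}$ with success probability $1-\delta$. Moreover, with any oracle and on any input, $P$ takes at most $C\,m\,(n+k+1/\varepsilon+1/\delta)^d$ steps. Here $P$ is a program for a random access machine on natural numbers whose unit-cost operations are: constants, addition, truncated subtraction, multiplication modulo a given number, indirect reading and writing, testing for zero, counting an iteration of a bounded loop, drawing a uniform number below a given bound, and drawing a bit that is $1$ with probability $\eta$; an oracle query is charged one step plus the number of entries of the query and of its answer. Its input is the instance together with $q,n,k,\sigma,m,M,\lceil1/\varepsilon\rceil,\lceil1/\delta\rceil$. -/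

import Mathlib

namespace SparseLPN

noncomputable section

/-! ### Distributions -/

/-- A biased bit: `true` with probability `p`, for `p ∈ [0, 1]` (`p` is clamped to `[0, 1]`). -/
def coin (p : ℝ) : PMF Bool :=
  PMF.ofFintype
    (fun b => cond b (min (ENNReal.ofReal p) 1) (1 - min (ENNReal.ofReal p) 1))
    (by simp [add_tsub_cancel_of_le])

/-- `Ber_q(p)`: with probability `p` a uniform element of `ZMod q`, otherwise `0`. -/
def berq (q : ℕ) [NeZero q] (p : ℝ) : PMF (ZMod q) :=
  (coin p).bind fun c => cond c (PMF.uniformOfFintype (ZMod q)) (PMF.pure 0)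

/-- `n` independent samples of `D`. -/
def iid {α : Type} (D : PMF α) : (n : ℕ) → PMF (Fin n → α)
  | 0 => PMF.pure Fin.elim0
  | n + 1 => D.bind fun x => (iid D n).map fun f => Fin.cons x f

/-- The vectors of length `n` over `ZMod q` of Hamming weight exactly `w`. -/
def weightSet (q n w : ℕ) [NeZero q] : Finset (Fin n → ZMod q) :=
  Finset.univ.filter fun a => hammingNorm a = w

/-- A uniform vector of Hamming weight exactly `w` (used only for `w ≤ n` and `2 ≤ q`, when there
is such a vector; otherwise the zero vector). -/
def exactRow (q n w : ℕ) [NeZero q] : PMF (Fin n → ZMod q) :=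
  if h : (weightSet q n w).Nonempty then PMF.uniformOfFinset (weightSet q n w) h else PMF.pure 0

/-- A vector with independent entries `Ber_q(q w / ((q - 1) n))`; its expected weight is `w`. -/
def approxRow (q n w : ℕ) [NeZero q] : PMF (Fin n → ZMod q) :=
  iid (berq q ((q : ℝ) * w / (((q : ℝ) - 1) * n))) n

/-! ### Search LPN -/

/-- A possibly randomised procedure which on input `(A, b)` returns a candidate secret. -/
abbrev Solver (q n m : ℕ) : Type :=
  Matrix (Fin m) (Fin n) (ZMod q) → (Fin m → ZMod q) → PMF (Fin n → ZMod q)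

/-- The probability over `s` uniform, `A` with `m` independent rows from `row`, `e` with `m`
independent `Ber_q(η)` entries, and the randomness of `S`, that `S` returns `s` on
`(A, A s + e)`. -/
def successProb {q n m : ℕ} [NeZero q] (row : PMF (Fin n → ZMod q)) (η : ℝ)
    (S : Solver q n m) : ENNReal :=
  ((PMF.uniformOfFintype (Fin n → ZMod q)).bind fun s =>
    (iid row m).bind fun A =>
      (iid (berq q η) m).bind fun e =>
        (S (Matrix.of A) ((Matrix.of A).mulVec s + e)).map fun z => decide (z = s)) true

/-- Success probability on `LPN^{=w}_{q,η,n,m}`. -/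
def successExact {q n m : ℕ} [NeZero q] (w : ℕ) (η : ℝ) (S : Solver q n m) : ENNReal :=
  successProb (exactRow q n w) η S

/-- Success probability on `LPN^{≈w}_{q,η,n,m}`. -/
def successApprox {q n m : ℕ} [NeZero q] (w : ℕ) (η : ℝ) (S : Solver q n m) : ENNReal :=
  successProb (approxRow q n w) η S

/-! ### Randomised oracle programs with a step count

Programs for a random access machine with registers and a memory, both holding natural numbers.
No instruction makes the longest number present more than one bit longer (apart from writing a
constant of the program), so that step counts are polynomially related to Turing machine time.
All loops are bounded: the number of iterations is read from a register on entry. -/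

inductive Prog : Type
  /-- `reg d := c` -/
  | const (d c : ℕ)
  /-- `reg d := reg a + reg b` -/
  | add (d a b : ℕ)
  /-- `reg d := reg a - reg b`, truncated at `0` -/
  | sub (d a b : ℕ)
  /-- `reg d := reg a * reg b mod reg c`, and `0` if `reg c = 0` -/
  | mulMod (d a b c : ℕ)
  /-- `reg d := mem (reg a)` -/
  | load (d a : ℕ)
  /-- `mem (reg a) := reg s` -/
  | store (a s : ℕ)
  /-- `reg d :=` a fresh uniform number in `{0, …, reg a}` -/
  | rand (d a : ℕ)
  /-- `reg d :=` a fresh noise bit (`1` with the probability given by the noise rate) -/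
  | noise (d : ℕ)
  /-- query the oracle on the instance stored at `reg a` and write the answer from `reg d` on -/
  | query (a d : ℕ)
  | seq (P Q : Prog)
  /-- if `reg r = 0` then `P` else `Q` -/
  | ifZero (r : ℕ) (P Q : Prog)
  /-- repeat `P` as many times as `reg r` says on entry -/
  | loop (r : ℕ) (P : Prog)

structure State : Type where
  reg : ℕ → ℕ
  mem : ℕ → ℕ
  time : ℕ

namespace State

def tick (t : ℕ) (S : State) : State := { S with time := S.time + t }

def setReg (d v : ℕ) (S : State) : State := { S with reg := Function.update S.reg d v }

def setMem (a v : ℕ) (S : State) : State := { S with mem := Function.update S.mem a v }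

/-- Read an `m × N` matrix, stored row by row from address `a` on. -/
def readMatrix (q N m a : ℕ) (S : State) : Matrix (Fin m) (Fin N) (ZMod q) :=
  Matrix.of fun i j => (S.mem (a + i * N + j) : ZMod q)

/-- Read a vector stored from address `a` on. -/
def readVec (q N a : ℕ) (S : State) : Fin N → ZMod q := fun j => (S.mem (a + j) : ZMod q)

/-- Write a vector from address `a` on, as representatives in `{0, …, q - 1}`. -/
def writeVec {q N : ℕ} (a : ℕ) (z : Fin N → ZMod q) (S : State) : State :=
  { S with mem := fun x =>
      if h : a ≤ x ∧ x - a < N then (z ⟨x - a, h.2⟩).val else S.mem x }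

end State

/-- The meaning of a program, given the noise bit and an oracle for `m` samples in dimension `N`.
Every instruction, test and loop iteration takes one step; a query takes in addition one step for
every memory cell that it reads or writes. -/
def exec {q N m : ℕ} (bit : PMF Bool) (O : Solver q N m) : Prog → State → PMF State
  | .const d c, S => PMF.pure ((S.setReg d c).tick 1)
  | .add d a b, S => PMF.pure ((S.setReg d (S.reg a + S.reg b)).tick 1)
  | .sub d a b, S => PMF.pure ((S.setReg d (S.reg a - S.reg b)).tick 1)
  | .mulMod d a b c, S =>
      PMF.pure ((S.setReg d (if S.reg c = 0 then 0 else S.reg a * S.reg b % S.reg c)).tick 1)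
  | .load d a, S => PMF.pure ((S.setReg d (S.mem (S.reg a))).tick 1)
  | .store a s, S => PMF.pure ((S.setMem (S.reg a) (S.reg s)).tick 1)
  | .rand d a, S =>
      (PMF.uniformOfFintype (Fin (S.reg a + 1))).map fun v => (S.setReg d v).tick 1
  | .noise d, S => bit.map fun c => (S.setReg d (cond c 1 0)).tick 1
  | .query a d, S =>
      (O (S.readMatrix q N m (S.reg a)) (S.readVec q m (S.reg a + m * N))).map fun z =>
        (S.writeVec (S.reg d) z).tick (1 + m * N + m + N)
  | .seq P Q, S => (exec bit O P S).bind fun S' => exec bit O Q S'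
  | .ifZero r P Q, S =>
      if S.reg r = 0 then exec bit O P (S.tick 1) else exec bit O Q (S.tick 1)
  | .loop r P, S =>
      Nat.rec (PMF.pure (S.tick 1))
        (fun _ D => D.bind fun S' => exec bit O P (S'.tick 1)) (S.reg r)

/-- The initial state: the numbers in `params` are in registers `0, 1, 2, …`, the memory holds the
rows of `A` one after another from address `0` on, then `b`; everything else is `0`. -/
def initState {q n M : ℕ} (params : List ℕ) (A : Matrix (Fin M) (Fin n) (ZMod q))
    (b : Fin M → ZMod q) : State :=
  (({ reg := fun i => params.getD i 0, mem := fun _ => 0, time := 0 } : State).writeVec 0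
    (fun x : Fin (M * n) => A (finProdFinEquiv.symm x).1 (finProdFinEquiv.symm x).2)).writeVec
      (M * n) b

/-- Run `P` on the instance `(A, b)`. -/
def run {q N m n M : ℕ} (P : Prog) (params : List ℕ) (η : ℝ) (O : Solver q N m)
    (A : Matrix (Fin M) (Fin n) (ZMod q)) (b : Fin M → ZMod q) : PMF State :=
  exec (coin η) O P (initState params A b)

/-- The solver computed by `P` with oracle `O`: the answer is read from memory cells
`0, …, n - 1` at the end of the run. -/
def reductionSolver {q N m n M : ℕ} (P : Prog) (params : List ℕ) (η : ℝ) (O : Solver q N m) :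
    Solver q n M :=
  fun A b => (run P params η O A b).map fun S => S.readVec q n 0

end

end SparseLPN

/-! A sample of dimension n is hidden as one of the k blocks of an oracle row. Given m samples whose
rows are distributed like a block of a uniform row of weight kσ in dimension kn, a trial picks a
random block position i and completes every row to a uniform row of weight kσ. It adds k - 1 fresh
noise values to the label and re-randomises the secret by a uniform shift u. The oracle then faces a
genuine instance of noise rate 1 - (1 - η)^k (`plantSample_labelled`, `sum_indep_berq`), and
subtracting u from block i of its answer gives a candidate for the secret. The work lies in showing
that for almost every list of m samples a trial succeeds with probability at least ε/(2k), although
ε itself may be tiny.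

This is a direct product statement (`direct_product`). Call a list of block samples bad if planting
it helps the oracle with probability at most ε/(2k), and let β be the probability of bad lists. The
oracle succeeds either on an instance none of whose k block columns is bad, or on one with a bad
column. The second case costs at most k · ε/(2k) = ε/2. If the blocks were independent, the first
would cost (1 - β)^k. They are only tied together by the total weight, and (1 - β)^(k/2) is proved
instead, so β > δ/2 is impossible for the given k (`bad_bound`).

The substitute for independence is that the expectation of a product of functions of the blocks is
at most the product of their L² norms (`expect_blocks_le`). Cauchy–Schwarz inside the classes of
equal weight reduces this to functions of the block weights, where it reads E ∏ √h_i(w_i) ≤ ∏ √(E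
h_i(w_i)). The law of the weights is reversible for the dynamics that moves single units of weight
between blocks. Moving all h_i along the generator keeps every E h_i, and the derivative of the left
side is a sum of squares. At a maximiser with prescribed means, which exists by compactness, all
these squares vanish. With at least three blocks this forces each h_i to be constant on the
admissible weights, and then equality holds (`sum_prodSqrt_le_of_bounds`). The inequality tensorises
over the m rows (`expect_rows_le`).

The input rows have independent entries, so their weights are binomial rather than hypergeometric.
Rejection sampling repairs this exactly: a row of weight w is kept with probability proportional to
the ratio of the two laws, which is largest at w = σ and is realised by at most n coins of rational
bias (`acceptProb_law`, `approxRow_mul_accept`). At most half of the rows are rejected on average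
(`reject_le`), so m of M ≥ 3m survive except with exponentially small probability
(`expect_iter_accept`).

Candidates are ranked by the number of violated input samples. A union bound over all wrong secrets
with the exponential moment 3^(score difference) shows that the true secret is the strict minimum
(`expect_score_le`), so one successful trial suffices, and 12k⌈1/ε⌉⌈1/δ⌉ trials are made. The
failure budget is δ/6 for scoring, δ/6 for filtering, δ/2 for bad lists and δ/6 for unlucky trials
(`expect_fail_le`).

The machine program is tied to these distributions by couplings (`Sim`) between runs and a
mathematical specification. Its running time follows from a syntactic cost function, because all
loop counts sit in registers that the program never changes after setup (`post_stable`). -/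

namespace SparseLPN
noncomputable section
open scoped ENNReal

/-! ### Expectations of nonnegative functions -/

/-- The expectation of a nonnegative function. -/
def expect {α : Type} (p : PMF α) (f : α → ℝ≥0∞) : ℝ≥0∞ := ∑' a, p a * f a

section expect
variable {α β : Type}

@[simp] theorem expect_pure (a : α) (f : α → ℝ≥0∞) : expect (PMF.pure a) f = f a := by
  classical
  rw [expect, tsum_eq_single a]
  · simp
  · intro b hb; simp [PMF.pure_apply, hb]

@[simp] theorem expect_bind (p : PMF α) (k : α → PMF β) (f : β → ℝ≥0∞) :
    expect (p.bind k) f = expect p fun a => expect (k a) f := by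
  simp only [expect, PMF.bind_apply, ← ENNReal.tsum_mul_right, ← ENNReal.tsum_mul_left]
  rw [ENNReal.tsum_comm]
  simp only [mul_assoc]

@[simp] theorem expect_map (p : PMF α) (g : α → β) (f : β → ℝ≥0∞) :
    expect (p.map g) f = expect p fun a => f (g a) := by
  simp [PMF.map, Function.comp_def]

theorem expect_congr {p : PMF α} {f g : α → ℝ≥0∞} (h : ∀ a ∈ p.support, f a = g a) :
    expect p f = expect p g := by
  refine tsum_congr fun a => ?_
  by_cases ha : a ∈ p.support
  · rw [h a ha]
  · rw [PMF.mem_support_iff, not_not] at ha; simp [ha]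

theorem expect_mono_support {p : PMF α} {f g : α → ℝ≥0∞} (h : ∀ a ∈ p.support, f a ≤ g a) :
    expect p f ≤ expect p g := by
  refine ENNReal.tsum_le_tsum fun a => ?_
  by_cases ha : a ∈ p.support
  · gcongr; exact h a ha
  · rw [PMF.mem_support_iff, not_not] at ha; simp [ha]

theorem expect_mono {p : PMF α} {f g : α → ℝ≥0∞} (h : ∀ a, f a ≤ g a) :
    expect p f ≤ expect p g := expect_mono_support fun a _ => h a

theorem expect_add (p : PMF α) (f g : α → ℝ≥0∞) :
    expect p (fun a => f a + g a) = expect p f + expect p g := by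
  simp only [expect, mul_add, ENNReal.tsum_add]

@[simp] theorem expect_const (p : PMF α) (c : ℝ≥0∞) : expect p (fun _ => c) = c := by
  simp [expect, ENNReal.tsum_mul_right, p.tsum_coe]

theorem expect_const_mul (p : PMF α) (c : ℝ≥0∞) (f : α → ℝ≥0∞) :
    expect p (fun a => c * f a) = c * expect p f := by
  simp only [expect, ← ENNReal.tsum_mul_left]
  exact tsum_congr fun a => by ring

theorem expect_mul_const (p : PMF α) (c : ℝ≥0∞) (f : α → ℝ≥0∞) :
    expect p (fun a => f a * c) = expect p f * c := by
  simp only [mul_comm _ c, expect_const_mul]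

theorem expect_sum {ι : Type} (p : PMF α) (s : Finset ι) (f : ι → α → ℝ≥0∞) :
    expect p (fun a => ∑ i ∈ s, f i a) = ∑ i ∈ s, expect p (f i) := by
  classical
  induction s using Finset.induction_on with
  | empty => simp
  | insert i s hi ih => simp only [Finset.sum_insert hi, expect_add, ih]

theorem expect_comm (p : PMF α) (r : PMF β) (f : α → β → ℝ≥0∞) :
    (expect p fun a => expect r fun b => f a b) = expect r fun b => expect p fun a => f a b := by
  simp only [expect, ← ENNReal.tsum_mul_left]
  rw [ENNReal.tsum_comm]
  exact tsum_congr fun a => tsum_congr fun b => by ring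

theorem expect_fintype [Fintype α] (p : PMF α) (f : α → ℝ≥0∞) :
    expect p f = ∑ a, p a * f a := tsum_fintype _

theorem expect_le_one {p : PMF α} {f : α → ℝ≥0∞} (h : ∀ a, f a ≤ 1) : expect p f ≤ 1 :=
  (expect_mono h).trans_eq (expect_const p 1)

theorem expect_indicator [DecidableEq α] (p : PMF α) (b : α) :
    expect p (fun a => if a = b then 1 else 0) = p b := by
  rw [expect, tsum_eq_single b]
  · simp
  · intro a ha; simp [ha]

/-- Indicators recover point masses. Equalities of distributions are proved in this form because
expectations of `bind` and `map` unfold by `simp`. -/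
theorem pmf_ext_expect {p r : PMF α} (h : ∀ f, expect p f = expect r f) : p = r := by
  classical
  ext a
  rw [← expect_indicator, h, expect_indicator]

theorem expect_uniform [Fintype α] [Nonempty α] (f : α → ℝ≥0∞) :
    expect (PMF.uniformOfFintype α) f = (Fintype.card α : ℝ≥0∞)⁻¹ * ∑ a, f a := by
  simp [expect_fintype, Finset.mul_sum]

theorem expect_uniform_equiv [Fintype α] [Nonempty α] (e : α ≃ α) (f : α → ℝ≥0∞) :
    expect (PMF.uniformOfFintype α) (fun a => f (e a)) = expect (PMF.uniformOfFintype α) f := by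
  rw [expect_uniform, expect_uniform, e.sum_comp f]

theorem map_uniform_equiv [Fintype α] [Nonempty α] [Fintype β] [Nonempty β] (e : α ≃ β) :
    (PMF.uniformOfFintype α).map e = PMF.uniformOfFintype β := by
  refine pmf_ext_expect fun f => ?_
  rw [expect_map, expect_uniform, expect_uniform, e.sum_comp f, Fintype.card_congr e]

end expect

/-! ### Independent samples -/

/-- Independent samples of `D 0, …, D (N - 1)`. -/
def indep {α : Type} : {N : ℕ} → (Fin N → PMF α) → PMF (Fin N → α)
  | 0, _ => PMF.pure Fin.elim0
  | _ + 1, D => (D 0).bind fun x => (indep fun j => D j.succ).map fun f => Fin.cons x f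

section indep
variable {α β : Type} {N : ℕ}

theorem iid_eq_indep (D : PMF α) (N : ℕ) : iid D N = indep fun _ => D := by
  induction N with
  | zero => rfl
  | succ N ih => simp only [iid, indep, ih]

theorem expect_indep_succ (D : Fin (N + 1) → PMF α) (F : (Fin (N + 1) → α) → ℝ≥0∞) :
    expect (indep D) F =
      expect (D 0) fun x => expect (indep fun j => D j.succ) fun f => F (Fin.cons x f) := by
  simp [indep]

theorem expect_indep_prod (D : Fin N → PMF α) (g : Fin N → α → ℝ≥0∞) :
    expect (indep D) (fun x => ∏ j, g j (x j)) = ∏ j, expect (D j) (g j) := by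
  induction N with
  | zero => simp [indep]
  | succ N ih =>
    rw [expect_indep_succ, Fin.prod_univ_succ, ← ih, ← expect_mul_const]
    simp only [Fin.prod_univ_succ, Fin.cons_zero, Fin.cons_succ, expect_const_mul]

theorem indep_apply (D : Fin N → PMF α) (x : Fin N → α) : indep D x = ∏ j, D j (x j) := by
  classical
  rw [← expect_indicator]
  simp_rw [← expect_indicator (D _)]
  rw [← expect_indep_prod]
  congr 1
  ext y
  rw [Fintype.prod_boole]
  simp [funext_iff]

/-- A coordinate may be replaced by a fresh copy without changing a product law. This is how one
coordinate at a time is singled out later. -/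
theorem expect_indep_resample (D : Fin N → PMF α) (i : Fin N) (F : (Fin N → α) → ℝ≥0∞) :
    (expect (D i) fun x => expect (indep D) fun y => F (Function.update y i x)) =
      expect (indep D) F := by
  induction N with
  | zero => exact i.elim0
  | succ N ih =>
    simp only [expect_indep_succ D]
    refine Fin.cases ?_ (fun i => ?_) i
    · simp only [Fin.update_cons_zero, expect_const]
    · rw [expect_comm]
      refine expect_congr fun x _ => ?_
      simp only [← Fin.cons_update]
      exact ih (fun j => D j.succ) i fun f => F (Fin.cons x f)

/-- `N` steps of a Markov chain. -/
def iter (step : ℕ → α → PMF α) : ℕ → α → PMF α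
  | 0, a => PMF.pure a
  | j + 1, a => (iter step j a).bind (step j)

/-- A chain whose `j`-th step is driven by `A j`. -/
def drive (step : β → α → PMF α) (A : Fin N → β) : ℕ → α → PMF α :=
  iter fun j a => if h : j < N then step (A ⟨j, h⟩) a else PMF.pure a

/-- After j steps the coordinates below j are independent samples and the others still come from f,
so the start is forgotten at the end. This turns a loop that fills an array into a product law. -/
theorem iter_update (D : Fin N → PMF α) (f : Fin N → α) :
    iter (fun j f => if h : j < N then (D ⟨j, h⟩).map (Function.update f ⟨j, h⟩)
      else PMF.pure f) N f = indep D := by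
  have key : ∀ j ≤ N, iter (fun j f => if h : j < N then
      (D ⟨j, h⟩).map (Function.update f ⟨j, h⟩) else PMF.pure f) j f =
      (indep D).map fun y p => if p.val < j then y p else f p := by
    intro j
    induction j with
    | zero =>
      intro _
      refine pmf_ext_expect fun G => ?_
      simp [iter]
    | succ j ih =>
      intro hj
      have hj' : j < N := hj
      refine pmf_ext_expect fun G => ?_
      rw [iter, ih hj'.le]
      simp only [hj', dite_true, expect_bind, expect_map]
      rw [expect_comm, ← expect_indep_resample D ⟨j, hj'⟩ (fun y => G _)]
      refine expect_congr fun x _ => expect_congr fun y _ => ?_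
      congr 1
      ext p
      by_cases hp : p = ⟨j, hj'⟩
      · subst hp; simp
      · have : p.val ≠ j := fun h => hp (Fin.ext h)
        have : (p.val < j + 1) = (p.val < j) := by simp; omega
        simp [Function.update_of_ne hp, this]
  rw [key N le_rfl]
  refine pmf_ext_expect fun G => ?_
  simp

/-- Deferred decisions: input j is first read at step j, so drawing it only then gives the same
average. -/
theorem expect_indep_drive (D : Fin N → PMF β) (step : β → α → PMF α) (a : α) (F : α → ℝ≥0∞) :
    (expect (indep D) fun A => expect (drive step A N a) F) =
      expect (iter (fun j a => if h : j < N then (D ⟨j, h⟩).bind fun x => step x a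
        else PMF.pure a) N a) F := by
  have key : ∀ j ≤ N, ∀ F : α → ℝ≥0∞, (expect (indep D) fun A => expect (drive step A j a) F) =
      expect (iter (fun j a => if h : j < N then (D ⟨j, h⟩).bind fun x => step x a
        else PMF.pure a) j a) F := by
    intro j
    induction j with
    | zero => intro _ F; simp [iter, drive]
    | succ j ih =>
      intro hj F
      have hj' : j < N := hj
      -- The first j steps do not see entry j, which may therefore be resampled.
      have hd : ∀ i ≤ j, ∀ A : Fin N → β, ∀ x,
          drive step (Function.update A ⟨j, hj'⟩ x) i a = drive step A i a := by
        intro i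
        induction i with
        | zero => intro _ A x; rfl
        | succ i ihi =>
          intro hi A x
          have e := ihi (by omega) A x
          have hi' : i < N := by omega
          have hne : (⟨i, hi'⟩ : Fin N) ≠ ⟨j, hj'⟩ := by simp [Fin.ext_iff]; omega
          unfold drive at e ⊢
          simp only [iter, e, hi', dite_true, Function.update_of_ne hne]
      have hs : ∀ A : Fin N → β, drive step A (j + 1) a =
          (drive step A j a).bind (step (A ⟨j, hj'⟩)) := by
        intro A
        simp [drive, iter, hj']
      simp only [hs, iter, hj', dite_true, expect_bind]
      rw [← ih hj'.le, ← expect_indep_resample D ⟨j, hj'⟩]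
      simp only [hd j le_rfl, Function.update_self]
      rw [expect_comm]
      refine expect_congr fun A _ => ?_
      rw [expect_comm]
  exact key N le_rfl F

end indep
end
end SparseLPN

namespace SparseLPN
noncomputable section

/-! ### A product inequality for blocks of a vector of fixed weight -/

section blocks
variable {k n s : ℕ}

/-- Move one unit of weight from block `b` to block `a`. -/
def shiftUnit (w : Fin k → ℕ) (a b : Fin k) : Fin k → ℕ :=
  Function.update (Function.update w a (w a + 1)) b (w b - 1)

/-- The number of ways to choose supports with the block weights `w`. -/
def chooseMass (n : ℕ) (w : Fin k → ℕ) : ℝ := ∏ i, (n.choose (w i) : ℝ)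

/-- Block weights with total weight `s`. -/
def weightVectors (k s : ℕ) : Finset (Fin k → ℕ) := Finset.piAntidiag Finset.univ s

theorem mem_weightVectors {w : Fin k → ℕ} : w ∈ weightVectors k s ↔ ∑ i, w i = s := by
  simp [weightVectors]

/-- Written without division so that it survives vanishing factors. -/
theorem prod_update_mul {w : Fin k → ℕ} (F : Fin k → ℕ → ℝ) (a : Fin k) (v : ℕ) :
    (∏ i, F i (Function.update w a v i)) * F a (w a) = (∏ i, F i (w i)) * F a v := by
  rw [← Finset.mul_prod_erase _ (fun i => F i (w i)) (Finset.mem_univ a),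
    ← Finset.mul_prod_erase _ (fun i => F i (Function.update w a v i)) (Finset.mem_univ a)]
  have : ∏ i ∈ Finset.univ.erase a, F i (Function.update w a v i) =
      ∏ i ∈ Finset.univ.erase a, F i (w i) :=
    Finset.prod_congr rfl fun i hi => by
      rw [Function.update_of_ne (Finset.ne_of_mem_erase hi)]
  rw [this, Function.update_self]
  ring

theorem prod_shiftUnit_mul {w : Fin k → ℕ} (F : Fin k → ℕ → ℝ) {a b : Fin k} (hab : a ≠ b) :
    (∏ i, F i (shiftUnit w a b i)) * (F a (w a) * F b (w b)) =
      (∏ i, F i (w i)) * (F a (w a + 1) * F b (w b - 1)) := by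
  have h1 := prod_update_mul (w := Function.update w a (w a + 1)) F b (w b - 1)
  have h2 := prod_update_mul (w := w) F a (w a + 1)
  rw [Function.update_of_ne hab.symm] at h1
  unfold shiftUnit
  linear_combination F a (w a) * h1 + F b (w b - 1) * h2

theorem shiftUnit_left {w : Fin k → ℕ} {a b : Fin k} (hab : a ≠ b) :
    shiftUnit w a b a = w a + 1 := by
  simp [shiftUnit, Function.update_of_ne hab]

theorem shiftUnit_right {w : Fin k → ℕ} {a b : Fin k} : shiftUnit w a b b = w b - 1 := by
  simp [shiftUnit]

theorem shiftUnit_other {w : Fin k → ℕ} {a b c : Fin k} (ha : c ≠ a) (hb : c ≠ b) :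
    shiftUnit w a b c = w c := by
  simp [shiftUnit, Function.update_of_ne ha, Function.update_of_ne hb]

theorem sum_shiftUnit {w : Fin k → ℕ} {a b : Fin k} (hab : a ≠ b) (hb : 0 < w b) :
    ∑ i, shiftUnit w a b i = ∑ i, w i := by
  have e1 := Finset.add_sum_erase Finset.univ w (Finset.mem_univ a)
  have hbm : b ∈ Finset.univ.erase a := by simp [hab.symm]
  have e2 := Finset.add_sum_erase _ w hbm
  have f1 := Finset.add_sum_erase Finset.univ (shiftUnit w a b) (Finset.mem_univ a)
  have f2 := Finset.add_sum_erase _ (shiftUnit w a b) hbm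
  have e3 : ∑ i ∈ (Finset.univ.erase a).erase b, shiftUnit w a b i =
      ∑ i ∈ (Finset.univ.erase a).erase b, w i :=
    Finset.sum_congr rfl fun i hi => by
      simp only [Finset.mem_erase] at hi
      exact shiftUnit_other hi.2.1 hi.1
  rw [shiftUnit_left hab] at f1
  rw [shiftUnit_right] at f2
  omega

theorem shiftUnit_shiftUnit {w : Fin k → ℕ} {a b : Fin k} (hab : a ≠ b) (hb : 0 < w b) :
    shiftUnit (shiftUnit w a b) b a = w := by
  ext i
  by_cases ha : i = a
  · subst ha; rw [shiftUnit_right, shiftUnit_left hab]; omega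
  · by_cases hb' : i = b
    · subst hb'; rw [shiftUnit_left hab.symm, shiftUnit_right]; omega
    · rw [shiftUnit_other hb' ha, shiftUnit_other ha hb']

/-- Detailed balance. A unit moves from b to a at rate (n - w a) · w b, one choice of a free place
and of an occupied one, and C(n, v+1)(v+1) = C(n, v)(n - v) matches it with the reverse move. -/
theorem chooseMass_shiftUnit {w : Fin k → ℕ} {a b : Fin k} (hab : a ≠ b) (hb : 0 < w b) :
    chooseMass n w * (((n - w a : ℕ) : ℝ) * w b) =
      chooseMass n (shiftUnit w a b) * ((n - (w b - 1) : ℕ) * ((w a : ℝ) + 1)) := by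
  -- Weights above n are allowed as indices but carry no mass; in these degenerate cases both sides
  -- vanish.
  by_cases hz : chooseMass n w = 0 ∨ n ≤ w a
  · have hl : chooseMass n w * (((n - w a : ℕ) : ℝ) * w b) = 0 := by
      rcases hz with hz | hz
      · simp [hz]
      · simp [Nat.sub_eq_zero_of_le hz]
    have hr : chooseMass n (shiftUnit w a b) * ((n - (w b - 1) : ℕ) * ((w a : ℝ) + 1)) = 0 := by
      by_cases ha : n ≤ w a
      · have : chooseMass n (shiftUnit w a b) = 0 :=
          Finset.prod_eq_zero (Finset.mem_univ a) (by
            rw [shiftUnit_left hab, Nat.choose_eq_zero_of_lt (by omega)]; simp)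
        simp [this]
      · have hz : chooseMass n w = 0 := hz.resolve_right ha
        obtain ⟨i, -, hi⟩ := Finset.prod_eq_zero_iff.1 hz
        rw [Nat.cast_eq_zero, Nat.choose_eq_zero_iff] at hi
        by_cases hib : i = b
        · subst hib; simp [show n - (w i - 1) = 0 by omega]
        · have hia : i ≠ a := by rintro rfl; omega
          have : chooseMass n (shiftUnit w a b) = 0 :=
            Finset.prod_eq_zero (Finset.mem_univ i) (by
              rw [shiftUnit_other hia hib, Nat.choose_eq_zero_of_lt hi]; simp)
          simp [this]
    rw [hl, hr]
  · push Not at hz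
    have hm : ∀ i, (n.choose (w i) : ℝ) ≠ 0 := fun i =>
      Finset.prod_ne_zero_iff.1 hz.1 i (Finset.mem_univ i)
    have h1 := prod_shiftUnit_mul (w := w) (fun _ v => (n.choose v : ℝ)) hab
    have h2 : (n.choose (w a + 1) : ℝ) * (w a + 1) = n.choose (w a) * (n - w a : ℕ) := by
      exact_mod_cast Nat.choose_succ_right_eq n (w a)
    have h3 : (n.choose (w b) : ℝ) * w b = n.choose (w b - 1) * (n - (w b - 1) : ℕ) := by
      have := Nat.choose_succ_right_eq n (w b - 1)
      rw [Nat.sub_add_cancel hb] at this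
      exact_mod_cast this
    have h4 := mul_ne_zero (hm a) (hm b)
    refine mul_right_cancel₀ h4 ?_
    simp only [chooseMass] at h1 ⊢
    linear_combination (-(n - (w b - 1) : ℕ) * ((w a : ℝ) + 1)) * h1 +
      (-(∏ i, (n.choose (w i) : ℝ)) * (n - (w b - 1) : ℕ) * (n.choose (w b - 1))) * h2 +
      (∏ i, (n.choose (w i) : ℝ)) * (n - w a : ℕ) * (n.choose (w a)) * h3

/-- Reversibility of the exchange dynamics. -/
theorem sum_exchange {a b : Fin k} (hab : a ≠ b) (G : (Fin k → ℕ) → ℝ) :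
    ∑ w ∈ weightVectors k s,
        chooseMass n w * (((n - w a : ℕ) : ℝ) * w b) * G (shiftUnit w a b) =
      ∑ w ∈ weightVectors k s, chooseMass n w * (((n - w b : ℕ) : ℝ) * w a) * G w := by
  -- The exchange is a bijection only between vectors that have a unit to give in b and those that
  -- have one in a; all others contribute zero.
  rw [← Finset.sum_filter_of_ne (p := fun w => 0 < w b),
    ← Finset.sum_filter_of_ne (s := weightVectors k s) (p := fun w => 0 < w a)]
  · refine Finset.sum_nbij' (fun w => shiftUnit w a b) (fun w => shiftUnit w b a) ?_ ?_ ?_ ?_ ?_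
    · intro w hw
      simp only [Finset.mem_filter, mem_weightVectors] at hw ⊢
      exact ⟨(sum_shiftUnit hab hw.2).trans hw.1, by rw [shiftUnit_left hab]; omega⟩
    · intro w hw
      simp only [Finset.mem_filter, mem_weightVectors] at hw ⊢
      exact ⟨(sum_shiftUnit hab.symm hw.2).trans hw.1, by rw [shiftUnit_left hab.symm]; omega⟩
    · intro w hw
      exact shiftUnit_shiftUnit hab (Finset.mem_filter.1 hw).2
    · intro w hw
      exact shiftUnit_shiftUnit hab.symm (Finset.mem_filter.1 hw).2
    · intro w hw
      rw [chooseMass_shiftUnit hab (Finset.mem_filter.1 hw).2, shiftUnit_left hab, shiftUnit_right]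
      push_cast
      ring
  · intro w _ h
    by_contra h0
    exact h (by simp [show w a = 0 by omega])
  · intro w _ h
    by_contra h0
    exact h (by simp [show w b = 0 by omega])

/-- The generator of the exchange dynamics, seen in one block. -/
def exchangeGen (k n s : ℕ) (g : ℕ → ℝ) (u : ℕ) : ℝ :=
  ((n - u : ℕ) : ℝ) * (s - u : ℕ) * (g (u + 1) - g u) +
    (if u ≤ n then (u : ℝ) * ((k - 1) * n + u - s : ℕ) else 0) * (g (u - 1) - g u)

/-- The other blocks together hold s - w i units and (k - 1) n - (s - w i) free places. The total
rates in and out of block i thus depend on its own weight alone, and the flow maps functions of one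
block to functions of one block. -/
theorem exchangeGen_apply {w : Fin k → ℕ} (hw : ∑ i, w i = s) (hn : ∀ i, w i ≤ n)
    (g : ℕ → ℝ) (i : Fin k) :
    exchangeGen k n s g (w i) =
      ∑ b ∈ Finset.univ.erase i, (((n - w i : ℕ) : ℝ) * w b * (g (w i + 1) - g (w i)) +
        ((n - w b : ℕ) : ℝ) * w i * (g (w i - 1) - g (w i))) := by
  have e1 := Finset.add_sum_erase Finset.univ w (Finset.mem_univ i)
  have c1 : ∑ b ∈ Finset.univ.erase i, w b = s - w i := by omega
  have c2 : ∑ b ∈ Finset.univ.erase i, (n - w b) = (k - 1) * n + w i - s := by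
    have : ∑ b ∈ Finset.univ.erase i, (n - w b) + ∑ b ∈ Finset.univ.erase i, w b =
        (k - 1) * n := by
      rw [← Finset.sum_add_distrib, Finset.sum_congr rfl fun b _ => Nat.sub_add_cancel (hn b)]
      simp [Finset.card_erase_of_mem]
    omega
  rw [exchangeGen, if_pos (hn i), ← c1, ← c2, Finset.sum_add_distrib, ← Finset.sum_mul,
    ← Finset.sum_mul, ← Finset.mul_sum, ← Finset.sum_mul]
  push_cast
  ring

end blocks
end
end SparseLPN

/-! ### The gain of an exchange and rigidity when no exchange gains -/

namespace SparseLPN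
noncomputable section

section blocks
variable {k n s : ℕ}

theorem sum_pairs_swap {M : Type} [AddCommMonoid M] (T : Fin k → Fin k → M) :
    ∑ a, ∑ b ∈ Finset.univ.erase a, T a b = ∑ a, ∑ b ∈ Finset.univ.erase a, T b a := by
  refine Finset.sum_comm' fun x y => ?_
  simp [eq_comm]

/-- Stationarity: detailed balance summed over ordered pairs, where renaming a and b turns reverse
rates into forward ones. -/
theorem sum_exchange_pairs (G : (Fin k → ℕ) → ℝ) :
    ∑ w ∈ weightVectors k s, ∑ a, ∑ b ∈ Finset.univ.erase a,
        chooseMass n w * (((n - w a : ℕ) : ℝ) * w b) * G (shiftUnit w a b) =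
      ∑ w ∈ weightVectors k s, ∑ a, ∑ b ∈ Finset.univ.erase a,
        chooseMass n w * (((n - w a : ℕ) : ℝ) * w b) * G w := by
  have comm : ∀ T : (Fin k → ℕ) → Fin k → Fin k → ℝ,
      ∑ w ∈ weightVectors k s, ∑ a, ∑ b ∈ Finset.univ.erase a, T w a b =
      ∑ a, ∑ b ∈ Finset.univ.erase a, ∑ w ∈ weightVectors k s, T w a b := by
    intro T
    rw [Finset.sum_comm]
    exact Finset.sum_congr rfl fun a _ => Finset.sum_comm
  rw [comm, comm, sum_pairs_swap fun a b => ∑ w ∈ weightVectors k s,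
    chooseMass n w * (((n - w a : ℕ) : ℝ) * w b) * G w]
  refine Finset.sum_congr rfl fun a _ => Finset.sum_congr rfl fun b hb => ?_
  exact sum_exchange (Finset.ne_of_mem_erase hb).symm G

/-- The product of the square roots of functions of the blocks. -/
def prodSqrt (h : Fin k → ℕ → ℝ) (w : Fin k → ℕ) : ℝ := ∏ i, √(h i (w i))

theorem chooseMass_nonneg (w : Fin k → ℕ) : 0 ≤ chooseMass n w :=
  Finset.prod_nonneg fun _ _ => Nat.cast_nonneg _

theorem chooseMass_pos {w : Fin k → ℕ} (hw : ∀ i, w i ≤ n) : 0 < chooseMass n w :=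
  Finset.prod_pos fun i _ => Nat.cast_pos.2 (Nat.choose_pos (hw i))

theorem chooseMass_eq_zero {w : Fin k → ℕ} (hw : ¬∀ i, w i ≤ n) : chooseMass n w = 0 := by
  push Not at hw
  obtain ⟨i, hi⟩ := hw
  exact Finset.prod_eq_zero (Finset.mem_univ i) (by simp [Nat.choose_eq_zero_of_lt hi])

/-- The gain of `prodSqrt` along one exchange. -/
def exchangeGain (n : ℕ) (h : Fin k → ℕ → ℝ) (w : Fin k → ℕ) (a b : Fin k) : ℝ :=
  chooseMass n w * (((n - w a : ℕ) : ℝ) * w b) *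
    (prodSqrt h w * (h a (w a + 1) / h a (w a) + h b (w b - 1) / h b (w b)) -
      2 * prodSqrt h (shiftUnit w a b))

theorem prodSqrt_shiftUnit {h : Fin k → ℕ → ℝ} (hp : ∀ i u, 0 < h i u) (w : Fin k → ℕ)
    {a b : Fin k} (hab : a ≠ b) :
    prodSqrt h (shiftUnit w a b) =
      prodSqrt h w * (√(h a (w a + 1) / h a (w a)) * √(h b (w b - 1) / h b (w b))) := by
  have e := prod_shiftUnit_mul (w := w) (fun i u => √(h i u)) hab
  have ha := Real.sqrt_pos.2 (hp a (w a))
  have hb := Real.sqrt_pos.2 (hp b (w b))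
  rw [Real.sqrt_div (hp _ _).le, Real.sqrt_div (hp _ _).le]
  unfold prodSqrt
  field_simp
  linarith

/-- x² + y² - 2xy = (x - y)² for the square roots x, y of the two ratios; the cross term is the
value after the exchange. -/
theorem exchangeGain_eq {h : Fin k → ℕ → ℝ} (hp : ∀ i u, 0 < h i u) (w : Fin k → ℕ)
    {a b : Fin k} (hab : a ≠ b) :
    exchangeGain n h w a b = chooseMass n w * (((n - w a : ℕ) : ℝ) * w b) * (prodSqrt h w *
      (√(h a (w a + 1) / h a (w a)) - √(h b (w b - 1) / h b (w b))) ^ 2) := by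
  rw [exchangeGain, prodSqrt_shiftUnit hp w hab]
  have h1 := Real.sq_sqrt (div_pos (hp a (w a + 1)) (hp a (w a))).le
  have h2 := Real.sq_sqrt (div_pos (hp b (w b - 1)) (hp b (w b))).le
  linear_combination (-chooseMass n w * (((n - w a : ℕ) : ℝ) * w b) * prodSqrt h w) * (h1 + h2)

theorem prodSqrt_pos {h : Fin k → ℕ → ℝ} (hp : ∀ i u, 0 < h i u) (w : Fin k → ℕ) :
    0 < prodSqrt h w := Finset.prod_pos fun i _ => Real.sqrt_pos.2 (hp i (w i))

theorem exchangeGain_nonneg {h : Fin k → ℕ → ℝ} (hp : ∀ i u, 0 < h i u) (w : Fin k → ℕ)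
    {a b : Fin k} (hab : a ≠ b) : 0 ≤ exchangeGain n h w a b := by
  rw [exchangeGain_eq hp w hab]
  have := chooseMass_nonneg (n := n) w
  have := (prodSqrt_pos hp w).le
  positivity

/-- The derivative of the expectation of `prodSqrt` along the exchange dynamics. -/
theorem sum_gen_eq_sum_gain {h : Fin k → ℕ → ℝ} :
    ∑ w ∈ weightVectors k s, chooseMass n w *
        ∑ i, prodSqrt h w / h i (w i) * exchangeGen k n s (h i) (w i) =
      ∑ w ∈ weightVectors k s, ∑ a, ∑ b ∈ Finset.univ.erase a,
        (chooseMass n w * (((n - w a : ℕ) : ℝ) * w b) * (prodSqrt h w *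
          (h a (w a + 1) / h a (w a) - h a (w a) / h a (w a) +
            (h b (w b - 1) / h b (w b) - h b (w b) / h b (w b))))) := by
  refine Finset.sum_congr rfl fun w hw => ?_
  rw [mem_weightVectors] at hw
  by_cases hn : ∀ i, w i ≤ n
  · simp_rw [exchangeGen_apply hw hn, Finset.mul_sum, mul_add, Finset.sum_add_distrib]
    congr 1
    · refine Finset.sum_congr rfl fun a _ => Finset.sum_congr rfl fun b _ => ?_
      ring
    · rw [sum_pairs_swap]
      refine Finset.sum_congr rfl fun a _ => Finset.sum_congr rfl fun b _ => ?_
      ring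
  · simp [chooseMass_eq_zero hn]

/-- The derivative subtracts 2 · `prodSqrt h w`; by stationarity the sum is unchanged when this is
replaced by the value after the exchange, and the completed squares appear. -/
theorem sum_gen_eq {h : Fin k → ℕ → ℝ} (hp : ∀ i u, 0 < h i u) :
    ∑ w ∈ weightVectors k s, chooseMass n w *
        ∑ i, prodSqrt h w / h i (w i) * exchangeGen k n s (h i) (w i) =
      ∑ w ∈ weightVectors k s, ∑ a, ∑ b ∈ Finset.univ.erase a, exchangeGain n h w a b := by
  rw [sum_gen_eq_sum_gain]
  have e := sum_exchange_pairs (k := k) (n := n) (s := s) (prodSqrt h)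
  simp only [exchangeGain, mul_sub, Finset.sum_sub_distrib]
  have e2 : ∀ w : Fin k → ℕ, ∀ a b, chooseMass n w * (((n - w a : ℕ) : ℝ) * w b) *
      (2 * prodSqrt h (shiftUnit w a b)) = 2 * (chooseMass n w * (((n - w a : ℕ) : ℝ) * w b) *
      prodSqrt h (shiftUnit w a b)) := fun _ _ _ => by ring
  simp only [e2, ← Finset.mul_sum]
  rw [e]
  simp only [Finset.mul_sum, ← Finset.sum_sub_distrib]
  refine Finset.sum_congr rfl fun w _ => Finset.sum_congr rfl fun a _ =>
    Finset.sum_congr rfl fun b _ => ?_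
  rw [div_self (hp _ _).ne', div_self (hp _ _).ne']
  ring

/-- A sum of nonnegative gains that is at most zero vanishes termwise. Mass and rate are positive
for an admissible move, so the square itself is zero. -/
theorem ratio_eq_of_sum_gen_nonpos {h : Fin k → ℕ → ℝ} (hp : ∀ i u, 0 < h i u)
    (hD : ∑ w ∈ weightVectors k s, chooseMass n w *
      ∑ i, prodSqrt h w / h i (w i) * exchangeGen k n s (h i) (w i) ≤ 0)
    {w : Fin k → ℕ} (hw : ∑ i, w i = s) (hn : ∀ i, w i ≤ n) {a b : Fin k} (hab : a ≠ b)
    (ha : w a < n) (hb : 0 < w b) :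
    h a (w a + 1) * h b (w b) = h b (w b - 1) * h a (w a) := by
  rw [sum_gen_eq hp] at hD
  have nn : ∀ w a, ∀ b ∈ Finset.univ.erase a, 0 ≤ exchangeGain n h w a b :=
    fun w a b hb => exchangeGain_nonneg hp w (Finset.ne_of_mem_erase hb).symm
  have h0 := le_antisymm hD (Finset.sum_nonneg fun w _ => Finset.sum_nonneg fun a _ =>
    Finset.sum_nonneg (nn w a))
  rw [Finset.sum_eq_zero_iff_of_nonneg fun w _ => Finset.sum_nonneg fun a _ =>
    Finset.sum_nonneg (nn w a)] at h0
  have h1 := h0 w (mem_weightVectors.2 hw)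
  rw [Finset.sum_eq_zero_iff_of_nonneg fun a _ => Finset.sum_nonneg (nn w a)] at h1
  have h2 := h1 a (Finset.mem_univ a)
  rw [Finset.sum_eq_zero_iff_of_nonneg (nn w a)] at h2
  have h3 := h2 b (by simp [hab.symm])
  rw [exchangeGain_eq hp w hab] at h3
  have m := chooseMass_pos hn
  have m2 : (0 : ℝ) < (n - w a : ℕ) := Nat.cast_pos.2 (by omega)
  have m3 : (0 : ℝ) < w b := Nat.cast_pos.2 hb
  have m4 := prodSqrt_pos hp w
  have h4 : √(h a (w a + 1) / h a (w a)) - √(h b (w b - 1) / h b (w b)) = 0 := by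
    by_contra hne
    have : 0 < (√(h a (w a + 1) / h a (w a)) - √(h b (w b - 1) / h b (w b))) ^ 2 := by positivity
    have := mul_pos (mul_pos m (mul_pos m2 m3)) (mul_pos m4 this)
    linarith
  have h5 := Real.sqrt_inj (div_pos (hp a (w a + 1)) (hp a (w a))).le
    (div_pos (hp b (w b - 1)) (hp b (w b))).le |>.1 (sub_eq_zero.1 h4)
  rwa [div_eq_div_iff (hp _ _).ne' (hp _ _).ne'] at h5

/-- If exchanges change the values of any two blocks by the same ratio, they do not change them. -/
theorem value_eq_of_ratio_eq {h : Fin k → ℕ → ℝ} (hp : ∀ i u, 0 < h i u) (hk : 3 ≤ k)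
    (hn0 : 0 < n)
    (hr : ∀ w : Fin k → ℕ, ∑ i, w i = s → (∀ i, w i ≤ n) → ∀ a b, a ≠ b → w a < n → 0 < w b →
      h a (w a + 1) * h b (w b) = h b (w b - 1) * h a (w a))
    {w : Fin k → ℕ} (hw : ∑ i, w i = s) (hn : ∀ i, w i ≤ n) {a b : Fin k} (hab : a ≠ b)
    (ha : w a < n) (hb : 0 < w b) :
    h a (w a + 1) = h a (w a) ∧ h b (w b - 1) = h b (w b) := by
  -- A third block is what three or more blocks are needed for. Let ρ be the ratio by which the move
  -- from b to a changes the value of a. Routing the unit through c shows that ρ equals its own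
  -- inverse, so ρ = 1.
  obtain ⟨c, -, hc⟩ := Finset.exists_mem_notMem_of_card_lt_card
    (s := {a, b}) (t := (Finset.univ : Finset (Fin k)))
    (lt_of_le_of_lt Finset.card_le_two (by rw [Finset.card_univ, Fintype.card_fin]; omega))
  simp only [Finset.mem_insert, Finset.mem_singleton, not_or] at hc
  obtain ⟨hca, hcb⟩ := hc
  have good : ∀ x y : Fin k, x ≠ y → w x < n → 0 < w y → ∑ i, shiftUnit w x y i = s ∧
      ∀ i, shiftUnit w x y i ≤ n := by
    intro x y hxy hx hy
    refine ⟨(sum_shiftUnit hxy hy).trans hw, fun i => ?_⟩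
    by_cases hix : i = x
    · subst hix; rw [shiftUnit_left hxy]; omega
    · by_cases hiy : i = y
      · subst hiy; rw [shiftUnit_right]; have := hn i; omega
      · rw [shiftUnit_other hix hiy]; exact hn i
  have r0 := hr w hw hn a b hab ha hb
  have pa := hp a (w a)
  have pa1 := hp a (w a + 1)
  have pb := hp b (w b)
  have pb1 := hp b (w b - 1)
  have key : h a (w a + 1) = h a (w a) := by
    by_cases hcn : w c < n
    · have r1 := hr w hw hn c b hcb hcn hb
      obtain ⟨g1, g2⟩ := good c b hcb hcn hb
      have r2 := hr _ g1 g2 a c (Ne.symm hca)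
        (by rw [shiftUnit_other (Ne.symm hca) hab]; exact ha) (by rw [shiftUnit_left hcb]; omega)
      rw [shiftUnit_other (Ne.symm hca) hab, shiftUnit_left hcb] at r2
      simp only [Nat.add_sub_cancel] at r2
      have pc := hp c (w c)
      have pc1 := hp c (w c + 1)
      -- `A B = B' A'`, `C B = B' C'`, `A C = C' A'`
      have e : h a (w a + 1) * h a (w a + 1) = h a (w a) * h a (w a) := by
        have : (h a (w a + 1) * h a (w a + 1)) * (h b (w b) * h c (w c + 1)) =
            (h a (w a) * h a (w a)) * (h b (w b) * h c (w c + 1)) := by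
          linear_combination (h a (w a + 1) * h c (w c + 1)) * r0 + (h b (w b - 1) * h a (w a)) * r2
            - (h a (w a) * h a (w a)) * r1
        exact mul_right_cancel₀ (mul_pos pb pc1).ne' this
      nlinarith
    -- A full c cannot receive first, so the detour is taken in the other order: c gives to a and is
    -- then refilled from b.
    · have hc0 : 0 < w c := by omega
      have r1 := hr w hw hn a c (Ne.symm hca) ha hc0
      obtain ⟨g1, g2⟩ := good a c (Ne.symm hca) ha hc0
      have r2 := hr _ g1 g2 c b hcb (by rw [shiftUnit_right]; have := hn c; omega)
        (by rw [shiftUnit_other hab.symm (Ne.symm hcb)]; exact hb)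
      rw [shiftUnit_other hab.symm (Ne.symm hcb), shiftUnit_right, Nat.sub_add_cancel hc0] at r2
      have pc := hp c (w c)
      have pc1 := hp c (w c - 1)
      have e : h a (w a + 1) * h a (w a + 1) = h a (w a) * h a (w a) := by
        have : (h a (w a + 1) * h a (w a + 1)) * (h b (w b) * h c (w c)) =
            (h a (w a) * h a (w a)) * (h b (w b) * h c (w c)) := by
          linear_combination (h a (w a + 1) * h c (w c)) * r0 + (h b (w b - 1) * h a (w a)) * r1
            - (h a (w a) * h a (w a)) * r2
        exact mul_right_cancel₀ (mul_pos pb pc).ne' this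
      nlinarith
  refine ⟨key, ?_⟩
  rw [key] at r0
  exact (mul_left_cancel₀ pa.ne' (by linarith)).symm

/-- Admissible weight vectors are connected by exchanges. As long as w differs from the target, some
block has too little and another too much, and moving a unit between them lowers the total deficit.
-/
theorem value_const {h : Fin k → ℕ → ℝ}
    (hv : ∀ w : Fin k → ℕ, ∑ i, w i = s → (∀ i, w i ≤ n) → ∀ a b, a ≠ b → w a < n → 0 < w b →
      h a (w a + 1) = h a (w a) ∧ h b (w b - 1) = h b (w b))
    {w w' : Fin k → ℕ} (hw : ∑ i, w i = s) (hn : ∀ i, w i ≤ n) (hw' : ∑ i, w' i = s)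
    (hn' : ∀ i, w' i ≤ n) (i : Fin k) : h i (w i) = h i (w' i) := by
  induction hd : ∑ i, (w' i - w i) using Nat.strong_induction_on generalizing w with
  | _ d ih =>
    by_cases hall : ∀ i, w' i ≤ w i
    · rw [((Finset.sum_eq_sum_iff_of_le fun i _ => hall i).1 (hw'.trans hw.symm)) i
        (Finset.mem_univ i)]
    · push Not at hall
      obtain ⟨a, ha⟩ := hall
      obtain ⟨b, hb⟩ : ∃ b, w' b < w b := by
        by_contra hcon
        push Not at hcon
        have := (Finset.sum_eq_sum_iff_of_le fun i _ => hcon i).1 (hw.trans hw'.symm) a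
          (Finset.mem_univ a)
        omega
      have hab : a ≠ b := by rintro rfl; omega
      have h1 := hn' a
      obtain ⟨va, vb⟩ := hv w hw hn a b hab (by omega) (by omega)
      have e : h i (w i) = h i (shiftUnit w a b i) := by
        by_cases hia : i = a
        · subst hia; rw [shiftUnit_left hab, va]
        · by_cases hib : i = b
          · subst hib; rw [shiftUnit_right, vb]
          · rw [shiftUnit_other hia hib]
      rw [e]
      refine ih _ ?_ ((sum_shiftUnit hab (by omega)).trans hw) (fun i => ?_) rfl
      · rw [← hd]
        refine Finset.sum_lt_sum (fun i _ => ?_) ⟨a, Finset.mem_univ a, ?_⟩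
        · by_cases hia : i = a
          · subst hia; rw [shiftUnit_left hab]; omega
          · by_cases hib : i = b
            · subst hib; rw [shiftUnit_right]; omega
            · rw [shiftUnit_other hia hib]
        · rw [shiftUnit_left hab]; omega
      · by_cases hia : i = a
        · subst hia; rw [shiftUnit_left hab]; omega
        · by_cases hib : i = b
          · subst hib; rw [shiftUnit_right]; have := hn i; omega
          · rw [shiftUnit_other hia hib]; exact hn i

end blocks
end
end SparseLPN

/-! ### The extremal argument for functions of block weights -/

namespace SparseLPN
noncomputable section

section blocks
variable {k n s : ℕ}

/-- By detailed balance each move into block i cancels the opposite move out of it. Perturbing along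
the generator therefore respects the constraints that fix the means. -/
theorem sum_exchangeGen (g : ℕ → ℝ) (i : Fin k) :
    ∑ w ∈ weightVectors k s, chooseMass n w * exchangeGen k n s g (w i) = 0 := by
  have h1 : ∑ w ∈ weightVectors k s, chooseMass n w * exchangeGen k n s g (w i) =
      ∑ w ∈ weightVectors k s, ∑ b ∈ Finset.univ.erase i, (chooseMass n w *
        (((n - w i : ℕ) : ℝ) * w b) * (g (w i + 1) - g (w i)) +
        chooseMass n w * (((n - w b : ℕ) : ℝ) * w i) * (g (w i - 1) - g (w i))) := by
    refine Finset.sum_congr rfl fun w hw => ?_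
    rw [mem_weightVectors] at hw
    by_cases hn : ∀ i, w i ≤ n
    · rw [exchangeGen_apply hw hn, Finset.mul_sum]
      exact Finset.sum_congr rfl fun b _ => by ring
    · simp [chooseMass_eq_zero hn]
  rw [h1, Finset.sum_comm]
  refine Finset.sum_eq_zero fun b hb => ?_
  have hbi := Finset.ne_of_mem_erase hb
  have e1 := sum_exchange (k := k) (n := n) (s := s) hbi.symm
    fun w => g (w i - 1) - g (w i)
  simp only [shiftUnit_left hbi.symm, Nat.add_sub_cancel] at e1
  rw [Finset.sum_add_distrib, ← e1, ← Finset.sum_add_distrib]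
  exact Finset.sum_eq_zero fun w _ => by ring

/-- A small Euler step replaces g u by a convex combination of g u and its two neighbours, so the
values stay in the interval. The cut-off u ≤ n in the generator makes the rates bounded uniformly in
u. -/
theorem exchangeGen_step {g : ℕ → ℝ} {δ R τ : ℝ} (hg : ∀ u, g u ∈ Set.Icc δ R) (h0 : 0 ≤ τ)
    (h1 : τ * ((n : ℝ) * s + n * (k * n + n)) ≤ 1) (u : ℕ) :
    g u + τ * exchangeGen k n s g u ∈ Set.Icc δ R := by
  set p : ℝ := ((n - u : ℕ) : ℝ) * (s - u : ℕ) with hp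
  set r : ℝ := if u ≤ n then (u : ℝ) * ((k - 1) * n + u - s : ℕ) else 0 with hr
  have p0 : 0 ≤ p := by positivity
  have p1 : p ≤ (n : ℝ) * s := by
    rw [hp]
    gcongr <;> omega
  have r0 : 0 ≤ r := by rw [hr]; split_ifs <;> positivity
  have r1 : r ≤ (n : ℝ) * (k * n + n) := by
    rw [hr]
    split_ifs with hu
    · have : (((k - 1) * n + u - s : ℕ) : ℝ) ≤ (k * n + n : ℕ) := by
        rw [Nat.cast_le]
        have : (k - 1) * n ≤ k * n := Nat.mul_le_mul_right n (by omega)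
        omega
      push_cast at this
      gcongr
    · positivity
  have e : g u + τ * exchangeGen k n s g u =
      (1 - τ * p - τ * r) * g u + τ * p * g (u + 1) + τ * r * g (u - 1) := by
    rw [exchangeGen]; ring
  have q0 : 0 ≤ 1 - τ * p - τ * r := by nlinarith
  have tp := mul_nonneg h0 p0
  have tr := mul_nonneg h0 r0
  obtain ⟨a1, a2⟩ := hg u
  obtain ⟨b1, b2⟩ := hg (u + 1)
  obtain ⟨c1, c2⟩ := hg (u - 1)
  rw [e]
  constructor <;> nlinarith

theorem hasDerivAt_prodSqrt {h G : Fin k → ℕ → ℝ} (hp : ∀ i u, 0 < h i u) (w : Fin k → ℕ) :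
    HasDerivAt (fun τ : ℝ => prodSqrt (fun i u => h i u + τ * G i u) w)
      (∑ i, prodSqrt h w / h i (w i) * G i (w i) / 2) 0 := by
  have h1 : ∀ i ∈ (Finset.univ : Finset (Fin k)),
      HasDerivAt (fun τ : ℝ => √(h i (w i) + τ * G i (w i)))
        (G i (w i) / (2 * √(h i (w i)))) 0 := by
    intro i _
    have h2 : HasDerivAt (fun τ : ℝ => h i (w i) + τ * G i (w i)) (G i (w i)) 0 := by
      simpa using ((hasDerivAt_id (0 : ℝ)).mul_const (G i (w i))).const_add (h i (w i))
    have := h2.sqrt (by simpa using (hp i (w i)).ne')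
    simpa using this
  have h3 := HasDerivAt.fun_finsetProd h1
  refine h3.congr_deriv (Finset.sum_congr rfl fun i _ => ?_)
  have e := Finset.mul_prod_erase Finset.univ (fun i => √(h i (w i))) (Finset.mem_univ i)
  have sp := Real.sqrt_pos.2 (hp i (w i))
  have sq := Real.mul_self_sqrt (hp i (w i)).le
  simp only [zero_mul, add_zero, smul_eq_mul, prodSqrt]
  rw [← e]
  have hne := (hp i (w i)).ne'
  field_simp
  rw [Real.sq_sqrt (hp i (w i)).le]

theorem deriv_nonpos_of_max {φ : ℝ → ℝ} {D τ₀ : ℝ} (hd : HasDerivAt φ D 0) (h0 : 0 < τ₀)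
    (hm : ∀ τ, 0 ≤ τ → τ ≤ τ₀ → φ τ ≤ φ 0) : D ≤ 0 := by
  have h1 := (hasDerivAt_iff_tendsto_slope.1 hd).mono_left
    (nhdsWithin_mono (0 : ℝ) (s := Set.Ioi 0) fun x hx => (ne_of_gt hx : x ≠ 0))
  refine le_of_tendsto h1 ?_
  filter_upwards [Ioo_mem_nhdsGT h0] with τ hτ
  rw [slope_def_field]
  have := hm τ hτ.1.le hτ.2.le
  exact div_nonpos_of_nonpos_of_nonneg (by linarith) (by linarith [hτ.1])

/-- Maximise the left side over all tuples with values in [δ, R] and the same means. An Euler step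
along the generator is a legal competitor, so the derivative there is at most zero. It is also a sum
of squares, hence all gains vanish and the maximiser is constant on each block, where both sides
agree. The lower bound δ > 0 keeps the square roots differentiable. -/
theorem sum_prodSqrt_le_of_bounds (hk : 3 ≤ k) (hn : 0 < n)
    {h : Fin k → ℕ → ℝ} {δ R : ℝ} (hδ : 0 < δ) (hh : ∀ i u, h i u ∈ Set.Icc δ R) :
    ∑ w ∈ weightVectors k s, chooseMass n w * prodSqrt h w ≤
      (∑ w ∈ weightVectors k s, chooseMass n w) *
        ∏ i, √((∑ w ∈ weightVectors k s, chooseMass n w * h i (w i)) /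
          ∑ w ∈ weightVectors k s, chooseMass n w) := by
  classical
  set Ω := weightVectors k s with hΩ
  set D : Set (Fin k → ℕ → ℝ) := {g | (∀ i u, g i u ∈ Set.Icc δ R) ∧
    ∀ i, ∑ w ∈ Ω, chooseMass n w * g i (w i) = ∑ w ∈ Ω, chooseMass n w * h i (w i)} with hD
  -- Tychonoff: a closed set of linear constraints inside a product of intervals.
  have hDc : IsCompact D := by
    have c1 : IsCompact (Set.pi Set.univ fun _ : Fin k => Set.pi Set.univ
        fun _ : ℕ => Set.Icc δ R) :=
      isCompact_univ_pi fun _ => isCompact_univ_pi fun _ => isCompact_Icc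
    have c2 : IsClosed {g : Fin k → ℕ → ℝ | ∀ i, ∑ w ∈ Ω, chooseMass n w * g i (w i) =
        ∑ w ∈ Ω, chooseMass n w * h i (w i)} := by
      simp only [Set.ofPred_forall]
      exact isClosed_iInter fun i => isClosed_eq (by fun_prop) continuous_const
    have : D = (Set.pi Set.univ fun _ : Fin k => Set.pi Set.univ fun _ : ℕ => Set.Icc δ R) ∩
        {g | ∀ i, ∑ w ∈ Ω, chooseMass n w * g i (w i) =
          ∑ w ∈ Ω, chooseMass n w * h i (w i)} := by
      ext g
      exact ⟨fun h => ⟨fun i _ u _ => h.1 i u, h.2⟩,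
        fun h => ⟨fun i u => h.1 i trivial u trivial, h.2⟩⟩
    rw [this]
    exact c1.inter_right c2
  have hcont : Continuous fun g : Fin k → ℕ → ℝ => ∑ w ∈ Ω, chooseMass n w * prodSqrt g w := by
    unfold prodSqrt
    fun_prop
  obtain ⟨g, hgD, hgm⟩ := hDc.exists_isMaxOn ⟨h, hh, fun _ => rfl⟩ hcont.continuousOn
  refine (hgm (⟨hh, fun _ => rfl⟩ : h ∈ D)).trans ?_
  have gp : ∀ i u, 0 < g i u := fun i u => hδ.trans_le (hgD.1 i u).1
  set G : Fin k → ℕ → ℝ := fun i u => exchangeGen k n s (g i) u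
  have hder : HasDerivAt (fun τ : ℝ => ∑ w ∈ Ω, chooseMass n w *
      prodSqrt (fun i u => g i u + τ * G i u) w)
      (∑ w ∈ Ω, chooseMass n w * ∑ i, prodSqrt g w / g i (w i) * G i (w i) / 2) 0 :=
    HasDerivAt.fun_sum fun w _ => (hasDerivAt_prodSqrt gp w).const_mul _
  -- The inverse of this bound on the rates is the admissible step size; the 1 avoids division by
  -- zero.
  have hB : 0 < 1 + ((n : ℝ) * s + n * (k * n + n)) := by positivity
  have hle := deriv_nonpos_of_max hder (inv_pos.2 hB) fun τ t0 t1 => by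
    have hmem : (fun i u => g i u + τ * G i u) ∈ D := by
      refine ⟨fun i u => exchangeGen_step (hgD.1 i) t0 ?_ u, fun i => ?_⟩
      · have : τ * (1 + ((n : ℝ) * s + n * (k * n + n))) ≤ 1 := by
          calc _ ≤ (1 + ((n : ℝ) * s + n * (k * n + n)))⁻¹ *
              (1 + ((n : ℝ) * s + n * (k * n + n))) := by gcongr
            _ = 1 := inv_mul_cancel₀ hB.ne'
        linarith
      · rw [← hgD.2 i]
        have := sum_exchangeGen (n := n) (s := s) (g i) i
        simp only [mul_add, Finset.sum_add_distrib]
        have e : ∑ w ∈ Ω, chooseMass n w * (τ * G i (w i)) =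
            τ * ∑ w ∈ Ω, chooseMass n w * exchangeGen k n s (g i) (w i) := by
          rw [Finset.mul_sum]
          exact Finset.sum_congr rfl fun w _ => by simp only [G]; ring
        rw [e, this]; ring
    simpa using hgm hmem
  have hle' : ∑ w ∈ weightVectors k s, chooseMass n w *
      ∑ i, prodSqrt g w / g i (w i) * exchangeGen k n s (g i) (w i) ≤ 0 := by
    have : ∑ w ∈ Ω, chooseMass n w * ∑ i, prodSqrt g w / g i (w i) * G i (w i) / 2 =
        (∑ w ∈ weightVectors k s, chooseMass n w *
          ∑ i, prodSqrt g w / g i (w i) * exchangeGen k n s (g i) (w i)) / 2 := by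
      simp only [← Finset.sum_div, mul_div_assoc']
      rfl
    linarith
  have hv := fun (w : Fin k → ℕ) (hw : ∑ i, w i = s) hwn a b hab ha hb =>
    value_eq_of_ratio_eq gp hk hn (fun w hw hn a b hab ha hb =>
      ratio_eq_of_sum_gen_nonpos gp hle' hw hn hab ha hb) hw hwn (a := a) (b := b) hab ha hb
  -- If s exceeds kn there are no admissible weights, all masses are zero and so are both sides.
  by_cases hex : ∃ w : Fin k → ℕ, ∑ i, w i = s ∧ ∀ i, w i ≤ n
  · obtain ⟨w₀, hw₀, hn₀⟩ := hex
    have hconst : ∀ w ∈ Ω, ∀ i, chooseMass n w * g i (w i) = chooseMass n w * g i (w₀ i) := by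
      intro w hw i
      by_cases hwn : ∀ i, w i ≤ n
      · rw [value_const hv (mem_weightVectors.1 hw) hwn hw₀ hn₀ i]
      · simp [chooseMass_eq_zero hwn]
    have hZ : 0 < ∑ w ∈ Ω, chooseMass n w :=
      Finset.sum_pos' (fun w _ => chooseMass_nonneg w)
        ⟨w₀, mem_weightVectors.2 hw₀, chooseMass_pos hn₀⟩
    have e1 : ∀ i, (∑ w ∈ Ω, chooseMass n w * h i (w i)) / ∑ w ∈ Ω, chooseMass n w =
        g i (w₀ i) := by
      intro i
      rw [← hgD.2 i, Finset.sum_congr rfl fun w hw => hconst w hw i, ← Finset.sum_mul]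
      field_simp
    have e2 : ∀ w ∈ Ω, chooseMass n w * prodSqrt g w = chooseMass n w * prodSqrt g w₀ := by
      intro w hw
      by_cases hwn : ∀ i, w i ≤ n
      · unfold prodSqrt
        simp_rw [value_const hv (mem_weightVectors.1 hw) hwn hw₀ hn₀]
      · simp [chooseMass_eq_zero hwn]
    simp_rw [e1]
    rw [Finset.sum_congr rfl e2, ← Finset.sum_mul]
    rfl
  · have hz : ∀ w ∈ Ω, chooseMass n w = 0 := fun w hw => chooseMass_eq_zero fun hn =>
      hex ⟨w, mem_weightVectors.1 hw, hn⟩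
    beta_reduce
    rw [Finset.sum_eq_zero hz, zero_mul]
    exact (Finset.sum_eq_zero fun w hw => by rw [hz w hw, zero_mul]).le

/-- Only the finitely many values at u ≤ n matter, which provides an upper bound; the positive lower
bound is removed by letting δ tend to 0. -/
theorem sum_prodSqrt_le (hk : 3 ≤ k) (hn : 0 < n)
    {h : Fin k → ℕ → ℝ} (hh : ∀ i u, 0 ≤ h i u) :
    ∑ w ∈ weightVectors k s, chooseMass n w * prodSqrt h w ≤
      (∑ w ∈ weightVectors k s, chooseMass n w) *
        ∏ i, √((∑ w ∈ weightVectors k s, chooseMass n w * h i (w i)) /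
          ∑ w ∈ weightVectors k s, chooseMass n w) := by
  set R : ℝ := ∑ i, ∑ u ∈ Finset.range (n + 1), h i u with hR
  have hle : ∀ i, ∀ u ≤ n, h i u ≤ R := fun i u hu =>
    (Finset.single_le_sum (f := fun u => h i u) (fun u _ => hh i u)
      (Finset.mem_range.2 (Nat.lt_succ_of_le hu))).trans
      (Finset.single_le_sum (f := fun i => ∑ u ∈ Finset.range (n + 1), h i u)
        (fun i _ => Finset.sum_nonneg fun u _ => hh i u) (Finset.mem_univ i))
  have hR0 : 0 ≤ R := Finset.sum_nonneg fun i _ => Finset.sum_nonneg fun u _ => hh i u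
  -- shift `h` up by `δ` and cut it off beyond `n`
  let H : ℝ → Fin k → ℕ → ℝ := fun δ i u => (if u ≤ n then h i u else 0) + δ
  have key : ∀ δ : ℝ, 0 < δ → ∑ w ∈ weightVectors k s, chooseMass n w * prodSqrt (H δ) w ≤
      (∑ w ∈ weightVectors k s, chooseMass n w) *
        ∏ i, √((∑ w ∈ weightVectors k s, chooseMass n w * H δ i (w i)) /
          ∑ w ∈ weightVectors k s, chooseMass n w) := by
    intro δ hδ
    refine sum_prodSqrt_le_of_bounds hk hn hδ (R := R + δ) fun i u => ?_
    simp only [H]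
    split_ifs with hu
    · exact ⟨by linarith [hh i u], by linarith [hle i u hu]⟩
    · exact ⟨by linarith, by linarith⟩
  have c1 : Continuous fun δ => ∑ w ∈ weightVectors k s, chooseMass n w * prodSqrt (H δ) w := by
    simp only [prodSqrt, H]
    fun_prop
  have c2 : Continuous fun δ => (∑ w ∈ weightVectors k s, chooseMass n w) *
      ∏ i, √((∑ w ∈ weightVectors k s, chooseMass n w * H δ i (w i)) /
          ∑ w ∈ weightVectors k s, chooseMass n w) := by
    simp only [H]
    fun_prop
  have h0 := le_of_tendsto_of_tendsto (c1.tendsto 0 |>.mono_left nhdsWithin_le_nhds)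
    (c2.tendsto 0 |>.mono_left nhdsWithin_le_nhds)
    (Filter.eventually_of_mem self_mem_nhdsWithin fun δ (hδ : δ ∈ Set.Ioi 0) => key δ hδ)
  have e1 : ∀ w : Fin k → ℕ, chooseMass n w * prodSqrt (H 0) w = chooseMass n w * prodSqrt h w := by
    intro w
    by_cases hwn : ∀ i, w i ≤ n
    · simp [prodSqrt, H, hwn]
    · simp [chooseMass_eq_zero hwn]
  have e2 : ∀ (w : Fin k → ℕ) i, chooseMass n w * H 0 i (w i) = chooseMass n w * h i (w i) := by
    intro w i
    by_cases hwn : ∀ i, w i ≤ n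
    · simp [H, hwn]
    · simp [chooseMass_eq_zero hwn]
  simpa only [e1, e2] using h0

end blocks
end
end SparseLPN

/-! ### From block weights to arbitrary functions of the blocks -/

namespace SparseLPN
noncomputable section
open scoped ENNReal

section blocks
variable {k n s : ℕ} {X : Type} [Fintype X]

/-- Once the weight of every block is prescribed, the sum runs over a product set and factorises. -/
theorem sum_fixed_weight (wt : X → ℕ) (F : Fin k → X → ℝ) :
    ∑ y : Fin k → X, (if ∑ i, wt (y i) = s then ∏ i, F i (y i) else 0) =
      ∑ w ∈ weightVectors k s, ∏ i, ∑ x with wt x = w i, F i x := by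
  classical
  simp_rw [Finset.prod_univ_sum]
  rw [← Finset.sum_filter, ← Finset.sum_fiberwise_of_maps_to (t := weightVectors k s)
    (g := fun y i => wt (y i))]
  · refine Finset.sum_congr rfl fun w hw => Finset.sum_congr ?_ fun _ _ => rfl
    rw [mem_weightVectors] at hw
    ext y
    simp only [Finset.mem_filter, Finset.mem_univ, true_and, Fintype.mem_piFinset, funext_iff]
    constructor
    · exact fun h => h.2
    · exact fun h => ⟨by simp [h, hw], h⟩
  · intro y hy
    simpa [mem_weightVectors] using hy

/-- Inside a weight class the blocks are independent, so Cauchy–Schwarz replaces f l by the root of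
its class mean square, which is a function of the weight. The factors γ combine to the constant γ^s,
leaving binomial coefficients. -/
theorem sum_blocks_le (hk : 3 ≤ k) (hn : 0 < n) (wt : X → ℕ) {μ : X → ℝ} (hμ : ∀ x, 0 ≤ μ x)
    {γ : ℝ} (hγ : 0 < γ) (hcls : ∀ u, ∑ x with wt x = u, μ x = γ ^ u * n.choose u)
    {f : Fin k → X → ℝ} (hf : ∀ l x, 0 ≤ f l x) :
    ∑ y : Fin k → X, (if ∑ i, wt (y i) = s then ∏ i, μ (y i) * f i (y i) else 0) ≤
      (∑ y : Fin k → X, if ∑ i, wt (y i) = s then ∏ i, μ (y i) else 0) *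
        ∏ l, √((∑ y : Fin k → X,
          if ∑ i, wt (y i) = s then (∏ i, μ (y i)) * f l (y l) ^ 2 else 0) /
          ∑ y : Fin k → X, if ∑ i, wt (y i) = s then ∏ i, μ (y i) else 0) := by
  classical
  set c : ℕ → ℝ := fun u => γ ^ u * n.choose u with hc
  have c0 : ∀ u, 0 ≤ c u := fun u => by positivity
  set g : Fin k → ℕ → ℝ := fun l u => (∑ x with wt x = u, μ x * f l x ^ 2) / c u with hg
  have g0 : ∀ l u, 0 ≤ g l u := fun l u =>
    div_nonneg (Finset.sum_nonneg fun x _ => mul_nonneg (hμ x) (sq_nonneg _)) (c0 u)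
  have cg : ∀ l u, ∑ x with wt x = u, μ x * f l x ^ 2 = c u * g l u := by
    intro l u
    -- In an empty class the mean is the default value of a division by zero; the identity holds
    -- because μ vanishes there.
    by_cases hcu : c u = 0
    · have hz : ∀ x ∈ Finset.univ.filter (fun x => wt x = u), μ x = 0 := by
        rw [← Finset.sum_eq_zero_iff_of_nonneg fun x _ => hμ x, hcls u]; exact hcu
      rw [hcu, zero_mul]
      exact Finset.sum_eq_zero fun x hx => by rw [hz x hx, zero_mul]
    · rw [hg]; field_simp
  have cm : ∀ w ∈ weightVectors k s, ∏ i, c (w i) = γ ^ s * chooseMass n w := by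
    intro w hw
    rw [mem_weightVectors] at hw
    simp only [hc, Finset.prod_mul_distrib, Finset.prod_pow_eq_pow_sum, hw, chooseMass]
  have e1 : ∑ y : Fin k → X, (if ∑ i, wt (y i) = s then ∏ i, μ (y i) else 0) =
      γ ^ s * ∑ w ∈ weightVectors k s, chooseMass n w := by
    rw [sum_fixed_weight wt fun _ => μ, Finset.mul_sum]
    exact Finset.sum_congr rfl fun w hw => by simp_rw [hcls]; exact cm w hw
  have e2 : ∀ l, ∑ y : Fin k → X,
      (if ∑ i, wt (y i) = s then (∏ i, μ (y i)) * f l (y l) ^ 2 else 0) =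
      γ ^ s * ∑ w ∈ weightVectors k s, chooseMass n w * g l (w l) := by
    intro l
    have : ∀ y : Fin k → X, (∏ i, μ (y i)) * f l (y l) ^ 2 =
        ∏ i, (μ (y i) * if i = l then f i (y i) ^ 2 else 1) := by
      intro y
      rw [Finset.prod_mul_distrib, Finset.prod_ite_eq' Finset.univ l]
      simp
    simp_rw [this]
    rw [sum_fixed_weight wt fun i x => μ x * if i = l then f i x ^ 2 else 1, Finset.mul_sum]
    refine Finset.sum_congr rfl fun w hw => ?_
    have : ∀ i, ∑ x with wt x = w i, μ x * (if i = l then f i x ^ 2 else 1) =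
        c (w i) * if i = l then g i (w i) else 1 := by
      intro i
      split_ifs
      · exact cg i (w i)
      · simp [hcls, hc]
    simp_rw [this]
    rw [Finset.prod_mul_distrib, Finset.prod_ite_eq' Finset.univ l, cm w hw]
    simp [mul_assoc]
  have e3 : ∑ y : Fin k → X, (if ∑ i, wt (y i) = s then ∏ i, μ (y i) * f i (y i) else 0) ≤
      γ ^ s * ∑ w ∈ weightVectors k s, chooseMass n w * prodSqrt g w := by
    rw [sum_fixed_weight wt fun i x => μ x * f i x, Finset.mul_sum]
    refine Finset.sum_le_sum fun w hw => ?_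
    rw [← mul_assoc, ← cm w hw, prodSqrt, ← Finset.prod_mul_distrib]
    refine Finset.prod_le_prod (fun i _ => Finset.sum_nonneg fun x _ =>
      mul_nonneg (hμ x) (hf i x)) fun i _ => ?_
    have cs := Finset.sum_mul_sq_le_sq_mul_sq (Finset.univ.filter fun x => wt x = w i)
      (fun x => √(μ x)) (fun x => √(μ x) * f i x)
    have a1 : ∀ x, √(μ x) * (√(μ x) * f i x) = μ x * f i x := fun x => by
      rw [← mul_assoc, Real.mul_self_sqrt (hμ x)]
    have a2 : ∀ x, √(μ x) ^ 2 = μ x := fun x => Real.sq_sqrt (hμ x)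
    have a3 : ∀ x, (√(μ x) * f i x) ^ 2 = μ x * f i x ^ 2 := fun x => by
      rw [mul_pow, Real.sq_sqrt (hμ x)]
    simp only [a1, a2, a3, hcls, cg] at cs
    refine le_of_sq_le_sq ?_ (mul_nonneg (c0 _) (Real.sqrt_nonneg _))
    rw [mul_pow, Real.sq_sqrt (g0 _ _)]
    refine cs.trans_eq ?_
    simp only [hc]
    ring
  rw [e1]
  simp_rw [e2]
  refine e3.trans ?_
  have hγs : γ ^ s ≠ 0 := (pow_pos hγ s).ne'
  simp_rw [mul_div_mul_left _ _ hγs]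
  rw [mul_assoc]
  exact mul_le_mul_of_nonneg_left (sum_prodSqrt_le hk hn g0) (pow_pos hγ s).le

/-- A product inequality for the blocks of a random vector of fixed weight: the expectation of a
product of functions of the blocks is at most the product of their `L²` norms. -/
theorem expect_blocks_le (hk : 3 ≤ k) (hn : 0 < n) (wt : X → ℕ) {μ : X → ℝ} (hμ : ∀ x, 0 ≤ μ x)
    {γ : ℝ} (hγ : 0 < γ) (hcls : ∀ u, ∑ x with wt x = u, μ x = γ ^ u * n.choose u)
    {ρ : PMF (Fin k → X)} {C : ℝ}
    (hρ : ∀ y, (ρ y).toReal = if ∑ i, wt (y i) = s then C * ∏ i, μ (y i) else 0)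
    {f : Fin k → X → ℝ≥0∞} (hf : ∀ l x, f l x ≤ 1) :
    expect ρ (fun y => ∏ l, f l (y l)) ≤ ∏ l, (expect ρ fun y => f l (y l) ^ 2) ^ (1 / 2 : ℝ) := by
  have fin : ∀ l x, f l x ≠ ∞ := fun l x => ((hf l x).trans_lt ENNReal.one_lt_top).ne
  have e0 : ∀ F : (Fin k → X) → ℝ≥0∞, (∀ y, F y ≤ 1) → (expect ρ F).toReal =
      ∑ y, (ρ y).toReal * (F y).toReal := by
    intro F hF
    rw [expect_fintype, ENNReal.toReal_sum fun y _ => ENNReal.mul_ne_top (ρ.apply_ne_top y)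
      ((hF y).trans_lt ENNReal.one_lt_top).ne]
    simp
  have e1 : ∀ F : (Fin k → X) → ℝ≥0∞, (∀ y, F y ≤ 1) → (expect ρ F).toReal =
      C * ∑ y : Fin k → X,
        if ∑ i, wt (y i) = s then (∏ i, μ (y i)) * (F y).toReal else 0 := by
    intro F hF
    rw [e0 F hF, Finset.mul_sum]
    refine Finset.sum_congr rfl fun y _ => ?_
    rw [hρ]
    split_ifs <;> ring
  set S := ∑ y : Fin k → X, if ∑ i, wt (y i) = s then ∏ i, μ (y i) else 0 with hS
  -- Testing with the constant 1 identifies C as the inverse normalisation.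
  have hCS : C * S = 1 := by
    have := e1 (fun _ => 1) fun _ => le_rfl
    simpa using this.symm
  have hS0 : 0 < S := lt_of_le_of_ne (Finset.sum_nonneg fun y _ => by
    split_ifs
    · exact Finset.prod_nonneg fun i _ => hμ _
    · exact le_rfl) fun h => by rw [← h] at hCS; simp at hCS
  have hC : C = S⁻¹ := eq_inv_of_mul_eq_one_left hCS
  have p1 : ∀ y : Fin k → X, ∏ l, f l (y l) ≤ 1 := fun y =>
    Finset.prod_le_one' fun l _ => hf l _
  have p2 : ∀ l, ∀ y : Fin k → X, f l (y l) ^ 2 ≤ 1 := fun l y => pow_le_one₀ zero_le (hf l _)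
  have main := sum_blocks_le (s := s) hk hn wt hμ hγ hcls (f := fun l x => (f l x).toReal)
    fun _ _ => ENNReal.toReal_nonneg
  have fin2 : ∀ F : (Fin k → X) → ℝ≥0∞, (∀ y, F y ≤ 1) → expect ρ F ≠ ∞ := fun F hF =>
    ((expect_le_one hF).trans_lt ENNReal.one_lt_top).ne
  rw [← ENNReal.toReal_le_toReal (fin2 _ p1)
    (ENNReal.prod_ne_top fun l _ => ENNReal.rpow_ne_top_of_nonneg (by norm_num) (fin2 _ (p2 l))),
    ENNReal.toReal_prod, e1 _ p1]
  simp_rw [← ENNReal.toReal_rpow, e1 _ (p2 _), ← Real.sqrt_eq_rpow, ENNReal.toReal_prod,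
    ENNReal.toReal_pow, ← Finset.prod_mul_distrib, hC]
  calc _ ≤ S⁻¹ * _ := mul_le_mul_of_nonneg_left main (inv_nonneg.2 hS0.le)
    _ = _ := by
      rw [← mul_assoc, inv_mul_cancel₀ hS0.ne', one_mul]
      exact Finset.prod_congr rfl fun l _ => by rw [div_eq_inv_mul]

end blocks

/-! ### Direct products with dependent components -/

section direct
variable {k m : ℕ} {X : Type}

/-- The product inequality passes to independent rows. -/
theorem expect_rows_le {ρ : PMF (Fin k → X)} {ν : PMF X}
    (h : ∀ f : Fin k → X → ℝ≥0∞, (∀ l x, f l x ≤ 1) →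
      expect ρ (fun y => ∏ l, f l (y l)) ≤ ∏ l, (expect ν fun x => f l x ^ 2) ^ (1 / 2 : ℝ))
    (f : Fin k → (Fin m → X) → ℝ≥0∞) (hf : ∀ l x, f l x ≤ 1) :
    expect (iid ρ m) (fun R => ∏ l, f l fun j => R j l) ≤
      ∏ l, (expect (iid ν m) fun x => f l x ^ 2) ^ (1 / 2 : ℝ) := by
  induction m with
  | zero =>
    simp only [iid, expect_pure]
    refine Finset.prod_le_prod' fun l _ => ?_
    rw [← ENNReal.rpow_natCast, ← ENNReal.rpow_mul]
    norm_num
    exact le_of_eq (congrArg _ (Subsingleton.elim _ _))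
  | succ m ih =>
    simp only [iid_eq_indep, expect_indep_succ] at ih ⊢
    have h1 : ∀ (y : Fin k → X) (R : Fin m → Fin k → X) l,
        (fun j => (Fin.cons y R : Fin (m + 1) → Fin k → X) j l) =
          Fin.cons (y l) fun j => R j l := by
      intro y R l
      ext j
      refine Fin.cases ?_ (fun j => ?_) j <;> simp
    simp only [h1]
    -- With the first row fixed, the induction hypothesis gives a product of L² norms of sections.
    -- Each norm depends on one block of the first row only, so the one-row inequality applies
    -- again.
    calc _ ≤ expect ρ fun y => ∏ l, (expect (indep fun _ : Fin m => ν) fun x =>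
          f l (Fin.cons (y l) x) ^ 2) ^ (1 / 2 : ℝ) :=
          expect_mono fun y => ih (fun l x => f l (Fin.cons (y l) x)) fun l x => hf l _
      _ ≤ _ := by
        refine (h (fun l a => (expect (indep fun _ : Fin m => ν) fun x =>
          f l (Fin.cons a x) ^ 2) ^ (1 / 2 : ℝ)) fun l a => ?_).trans_eq ?_
        · exact ENNReal.rpow_le_one (expect_le_one fun x => pow_le_one₀ zero_le (hf l _))
            (by norm_num)
        · refine Finset.prod_congr rfl fun l _ => ?_
          congr 2
          ext a
          rw [← ENNReal.rpow_natCast, ← ENNReal.rpow_mul]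
          norm_num

/-- Sampling a row and looking at its `i`-th block is the same as sampling the block and completing
it. -/
theorem expect_rows_complete {ρ : PMF (Fin k → X)} {ν : PMF X} {κ : X → PMF (Fin k → X)}
    {i : Fin k} (h : ∀ F : X → (Fin k → X) → ℝ≥0∞,
      (expect ν fun x => expect (κ x) fun y => F x y) = expect ρ fun y => F (y i) y)
    (F : (Fin m → X) → (Fin m → Fin k → X) → ℝ≥0∞) :
    (expect (iid ν m) fun x => expect (indep fun j => κ (x j)) fun R => F x R) =
      expect (iid ρ m) fun R => F (fun j => R j i) R := by
  induction m with
  | zero =>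
    simp only [iid, indep, expect_pure]
    congr 1
    exact Subsingleton.elim _ _
  | succ m ih =>
    simp only [iid_eq_indep, expect_indep_succ] at ih ⊢
    simp only [Fin.cons_zero, Fin.cons_succ]
    have h1 : ∀ x, (expect (indep fun _ : Fin m => ν) fun f => expect (κ x) fun y =>
        expect (indep fun j => κ (f j)) fun R => F (Fin.cons x f) (Fin.cons y R)) =
        expect (κ x) fun y => expect (indep fun _ : Fin m => ρ) fun R =>
          F (Fin.cons x fun j => R j i) (Fin.cons y R) := by
      intro x
      rw [expect_comm]
      exact expect_congr fun y _ => ih fun f R => F (Fin.cons x f) (Fin.cons y R)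
    simp only [h1]
    rw [h fun x y => expect (indep fun _ : Fin m => ρ) fun R =>
          F (Fin.cons x fun j => R j i) (Fin.cons y R)]
    refine expect_congr fun y _ => expect_congr fun R _ => ?_
    congr 1
    ext j
    refine Fin.cases ?_ (fun j => ?_) j <;> simp

/-- If a test of `k` components succeeds with probability more than `(1 - β)^(k/2) + k t`, then for
all but a `β` fraction of the values of one component, planting it in a random position makes the
test succeed with probability at least `t`. -/
theorem direct_product {ρ : PMF (Fin k → X)} {ν : PMF X} {κ : Fin k → X → PMF (Fin k → X)}
    (hκ : ∀ i, ∀ F : X → (Fin k → X) → ℝ≥0∞,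
      (expect ν fun x => expect (κ i x) fun y => F x y) = expect ρ fun y => F (y i) y)
    (h : ∀ f : Fin k → X → ℝ≥0∞, (∀ l x, f l x ≤ 1) →
      expect ρ (fun y => ∏ l, f l (y l)) ≤ ∏ l, (expect ν fun x => f l x ^ 2) ^ (1 / 2 : ℝ))
    (S : (Fin m → Fin k → X) → ℝ≥0∞) (hS : ∀ R, S R ≤ 1) (t : ℝ≥0∞)
    (B : Set (Fin m → X)) [DecidablePred (· ∈ B)]
    (hB : ∀ x ∈ B, ∑ i, (expect (indep fun j => κ i (x j)) S) ≤ k * t) :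
    expect (iid ρ m) S ≤
      (1 - expect (iid ν m) fun x => if x ∈ B then 1 else 0) ^ ((k : ℝ) / 2) + k * t := by
  set f : (Fin m → X) → ℝ≥0∞ := fun x => if x ∈ B then 0 else 1 with hfdef
  set b : (Fin m → X) → ℝ≥0∞ := fun x => if x ∈ B then 1 else 0 with hbdef
  -- Either every column avoids `B` and the product is 1, or the success is charged to a column in
  -- `B`.
  have split : ∀ R : Fin m → Fin k → X, S R ≤ ∏ l, f (fun j => R j l) +
      ∑ i, b (fun j => R j i) * S R := by
    intro R
    by_cases hR : ∃ i, (fun j => R j i) ∈ B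
    · obtain ⟨i, hi⟩ := hR
      have := Finset.single_le_sum (f := fun i => b (fun j => R j i) * S R)
        (fun _ _ => zero_le) (Finset.mem_univ i)
      simp only [hbdef, hi, if_true, one_mul] at this
      exact this.trans le_add_self
    · push Not at hR
      have : ∏ l, f (fun j => R j l) = 1 :=
        Finset.prod_eq_one fun l _ => by simp [hfdef, hR l]
      rw [this]
      exact (hS R).trans le_self_add
  have hfb : ∀ x, f x + b x = 1 := fun x => by simp only [hfdef, hbdef]; split_ifs <;> simp
  have hf1 : ∀ x, f x ≤ 1 := fun x => by simp only [hfdef]; split_ifs <;> simp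
  have hb1 : ∀ x, b x ≤ 1 := fun x => by simp only [hbdef]; split_ifs <;> simp
  have hbt : expect (iid ν m) b ≠ ∞ := ((expect_le_one hb1).trans_lt ENNReal.one_lt_top).ne
  have hEf : expect (iid ν m) f = 1 - expect (iid ν m) b := by
    refine ENNReal.eq_sub_of_add_eq hbt ?_
    rw [← expect_add]
    simp [hfb]
  refine (expect_mono split).trans ?_
  rw [expect_add, expect_sum]
  refine add_le_add ?_ ?_
  · refine (expect_rows_le h (fun _ => f) fun _ x => hf1 x).trans ?_
    -- An indicator is its own square, so its L² norm is the root of its probability; this is where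
    -- the exponent k/2 comes from.
    have : (fun x => f x ^ 2) = f := by ext x; simp only [hfdef]; split_ifs <;> simp
    rw [this, hEf, Finset.prod_const, Finset.card_univ, Fintype.card_fin, ← ENNReal.rpow_natCast,
      ← ENNReal.rpow_mul]
    apply le_of_eq
    congr 1
    ring
  · have : ∀ i, (expect (iid ρ m) fun R => b (fun j => R j i) * S R) =
        expect (iid ν m) fun x => b x * expect (indep fun j => κ i (x j)) S := by
      intro i
      rw [← expect_rows_complete (hκ i) fun x R => b x * S R]
      simp only [expect_const_mul]
    simp only [this]
    rw [← expect_sum]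
    refine (expect_mono fun x => ?_).trans_eq (expect_const _ _)
    rw [← Finset.mul_sum]
    by_cases hx : x ∈ B
    · simpa [hbdef, hx] using hB x hx
    · simp [hbdef, hx]

end direct
end
end SparseLPN

namespace SparseLPN
noncomputable section
open scoped ENNReal

/-! ### Reasoning about programs -/

section sim
variable {α β : Type}

/-- The run `μ` simulates the specification `D`: they can be coupled within the relation `R`. -/
def Sim (μ : PMF State) (D : PMF α) (R : α → State → Prop) : Prop :=
  ∃ J : PMF (α × State), J.map Prod.fst = D ∧ J.map Prod.snd = μ ∧ ∀ p ∈ J.support, R p.1 p.2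

/-- Every possible outcome of `μ` satisfies `Q`. -/
def Post (μ : PMF State) (Q : State → Prop) : Prop := ∀ S ∈ μ.support, Q S

theorem Post.pure {S : State} {Q : State → Prop} (h : Q S) : Post (PMF.pure S) Q := by
  intro S' hS'
  rw [PMF.mem_support_pure_iff] at hS'
  exact hS' ▸ h

theorem Post.bind {μ : PMF State} {K : State → PMF State} {Q Q' : State → Prop} (h : Post μ Q)
    (hK : ∀ S, Q S → Post (K S) Q') : Post (μ.bind K) Q' := by
  intro S hS
  obtain ⟨T, hT, hS⟩ := (PMF.mem_support_bind_iff _ _ _).1 hS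
  exact hK T (h T hT) S hS

theorem Post.mono {μ : PMF State} {Q Q' : State → Prop} (h : Post μ Q) (hQ : ∀ S, Q S → Q' S) :
    Post μ Q' := fun S hS => hQ S (h S hS)

theorem Post.and {μ : PMF State} {Q Q' : State → Prop} (h : Post μ Q) (h' : Post μ Q') :
    Post μ fun S => Q S ∧ Q' S := fun S hS => ⟨h S hS, h' S hS⟩

theorem Post.map {D : PMF α} {g : α → State} {Q : State → Prop} (h : ∀ a, Q (g a)) :
    Post (D.map g) Q := by
  intro S hS
  obtain ⟨a, -, rfl⟩ := (PMF.mem_support_map_iff _ _ _).1 hS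
  exact h a

theorem Post.sim {μ : PMF State} {a : α} {R : α → State → Prop} (h : Post μ (R a)) :
    Sim μ (PMF.pure a) R := by
  refine ⟨μ.map fun S => (a, S), ?_, ?_, ?_⟩
  · rw [PMF.map_comp]; exact PMF.map_const μ a
  · rw [PMF.map_comp]; exact PMF.map_id μ
  · intro p hp
    obtain ⟨S, hS, rfl⟩ := (PMF.mem_support_map_iff _ _ _).1 hp
    exact h S hS

theorem Sim.map_left {D : PMF α} {g : α → State} {R : α → State → Prop}
    (h : ∀ a ∈ D.support, R a (g a)) : Sim (D.map g) D R := by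
  refine ⟨D.map fun a => (a, g a), ?_, ?_, ?_⟩
  · rw [PMF.map_comp]; exact PMF.map_id D
  · rw [PMF.map_comp]; rfl
  · intro p hp
    obtain ⟨a, ha, rfl⟩ := (PMF.mem_support_map_iff _ _ _).1 hp
    exact h a ha

theorem Sim.mono {μ : PMF State} {D : PMF α} {R R' : α → State → Prop} (h : Sim μ D R)
    (hR : ∀ a S, R a S → R' a S) : Sim μ D R' := by
  obtain ⟨J, h1, h2, h3⟩ := h
  exact ⟨J, h1, h2, fun p hp => hR _ _ (h3 p hp)⟩

theorem Sim.and_post {μ : PMF State} {D : PMF α} {R : α → State → Prop} {Q : State → Prop}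
    (h : Sim μ D R) (hQ : Post μ Q) : Sim μ D fun a S => R a S ∧ Q S := by
  obtain ⟨J, h1, h2, h3⟩ := h
  refine ⟨J, h1, h2, fun p hp => ⟨h3 p hp, hQ _ ?_⟩⟩
  rw [← h2]
  exact (PMF.mem_support_map_iff _ _ _).2 ⟨p, hp, rfl⟩

/-- Couplings are glued by drawing the first pair and then a pair from the coupling of its
continuations. Outside the support any distribution will do. -/
theorem Sim.bind {μ : PMF State} {D : PMF α} {R : α → State → Prop} {K : State → PMF State}
    {E : α → PMF β} {R' : β → State → Prop} (h : Sim μ D R)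
    (hK : ∀ a S, R a S → Sim (K S) (E a) R') : Sim (μ.bind K) (D.bind E) R' := by
  classical
  obtain ⟨J, h1, h2, h3⟩ := h
  have ex : ∀ p : α × State, ∃ L : PMF (β × State), p ∈ J.support →
      L.map Prod.fst = E p.1 ∧ L.map Prod.snd = K p.2 ∧ ∀ r ∈ L.support, R' r.1 r.2 := by
    intro p
    by_cases hp : p ∈ J.support
    · obtain ⟨L, hL⟩ := hK p.1 p.2 (h3 p hp)
      exact ⟨L, fun _ => hL⟩
    · exact ⟨(E p.1).map fun b => (b, p.2), fun h => absurd h hp⟩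
  choose L hL using ex
  refine ⟨J.bind L, ?_, ?_, ?_⟩
  · rw [← h1]
    refine pmf_ext_expect fun f => ?_
    simp only [expect_map, expect_bind]
    refine expect_congr fun p hp => ?_
    rw [← (hL p hp).1, expect_map]
  · rw [← h2]
    refine pmf_ext_expect fun f => ?_
    simp only [expect_map, expect_bind]
    refine expect_congr fun p hp => ?_
    rw [← (hL p hp).2.1, expect_map]
  · intro r hr
    obtain ⟨p, hp, hr⟩ := (PMF.mem_support_bind_iff _ _ _).1 hr
    exact (hL p hp).2.2 r hr

theorem Sim.map {μ : PMF State} {D : PMF α} {R : α → State → Prop} {g : α → β}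
    {R' : β → State → Prop} (h : Sim μ D R) (hg : ∀ a S, R a S → R' (g a) S) :
    Sim μ (D.map g) R' := by
  obtain ⟨J, h1, h2, h3⟩ := h
  refine ⟨J.map fun p => (g p.1, p.2), ?_, ?_, ?_⟩
  · rw [← h1, PMF.map_comp, PMF.map_comp]; rfl
  · rw [← h2, PMF.map_comp]; rfl
  · intro p hp
    obtain ⟨r, hr, rfl⟩ := (PMF.mem_support_map_iff _ _ _).1 hp
    exact hg _ _ (h3 r hr)

/-- Continue a simulation by a deterministic part of the program. -/
theorem Sim.bind_post {μ : PMF State} {D : PMF α} {R : α → State → Prop} {K : State → PMF State}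
    {R' : α → State → Prop} (h : Sim μ D R) (hK : ∀ a S, R a S → Post (K S) (R' a)) :
    Sim (μ.bind K) D R' := by
  have := h.bind (E := PMF.pure) fun a S hR => (hK a S hR).sim
  rwa [PMF.bind_pure] at this

/-- Start a simulation after a deterministic part of the program. -/
theorem Post.bind_sim {μ : PMF State} {D : PMF α} {Q : State → Prop} {K : State → PMF State}
    {R : α → State → Prop} (h : Post μ Q) (hK : ∀ S, Q S → Sim (K S) D R) :
    Sim (μ.bind K) D R := by
  have := (h.sim (a := ()) (R := fun _ => Q)).bind (E := fun _ => D) fun _ S hQ => hK S hQ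
  rwa [PMF.pure_bind] at this

/-- The use of a coupling: the output law of a run can be read off its specification. -/
theorem Sim.expect_eq {μ : PMF State} {D : PMF α} {R : α → State → Prop} (h : Sim μ D R)
    {f : State → ℝ≥0∞} {g : α → ℝ≥0∞} (hfg : ∀ a S, R a S → f S = g a) :
    expect μ f = expect D g := by
  obtain ⟨J, h1, h2, h3⟩ := h
  rw [← h1, ← h2, expect_map, expect_map]
  exact expect_congr fun p hp => hfg _ _ (h3 p hp)

theorem Sim.iter {I : ℕ → α → State → Prop} {stepS : ℕ → State → PMF State}
    {step : ℕ → α → PMF α} {N : ℕ} {a : α} {S : State} (h0 : I 0 a S)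
    (hs : ∀ j < N, ∀ a S, I j a S → Sim (stepS j S) (step j a) (I (j + 1))) :
    Sim (iter stepS N S) (iter step N a) (I N) := by
  have : ∀ j ≤ N, Sim (SparseLPN.iter stepS j S) (SparseLPN.iter step j a) (I j) := by
    intro j
    induction j with
    | zero => intro _; exact (Post.pure h0).sim
    | succ j ih => intro hj; exact (ih (by omega)).bind fun a S h => hs j hj a S h
  exact this N le_rfl

theorem Post.iter {I : ℕ → State → Prop} {stepS : ℕ → State → PMF State} {N : ℕ} {S : State}
    (h0 : I 0 S) (hs : ∀ j < N, ∀ S, I j S → Post (stepS j S) (I (j + 1))) :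
    Post (iter stepS N S) (I N) := by
  have : ∀ j ≤ N, Post (SparseLPN.iter stepS j S) (I j) := by
    intro j
    induction j with
    | zero => intro _; exact Post.pure h0
    | succ j ih => intro hj; exact (ih (by omega)).bind fun S h => hs j hj S h
  exact this N le_rfl

end sim

namespace State

@[simp] theorem tick_reg (t : ℕ) (S : State) : (S.tick t).reg = S.reg := rfl
@[simp] theorem tick_mem (t : ℕ) (S : State) : (S.tick t).mem = S.mem := rfl
@[simp] theorem tick_time (t : ℕ) (S : State) : (S.tick t).time = S.time + t := rfl
@[simp] theorem setReg_reg (d v : ℕ) (S : State) (r : ℕ) :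
    (S.setReg d v).reg r = if r = d then v else S.reg r := Function.update_apply ..
@[simp] theorem setReg_mem (d v : ℕ) (S : State) : (S.setReg d v).mem = S.mem := rfl
@[simp] theorem setReg_time (d v : ℕ) (S : State) : (S.setReg d v).time = S.time := rfl
@[simp] theorem setMem_mem (a v : ℕ) (S : State) (x : ℕ) :
    (S.setMem a v).mem x = if x = a then v else S.mem x := Function.update_apply ..
@[simp] theorem setMem_reg (a v : ℕ) (S : State) : (S.setMem a v).reg = S.reg := rfl
@[simp] theorem setMem_time (a v : ℕ) (S : State) : (S.setMem a v).time = S.time := rfl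
@[simp] theorem writeVec_reg {q N : ℕ} (a : ℕ) (z : Fin N → ZMod q) (S : State) :
    (S.writeVec a z).reg = S.reg := rfl
@[simp] theorem writeVec_time {q N : ℕ} (a : ℕ) (z : Fin N → ZMod q) (S : State) :
    (S.writeVec a z).time = S.time := rfl

end State

namespace Prog

/-- No instruction writes a register below `30`, and all loop counts are in such registers. -/
def stable : Prog → Bool
  | const d _ => 30 ≤ d
  | add d _ _ => 30 ≤ d
  | sub d _ _ => 30 ≤ d
  | mulMod d _ _ _ => 30 ≤ d
  | load d _ => 30 ≤ d
  | store _ _ => true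
  | rand d _ => 30 ≤ d
  | noise d => 30 ≤ d
  | query _ _ => true
  | seq P Q => P.stable && Q.stable
  | ifZero _ P Q => P.stable && Q.stable
  | loop r P => r < 30 && P.stable

/-- A bound for the number of steps when the loop counts are given by `c`. -/
def cost (c : ℕ → ℕ) (L : ℕ) : Prog → ℕ
  | query _ _ => L
  | seq P Q => P.cost c L + Q.cost c L
  | ifZero _ P Q => 1 + (P.cost c L + Q.cost c L)
  | loop r P => 1 + c r * (1 + P.cost c L)
  | _ => 1

/-- Whether register `r` may be written. -/
def writes (r : ℕ) : Prog → Bool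
  | const d _ => d == r
  | add d _ _ => d == r
  | sub d _ _ => d == r
  | mulMod d _ _ _ => d == r
  | load d _ => d == r
  | store _ _ => false
  | rand d _ => d == r
  | noise d => d == r
  | query _ _ => false
  | seq P Q => P.writes r || Q.writes r
  | ifZero _ P Q => P.writes r || Q.writes r
  | loop _ P => P.writes r

/-- Whether the memory may be written. -/
def stores : Prog → Bool
  | store _ _ => true
  | query _ _ => true
  | seq P Q => P.stores || Q.stores
  | ifZero _ P Q => P.stores || Q.stores
  | loop _ P => P.stores
  | _ => false

/-- `reg d := reg a` -/
def mov (d a : ℕ) : Prog := seq (const d 0) (add d d a)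

/-- `reg d := reg a * reg b` -/
def mul (d a b : ℕ) : Prog := seq (const d 0) (loop a (add d d b))

/-- No operation (register `59` is never read). -/
def skip : Prog := const 59 0

/-- Run a list of programs one after another. -/
def block : List Prog → Prog
  | [] => skip
  | [P] => P
  | P :: Q :: L => seq P (block (Q :: L))

end Prog

section exec
variable {q N m : ℕ} {bit : PMF Bool} {O : Solver q N m}

theorem exec_seq (P Q : Prog) (S : State) :
    exec bit O (.seq P Q) S = (exec bit O P S).bind fun S' => exec bit O Q S' := rfl

theorem exec_ifZero (r : ℕ) (P Q : Prog) (S : State) : exec bit O (.ifZero r P Q) S =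
    if S.reg r = 0 then exec bit O P (S.tick 1) else exec bit O Q (S.tick 1) := rfl

theorem exec_loop (r : ℕ) (P : Prog) (S : State) :
    exec bit O (.loop r P) S =
      iter (fun _ S' => exec bit O P (S'.tick 1)) (S.reg r) (S.tick 1) := by
  show Nat.rec (motive := fun _ => PMF State) (PMF.pure (S.tick 1))
    (fun _ D => D.bind fun S' => exec bit O P (S'.tick 1)) (S.reg r) = _
  induction S.reg r with
  | zero => rfl
  | succ j ih => simp only [iter, ← ih]

theorem exec_mov {d a : ℕ} (h : d ≠ a) (S : State) :
    exec bit O (.mov d a) S = PMF.pure ((S.setReg d (S.reg a)).tick 2) := by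
  simp [Prog.mov, exec, h.symm, State.tick, State.setReg]

/-- The machine multiplies only modulo a number, so plain products are repeated additions and take
time linear in the first factor. -/
theorem exec_mul {d a b : ℕ} (ha : d ≠ a) (hb : d ≠ b) (S : State) :
    exec bit O (.mul d a b) S =
      PMF.pure ((S.setReg d (S.reg a * S.reg b)).tick (2 * S.reg a + 2)) := by
  have key : ∀ j, iter (fun _ S' => exec bit O (.add d d b) (S'.tick 1)) j
      (((S.setReg d 0).tick 1).tick 1) =
      PMF.pure ((S.setReg d (j * S.reg b)).tick (2 * j + 2)) := by
    intro j
    induction j with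
    | zero => simp [iter, State.tick, State.setReg]
    | succ j ih =>
      rw [iter, ih, PMF.pure_bind]
      simp [exec, State.tick, State.setReg, hb.symm]
      rw [show (j + 1) * S.reg b = j * S.reg b + S.reg b by ring,
        show S.time + (2 * (j + 1) + 2) = S.time + (2 * j + 2) + 1 + 1 by ring]
  rw [Prog.mul, exec_seq]
  show (PMF.pure _).bind _ = _
  rw [PMF.pure_bind, exec_loop]
  simpa [ha.symm] using key (S.reg a)

theorem Sim.loop {α : Type} {I : ℕ → α → State → Prop} {step : ℕ → α → PMF α} {r n : ℕ} {P : Prog}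
    {a : α} {S : State} (hr : S.reg r = n) (h0 : I 0 a (S.tick 1))
    (hs : ∀ j < n, ∀ a S, I j a S → Sim (exec bit O P (S.tick 1)) (step j a) (I (j + 1))) :
    Sim (exec bit O (.loop r P) S) (SparseLPN.iter step n a) (I n) := by
  rw [exec_loop, hr]
  exact Sim.iter h0 hs

theorem Post.loop {I : ℕ → State → Prop} {r n : ℕ} {P : Prog} {S : State} (hr : S.reg r = n)
    (h0 : I 0 (S.tick 1))
    (hs : ∀ j < n, ∀ S, I j S → Post (exec bit O P (S.tick 1)) (I (j + 1))) :
    Post (exec bit O (.loop r P) S) (I n) := by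
  rw [exec_loop, hr]
  exact Post.iter h0 hs

/-- A loop that draws one sample per iteration. -/
theorem Sim.loop_indep {α : Type} [Nonempty α] {n : ℕ} {D : Fin n → PMF α}
    {I : ℕ → (Fin n → α) → State → Prop} {r : ℕ} {P : Prog} {S : State} (hr : S.reg r = n)
    (h0 : ∀ f, I 0 f (S.tick 1))
    (hs : ∀ j, ∀ hj : j < n, ∀ f S, I j f S → Sim (exec bit O P (S.tick 1)) (D ⟨j, hj⟩)
      fun x S' => I (j + 1) (Function.update f ⟨j, hj⟩ x) S') :
    Sim (exec bit O (.loop r P) S) (indep D) (I n) := by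
  obtain ⟨x⟩ := ‹Nonempty α›
  rw [← iter_update D fun _ => x]
  refine Sim.loop hr (h0 _) fun j hj f S hI => ?_
  rw [dif_pos hj]
  exact (hs j hj f S hI).map fun x S h => h

theorem Post.seq {P Q : Prog} {S : State} {R R' : State → Prop} (h : Post (exec bit O P S) R)
    (h' : ∀ S, R S → Post (exec bit O Q S) R') : Post (exec bit O (.seq P Q) S) R' :=
  h.bind h'

/-- Loop counts are read from registers that never change, so a bound computed from the program text
holds in every iteration. Conditionals are charged for both branches. -/
theorem post_stable {c : ℕ → ℕ} (P : Prog) (hP : P.stable = true) (S : State)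
    (hc : ∀ i < 30, S.reg i = c i) :
    Post (exec bit O P S) fun S' => (∀ i < 30, S'.reg i = c i) ∧
      S'.time ≤ S.time + P.cost c (1 + m * N + m + N) := by
  have low : ∀ (S : State) (d v t : ℕ), 30 ≤ d → (∀ i < 30, S.reg i = c i) →
      (∀ i < 30, ((S.setReg d v).tick t).reg i = c i) := by
    intro S d v t hd hS i hi
    simp [show i ≠ d by omega, hS i hi]
  induction P generalizing S with
  | const d v => exact Post.pure ⟨low _ _ _ _ (by simpa [Prog.stable] using hP) hc, by
      simp [Prog.cost]⟩
  | add d a b => exact Post.pure ⟨low _ _ _ _ (by simpa [Prog.stable] using hP) hc, by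
      simp [Prog.cost]⟩
  | sub d a b => exact Post.pure ⟨low _ _ _ _ (by simpa [Prog.stable] using hP) hc, by
      simp [Prog.cost]⟩
  | mulMod d a b e => exact Post.pure ⟨low _ _ _ _ (by simpa [Prog.stable] using hP) hc, by
      simp [Prog.cost]⟩
  | load d a => exact Post.pure ⟨low _ _ _ _ (by simpa [Prog.stable] using hP) hc, by
      simp [Prog.cost]⟩
  | store a s => exact Post.pure ⟨hc, by simp [Prog.cost]⟩
  | rand d a => exact Post.map fun v => ⟨low _ _ _ _ (by simpa [Prog.stable] using hP) hc, by
      simp [Prog.cost]⟩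
  | noise d => exact Post.map fun v => ⟨low _ _ _ _ (by simpa [Prog.stable] using hP) hc, by
      simp [Prog.cost]⟩
  | query a d => exact Post.map fun v => ⟨hc, by simp [Prog.cost]⟩
  | seq P Q ihP ihQ =>
    simp only [Prog.stable, Bool.and_eq_true] at hP
    refine (ihP hP.1 S hc).seq fun S' h => (ihQ hP.2 S' h.1).mono fun S'' h' => ⟨h'.1, ?_⟩
    simp only [Prog.cost]
    omega
  | ifZero r P Q ihP ihQ =>
    simp only [Prog.stable, Bool.and_eq_true] at hP
    rw [exec_ifZero]
    split_ifs
    · refine (ihP hP.1 (S.tick 1) hc).mono fun S' h => ⟨h.1, h.2.trans ?_⟩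
      simp only [Prog.cost, State.tick_time]
      omega
    · refine (ihQ hP.2 (S.tick 1) hc).mono fun S' h => ⟨h.1, h.2.trans ?_⟩
      simp only [Prog.cost, State.tick_time]
      omega
  | loop r P ih =>
    simp only [Prog.stable, Bool.and_eq_true, decide_eq_true_eq] at hP
    have := Post.loop (bit := bit) (O := O) (P := P) (n := c r)
      (I := fun j S' => (∀ i < 30, S'.reg i = c i) ∧
        S'.time ≤ S.time + (1 + j * (1 + P.cost c (1 + m * N + m + N)))) (hc r hP.1)
      ⟨hc, by simp⟩ fun j _ S' h => (ih hP.2 (S'.tick 1) h.1).mono fun S'' h' => ⟨h'.1, by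
        refine h'.2.trans ?_
        have := h.2
        simp only [State.tick_time]
        rw [add_mul (j : ℕ) 1]
        omega⟩
    exact this

/-- A frame rule whose hypothesis is decided syntactically, by `rfl` at each use. -/
theorem post_reg {r : ℕ} (P : Prog) (hP : P.writes r = false) (S : State) :
    Post (exec bit O P S) fun S' => S'.reg r = S.reg r := by
  have other : ∀ (S : State) (d v t : ℕ), (d == r) = false →
      ((S.setReg d v).tick t).reg r = S.reg r := by
    intro S d v t hd
    have : r ≠ d := fun h => by simp [h] at hd
    simp [this]
  induction P generalizing S with
  | const d v => exact Post.pure (other _ _ _ _ hP)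
  | add d a b => exact Post.pure (other _ _ _ _ hP)
  | sub d a b => exact Post.pure (other _ _ _ _ hP)
  | mulMod d a b e => exact Post.pure (other _ _ _ _ hP)
  | load d a => exact Post.pure (other _ _ _ _ hP)
  | store a s => exact Post.pure rfl
  | rand d a => exact Post.map fun v => other _ _ _ _ hP
  | noise d => exact Post.map fun v => other _ _ _ _ hP
  | query a d => exact Post.map fun v => rfl
  | seq P Q ihP ihQ =>
    simp only [Prog.writes, Bool.or_eq_false_iff] at hP
    exact (ihP hP.1 S).seq fun S' h => (ihQ hP.2 S').mono fun S'' h' => h'.trans h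
  | ifZero s P Q ihP ihQ =>
    simp only [Prog.writes, Bool.or_eq_false_iff] at hP
    rw [exec_ifZero]
    split_ifs
    · exact ihP hP.1 (S.tick 1)
    · exact ihQ hP.2 (S.tick 1)
  | loop s P ih =>
    exact Post.loop (I := fun _ S' => S'.reg r = S.reg r) rfl rfl
      fun j _ S' h => (ih hP (S'.tick 1)).mono fun S'' h' => h'.trans h

theorem post_mem (P : Prog) (hP : P.stores = false) (S : State) :
    Post (exec bit O P S) fun S' => S'.mem = S.mem := by
  induction P generalizing S with
  | const d v => exact Post.pure rfl
  | add d a b => exact Post.pure rfl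
  | sub d a b => exact Post.pure rfl
  | mulMod d a b e => exact Post.pure rfl
  | load d a => exact Post.pure rfl
  | store a s => simp [Prog.stores] at hP
  | rand d a => exact Post.map fun v => rfl
  | noise d => exact Post.map fun v => rfl
  | query a d => simp [Prog.stores] at hP
  | seq P Q ihP ihQ =>
    simp only [Prog.stores, Bool.or_eq_false_iff] at hP
    exact (ihP hP.1 S).seq fun S' h => (ihQ hP.2 S').mono fun S'' h' => h'.trans h
  | ifZero s P Q ihP ihQ =>
    simp only [Prog.stores, Bool.or_eq_false_iff] at hP
    rw [exec_ifZero]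
    split_ifs
    · exact ihP hP.1 (S.tick 1)
    · exact ihQ hP.2 (S.tick 1)
  | loop s P ih =>
    exact Post.loop (I := fun _ S' => S'.mem = S.mem) rfl rfl
      fun j _ S' h => (ih hP (S'.tick 1)).mono fun S'' h' => h'.trans h

end exec
end
end SparseLPN

/-! ### Program pieces: weighing a row, acceptance coins, copying -/

namespace SparseLPN
noncomputable section
open scoped ENNReal

section exec
variable {q N m : ℕ} {bit : PMF Bool} {O : Solver q N m}

@[simp] theorem exec_const (d c : ℕ) (S : State) :
    exec bit O (.const d c) S = PMF.pure ((S.setReg d c).tick 1) := rfl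
@[simp] theorem exec_add (d a b : ℕ) (S : State) :
    exec bit O (.add d a b) S = PMF.pure ((S.setReg d (S.reg a + S.reg b)).tick 1) := rfl
@[simp] theorem exec_sub (d a b : ℕ) (S : State) :
    exec bit O (.sub d a b) S = PMF.pure ((S.setReg d (S.reg a - S.reg b)).tick 1) := rfl
@[simp] theorem exec_mulMod (d a b c : ℕ) (S : State) : exec bit O (.mulMod d a b c) S = PMF.pure
    ((S.setReg d (if S.reg c = 0 then 0 else S.reg a * S.reg b % S.reg c)).tick 1) := rfl
@[simp] theorem exec_load (d a : ℕ) (S : State) :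
    exec bit O (.load d a) S = PMF.pure ((S.setReg d (S.mem (S.reg a))).tick 1) := rfl
@[simp] theorem exec_store (a s : ℕ) (S : State) :
    exec bit O (.store a s) S = PMF.pure ((S.setMem (S.reg a) (S.reg s)).tick 1) := rfl
@[simp] theorem exec_skip (S : State) :
    exec bit O .skip S = PMF.pure ((S.setReg 59 0).tick 1) := rfl

theorem exec_rand {d a v : ℕ} {S : State} (h : S.reg a = v) : exec bit O (.rand d a) S =
    (PMF.uniformOfFintype (Fin (v + 1))).map fun u : Fin (v + 1) => (S.setReg d u.val).tick 1 := by
  subst h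
  exact PMF.map_comp (fun u : Fin (S.reg a + 1) => u.val) _ fun v : ℕ => (S.setReg d v).tick 1
theorem exec_noise (d : ℕ) (S : State) : exec bit O (.noise d) S =
    bit.map fun c => (S.setReg d (cond c 1 0)).tick 1 := rfl

attribute [simp] exec_seq exec_ifZero

@[simp] theorem post_pure_iff {S : State} {Q : State → Prop} : Post (PMF.pure S) Q ↔ Q S :=
  ⟨fun h => h S ((PMF.mem_support_pure_iff _ _).2 rfl), Post.pure⟩

/-- Drawing a residue. -/
theorem exec_rand_zmod {p : ℕ} [NeZero p] {d a : ℕ} {S : State} (h : S.reg a = p - 1) :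
    exec bit O (.rand d a) S =
      (PMF.uniformOfFintype (ZMod p)).map fun x => (S.setReg d x.val).tick 1 := by
  have hp := Nat.pos_of_ne_zero (NeZero.ne p)
  have e1 : S.reg a + 1 = p := by omega
  let e : Fin (S.reg a + 1) ≃ ZMod p := (finCongr e1).trans
    { toFun := fun i => (i.val : ZMod p)
      invFun := fun x => ⟨x.val, ZMod.val_lt x⟩
      left_inv := fun i => Fin.ext (ZMod.val_cast_of_lt i.isLt)
      right_inv := fun x => ZMod.natCast_zmod_val x }
  rw [exec_rand rfl, ← map_uniform_equiv e, PMF.map_comp]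
  refine congrArg (fun f => PMF.map f _) (funext fun v => ?_)
  have hv : (e v).val = v := ZMod.val_cast_of_lt (by have := v.isLt; omega)
  simp [hv]

/-- A coin with rational bias. -/
def ratioCoin (a b : ℕ) : PMF Bool :=
  (PMF.uniformOfFintype (Fin (b - 1 + 1))).map fun u => decide (u.val < a)

end exec

namespace Prog

/-- Number of nonzero entries of the row at `reg 30`, into register 35. -/
def weigh : Prog := block [const 35 0, mov 36 30,
  loop 1 (block [load 37 36, ifZero 37 skip (add 35 35 8), add 36 36 8])]

/-- Set register 38 with probability `1 - reg a / reg b`. -/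
def bern (a b : ℕ) : Prog := block [sub 46 b 8, rand 46 46, add 46 46 8, sub 46 46 a,
  ifZero 46 skip (const 38 1)]

def coinStep : Prog := block [sub 42 20 39, mul 43 21 42, add 44 22 39, sub 44 44 20, mul 45 3 44,
  sub 40 3 39, add 41 39 8, sub 41 41 35, sub 46 35 39,
  ifZero 40 (ifZero 41 (bern 43 45) skip) (ifZero 46 (bern 45 43) skip), add 39 39 8]

/-- Register 38 stays `0` if a row of weight `reg 35` is accepted. -/
def coins : Prog := block [const 38 0, const 39 0, loop 1 coinStep]

/-- Copy a vector from the address in `s` to the address in `d` and advance both pointers. -/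
def copy (s d : ℕ) : Prog := loop 1 (block [load 37 s, store d 37, add s s 8, add d d 8])

end Prog

section segments
variable {q N m : ℕ} {bit : PMF Bool} {O : Solver q N m}

theorem post_weigh {n : ℕ} {S : State} (h1 : S.reg 1 = n) (h8 : S.reg 8 = 1) :
    Post (exec bit O .weigh S) fun S' => S'.reg 35 =
      ∑ t ∈ Finset.range n, if S.mem (S.reg 30 + t) = 0 then 0 else 1 := by
  simp only [Prog.weigh, Prog.block, exec_seq, exec_const, exec_mov (show 36 ≠ 30 by decide),
    PMF.pure_bind]
  refine (Post.loop (n := n) (I := fun j T => T.reg 8 = 1 ∧ T.mem = S.mem ∧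
    T.reg 36 = S.reg 30 + j ∧
    T.reg 35 = ∑ t ∈ Finset.range j, if S.mem (S.reg 30 + t) = 0 then 0 else 1) ?_ ?_ ?_).mono ?_
  · simpa using h1
  · simp [h8]
  · rintro j - T ⟨i8, im, i36, i35⟩
    by_cases hz : S.mem (S.reg 30 + j) = 0 <;>
      simp [i8, i36, i35, im, Finset.sum_range_succ, hz, add_assoc]
  · rintro T ⟨-, -, -, h⟩
    exact h

/-- The draw u is uniform below reg b, and u < reg a is tested by whether u + 1 - reg a truncates to
zero. -/
theorem sim_bern {a b : ℕ} {S : State} (h8 : S.reg 8 = 1) (ha : a ≠ 46) :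
    Sim (exec bit O (.bern a b) S) (ratioCoin (S.reg a) (S.reg b))
      fun c S' => S'.reg 38 = if c then S.reg 38 else 1 := by
  simp only [Prog.bern, Prog.block, exec_seq, exec_sub, PMF.pure_bind]
  rw [exec_rand (v := S.reg b - 1) (by simp [h8]), ratioCoin]
  refine Sim.map (R := fun (u : Fin (S.reg b - 1 + 1)) S' =>
    S'.reg 38 = if u.val < S.reg a then S.reg 38 else 1)
    (Sim.bind_post (Sim.map_left (R := fun (u : Fin (S.reg b - 1 + 1)) S' => S' =
    (((S.setReg 46 (S.reg b - S.reg 8)).tick 1).setReg 46 u.val).tick 1) fun u _ => rfl) ?_) ?_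
  · rintro u S' rfl
    by_cases hu : u.val < S.reg a
    · simp [h8, ha, hu, Nat.sub_eq_zero_of_le (Nat.succ_le_of_lt hu)]
    · simp [h8, ha, hu, show u.val + 1 - S.reg a ≠ 0 by omega]
  · intro u S' h
    simpa using h

/-- One of the coins that decide whether a row of weight `w` is accepted. -/
def factorCoin (n k σ w v : ℕ) : PMF Bool :=
  if σ ≤ v then
    if v < w then ratioCoin ((n - σ) * (k * σ - v)) (σ * (k * n - n + 1 + v - k * σ))
    else PMF.pure true
  else if w ≤ v then ratioCoin (σ * (k * n - n + 1 + v - k * σ)) ((n - σ) * (k * σ - v))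
    else PMF.pure true

/-- The coin that decides whether a row of weight `w` is accepted. -/
def acceptCoin (n k σ w : ℕ) : PMF Bool :=
  (indep fun v : Fin n => factorCoin n k σ w v).map fun f => decide (∀ v, f v = true)

/-- The case distinctions σ ≤ v, v < w and w ≤ v are zero tests of truncated differences. -/
theorem sim_coinStep {n k σ w v : ℕ} {S : State} (h3 : S.reg 3 = σ) (h8 : S.reg 8 = 1)
    (h20 : S.reg 20 = k * σ) (h21 : S.reg 21 = n - σ) (h22 : S.reg 22 = k * n - n + 1)
    (h35 : S.reg 35 = w) (h39 : S.reg 39 = v) :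
    Sim (exec bit O .coinStep S) (factorCoin n k σ w v) fun c S' =>
      S'.reg 38 = (if c then S.reg 38 else 1) ∧ S'.reg 39 = v + 1 := by
  simp only [Prog.coinStep, Prog.block, exec_seq, exec_sub, exec_add, PMF.pure_bind,
    exec_mul (show 43 ≠ 21 by decide) (show 43 ≠ 42 by decide),
    exec_mul (show 45 ≠ 3 by decide) (show 45 ≠ 44 by decide)]
  refine Sim.bind_post (R := fun c S' => S'.reg 38 = (if c then S.reg 38 else 1) ∧
    S'.reg 39 = v ∧ S'.reg 8 = 1) ?_ ?_
  · rw [factorCoin]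
    simp only [exec_ifZero]
    simp only [State.tick_reg, State.setReg_reg, Nat.reduceEqDiff, if_false, if_true, h3, h8, h20,
      h21, h22, h35, h39, Nat.sub_eq_zero_iff_le, Nat.succ_le_iff]
    have skip : ∀ T : State, T.reg 38 = S.reg 38 → T.reg 39 = v → T.reg 8 = 1 →
        Sim (exec bit O .skip T) (PMF.pure true) fun c S' =>
          S'.reg 38 = (if c then S.reg 38 else 1) ∧ S'.reg 39 = v ∧ S'.reg 8 = 1 := by
      intro T t38 t39 t8
      rw [exec_skip]
      exact (Post.pure (by simp [t38, t39, t8])).sim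
    have bern : ∀ (T : State) (a b x y : ℕ), a ≠ 46 → T.reg a = x → T.reg b = y →
        T.reg 38 = S.reg 38 → T.reg 39 = v → T.reg 8 = 1 →
        Sim (exec bit O (.bern a b) T) (ratioCoin x y) fun c S' =>
          S'.reg 38 = (if c then S.reg 38 else 1) ∧ S'.reg 39 = v ∧ S'.reg 8 = 1 := by
      intro T a b x y ha hx hy t38 t39 t8
      subst hx hy
      refine ((sim_bern t8 ha).and_post
        ((post_reg (r := 39) _ rfl T).and (post_reg (r := 8) _ rfl T))).mono ?_
      rintro c S' ⟨h, h', h''⟩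
      exact ⟨by rw [h, t38], by rw [h', t39], by rw [h'', t8]⟩
    split_ifs with c1 c2 c2
    · apply bern <;> simp [h39, h8]
    · apply skip <;> simp [h39, h8]
    · apply bern <;> simp [h39, h8]
    · apply skip <;> simp [h39, h8]
  · rintro c S' ⟨t38, t39, t8⟩
    apply Post.pure
    simp [t38, t39, t8]

/-- The loop never stops early: all n coins are processed, and register 38 remembers whether one of
them failed. -/
theorem sim_coins {n k σ w : ℕ} {S : State} (h1 : S.reg 1 = n) (h3 : S.reg 3 = σ)
    (h8 : S.reg 8 = 1) (h20 : S.reg 20 = k * σ) (h21 : S.reg 21 = n - σ)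
    (h22 : S.reg 22 = k * n - n + 1) (h35 : S.reg 35 = w) :
    Sim (exec bit O .coins S) (acceptCoin n k σ w) fun c S' => S'.reg 38 = 0 ↔ c = true := by
  simp only [Prog.coins, Prog.block, exec_seq, exec_const, PMF.pure_bind]
  have main := Sim.loop_indep (bit := bit) (O := O) (n := n) (r := 1) (P := .coinStep)
    (S := (((S.setReg 38 0).tick 1).setReg 39 0).tick 1)
    (D := fun v : Fin n => factorCoin n k σ w v)
    (I := fun j f T => (T.reg 3 = σ ∧ T.reg 8 = 1 ∧ T.reg 20 = k * σ ∧ T.reg 21 = n - σ ∧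
      T.reg 22 = k * n - n + 1 ∧ T.reg 35 = w) ∧ T.reg 39 = j ∧
      (T.reg 38 = 0 ↔ ∀ v : Fin n, v.val < j → f v = true)) (by simpa using h1)
    (fun f => by simp [h3, h8, h20, h21, h22, h35]) ?_
  · refine main.map fun f T h => ?_
    rw [h.2.2]
    simp
  · rintro j hj f T ⟨⟨i3, i8, i20, i21, i22, i35⟩, i39, i38⟩
    have fr := fun r (hr : Prog.coinStep.writes r = false) =>
      post_reg (bit := bit) (O := O) (r := r) _ hr (T.tick 1)
    refine ((sim_coinStep (S := T.tick 1) (by simpa using i3) i8 i20 i21 i22 i35 i39).and_post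
      ((fr 3 rfl).and ((fr 8 rfl).and ((fr 20 rfl).and ((fr 21 rfl).and ((fr 22 rfl).and
        (fr 35 rfl))))))).mono ?_
    rintro c T' ⟨⟨t38, t39⟩, t3, t8, t20, t21, t22, t35⟩
    refine ⟨⟨t3.trans i3, t8.trans i8, t20.trans i20, t21.trans i21, t22.trans i22,
      t35.trans i35⟩, t39, ?_⟩
    rw [t38]
    constructor
    · intro h v hv
      have hc : c = true := by
        by_contra hc
        rw [if_neg hc] at h
        exact absurd h one_ne_zero
      by_cases hvj : v = ⟨j, hj⟩
      · subst hvj; simpa using hc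
      · rw [Function.update_of_ne hvj]
        rw [if_pos hc] at h
        have : v.val ≠ j := fun e => hvj (Fin.ext e)
        exact i38.1 h v (by omega)
    · intro h
      have hc : c = true := by simpa using h ⟨j, hj⟩ (Nat.lt_succ_self j)
      rw [if_pos hc]
      refine i38.2 fun v hv => ?_
      have := h v (by omega)
      rwa [Function.update_of_ne (fun e => by simp [e] at hv)] at this

theorem post_copy {s d n : ℕ} {S : State} (hs : s ≠ d ∧ s ≠ 37 ∧ s ≠ 8 ∧ d ≠ 37 ∧ d ≠ 8)
    (h1 : S.reg 1 = n) (h8 : S.reg 8 = 1)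
    (hd : S.reg s + n ≤ S.reg d ∨ S.reg d + n ≤ S.reg s) :
    Post (exec bit O (.copy s d) S) fun S' =>
      (S'.mem = fun x => if S.reg d ≤ x ∧ x < S.reg d + n then S.mem (S.reg s + (x - S.reg d))
        else S.mem x) ∧ S'.reg s = S.reg s + n ∧ S'.reg d = S.reg d + n := by
  obtain ⟨e1, e2, e3, e4, e5⟩ := hs
  refine (Post.loop (n := n) (I := fun j T => T.reg 8 = 1 ∧ T.reg s = S.reg s + j ∧
    T.reg d = S.reg d + j ∧
    T.mem = fun x => if S.reg d ≤ x ∧ x < S.reg d + j then S.mem (S.reg s + (x - S.reg d))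
        else S.mem x) ?_ ?_ ?_).mono ?_
  · simpa using h1
  · refine ⟨by simpa using h8, by simp, by simp, ?_⟩
    ext x
    simp only [State.tick_mem]
    rw [if_neg (by omega)]
  · rintro j hj T ⟨i8, is, idd, im⟩
    simp only [Prog.block, exec_seq, exec_load, exec_store, exec_add, PMF.pure_bind, post_pure_iff]
    simp only [State.tick_reg, State.tick_mem, State.setReg_reg, State.setReg_mem, State.setMem_reg,
      e1, e2, e4, e1.symm, e3.symm, e5.symm, i8, is, idd, if_true, if_false,
      show 8 ≠ 37 by decide, add_assoc, true_and]
    ext x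
    simp only [State.setMem_mem, State.tick_mem, State.setReg_mem, im]
    by_cases hx : x = S.reg d + j
    · subst hx
      rw [if_pos rfl, if_neg (by omega), if_pos (by omega)]
      congr 1
      omega
    · rw [if_neg hx]
      by_cases hx' : S.reg d ≤ x ∧ x < S.reg d + j
      · rw [if_pos hx', if_pos (by omega)]
      · rw [if_neg hx', if_neg (by omega)]
  · rintro T ⟨-, h1, h2, h3⟩
    exact ⟨h3, h1, h2⟩

end segments
end
end SparseLPN

/-! ### Memory layout and the filtering loop -/

namespace SparseLPN
noncomputable section
open scoped ENNReal

/-- The values of the constant registers; registers `10`–`13` hold the addresses of the input labels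
and of the accepted rows, labels and weights, registers `14`–`19` those of the random shift, the
oracle instance, its labels, the oracle's answer, the current and the best candidate. -/
structure Layout (q n k σ m M : ℕ) (c : ℕ → ℕ) : Prop where
  c0 : c 0 = q
  c1 : c 1 = n
  c2 : c 2 = k
  c3 : c 3 = σ
  c4 : c 4 = m
  c5 : c 5 = M
  c8 : c 8 = 1
  c9 : c 9 = k * n
  c10 : c 10 = M * n
  c11 : c 11 = c 10 + M
  c12 : c 12 = c 11 + M * n
  c13 : c 13 = c 12 + M
  c14 : c 14 = c 13 + M
  c15 : c 15 = c 14 + k * n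
  c16 : c 16 = c 15 + m * (k * n)
  c17 : c 17 = c 16 + m
  c18 : c 18 = c 17 + k * n
  c19 : c 19 = c 18 + n
  c20 : c 20 = k * σ
  c21 : c 21 = n - σ
  c22 : c 22 = k * n - n + 1
  c23 : c 23 = q - 1
  c24 : c 24 = q - 2
  c25 : c 25 = k - 1
  c29 : c 29 = M + 1

/-- A sample: a row and a label. -/
abbrev Sample (q n : ℕ) : Type := (Fin n → ZMod q) × ZMod q

/-- The memory holds the accepted samples `f`, followed by zeros. -/
def Stored {q n m : ℕ} (c : ℕ → ℕ) (mem : ℕ → ℕ) (f : Fin m → Sample q n) : Prop :=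
  ∀ p : Fin m, (∀ t : Fin n, mem (c 11 + p * n + t) = ((f p).1 t).val) ∧
    mem (c 12 + p) = (f p).2.val ∧ mem (c 13 + p) = hammingNorm (f p).1

/-- The memory holds the input. -/
def HasInput {q n M : ℕ} (c : ℕ → ℕ) (mem : ℕ → ℕ) (A : Matrix (Fin M) (Fin n) (ZMod q))
    (b : Fin M → ZMod q) : Prop :=
  ∀ j : Fin M, (∀ t : Fin n, mem (j * n + t) = (A j t).val) ∧ mem (c 10 + j) = (b j).val

/-- Try to append a sample to a list of `p.1` accepted ones, of which the first `m` are kept. -/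
def filterStep {q n m : ℕ} (k σ : ℕ) (y : Sample q n) (p : ℕ × (Fin m → Sample q n)) :
    PMF (ℕ × (Fin m → Sample q n)) :=
  (acceptCoin n k σ (hammingNorm y.1)).map fun c =>
    if c then (p.1 + 1, fun i => if i.val = p.1 then y else p.2 i) else p

namespace Prog

def append : Prog := block [mov 36 30, copy 36 32, load 37 31, store 33 37, add 33 33 8,
  store 34 35, add 34 34 8]

def filterBody : Prog := block [weigh, coins, ifZero 38 append skip, add 30 30 1, add 31 31 8]

/-- Append the accepted samples to the memory. -/
def filter : Prog := block [const 30 0, mov 31 10, mov 32 11, mov 33 12, mov 34 13,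
  loop 5 filterBody]

end Prog

theorem sum_range_hammingNorm {q n : ℕ} {x : Fin n → ZMod q} {f : ℕ → ℕ}
    (h : ∀ t : Fin n, f t = (x t).val) :
    ∑ t ∈ Finset.range n, (if f t = 0 then 0 else 1) = hammingNorm x := by
  rw [Finset.sum_range, hammingNorm, Finset.card_filter]
  refine Finset.sum_congr rfl fun t _ => ?_
  by_cases hx : x t = 0 <;> simp [hx, h t]

theorem row_index_lt {M n j t : ℕ} (hj : j < M) (ht : t < n) : j * n + t < M * n :=
  calc j * n + t < j * n + n := by omega
    _ = (j + 1) * n := by ring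
    _ ≤ M * n := Nat.mul_le_mul_right n hj

theorem row_index_inj {n i j t u : ℕ} (ht : t < n) (hu : u < n) (h : i * n + t = j * n + u) :
    i = j ∧ t = u := by
  have h1 : (i * n + t) / n = i := by
    rw [mul_comm, Nat.mul_add_div (by omega), Nat.div_eq_of_lt ht, add_zero]
  have h2 : (j * n + u) / n = j := by
    rw [mul_comm, Nat.mul_add_div (by omega), Nat.div_eq_of_lt hu, add_zero]
  have hij : i = j := by rw [← h1, h, h2]
  subst hij
  exact ⟨rfl, by omega⟩

section segments
variable {q N m k σ n M : ℕ} {bit : PMF Bool} {O : Solver q N m} {c : ℕ → ℕ}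

/-- The relation between the specification and the machine after `j` samples were filtered. -/
structure FilterRel {q n m : ℕ} (c mem₀ : ℕ → ℕ) (j : ℕ) (p : ℕ × (Fin m → Sample q n))
    (S : State) : Prop where
  env : ∀ i < 30, S.reg i = c i
  r30 : S.reg 30 = j * n
  r31 : S.reg 31 = c 10 + j
  r32 : S.reg 32 = c 11 + p.1 * n
  r33 : S.reg 33 = c 12 + p.1
  r34 : S.reg 34 = c 13 + p.1
  le : p.1 ≤ j
  low : ∀ x < c 11, S.mem x = mem₀ x
  stored : Stored c S.mem p.2

/-- Samples beyond the first m are written as well. Each region has room for M of them, so nothing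
else is overwritten, and `Stored` looks only at the first m. -/
theorem post_append (L : Layout q n k σ m M c) {S : State} {mem₀ : ℕ → ℕ} {j : ℕ} (hj : j < M)
    (hmM : m ≤ M) {p : ℕ × (Fin m → Sample q n)} (h : FilterRel c mem₀ j p S) {y : Sample q n}
    (hy : ∀ t : Fin n, mem₀ (j * n + t) = (y.1 t).val) (hb : mem₀ (c 10 + j) = y.2.val)
    (h35 : S.reg 35 = hammingNorm y.1) :
    Post (exec bit O .append S) fun S' => S'.reg 32 = c 11 + (p.1 + 1) * n ∧
      S'.reg 33 = c 12 + (p.1 + 1) ∧ S'.reg 34 = c 13 + (p.1 + 1) ∧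
      (∀ x < c 11, S'.mem x = mem₀ x) ∧
      Stored c S'.mem fun i => if i.val = p.1 then y else p.2 i := by
  obtain ⟨ℓ, f⟩ := p
  obtain ⟨env, r30, r31, r32, r33, r34, le, low, stored⟩ := h
  simp only at r32 r33 r34 le low stored ⊢
  have e1 := env 1 (by norm_num)
  have e8 := env 8 (by norm_num)
  rw [L.c1] at e1
  rw [L.c8] at e8
  have b1 : j * n + n ≤ M * n := by
    have := Nat.mul_le_mul_right n hj
    rwa [Nat.succ_mul] at this
  have b2 : ℓ * n + n ≤ M * n := by
    have := Nat.mul_le_mul_right n (show ℓ + 1 ≤ M by omega)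
    rwa [Nat.succ_mul] at this
  have l10 := L.c10
  have l11 := L.c11
  have l12 := L.c12
  have l13 := L.c13
  simp only [Prog.append, Prog.block, exec_seq, exec_mov (show 36 ≠ 30 by decide), PMF.pure_bind]
  set T := (S.setReg 36 (S.reg 30)).tick 2 with hT
  have fr := fun r (hr : (Prog.copy 36 32).writes r = false) =>
    post_reg (bit := bit) (O := O) (r := r) _ hr T
  have main := post_copy (bit := bit) (O := O) (s := 36) (d := 32) (n := n) (S := T) (by decide)
    (by simp [hT, e1]) (by simp [hT, e8]) (by simp [hT, r30, r32]; omega)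
  refine (main.and ((fr 31 rfl).and ((fr 33 rfl).and ((fr 34 rfl).and ((fr 35 rfl).and
    (fr 8 rfl)))))).bind ?_
  rintro T' ⟨⟨tm, -, t32⟩, t31, t33, t34, t35, t8⟩
  simp only [hT, State.tick_reg, State.tick_mem, State.setReg_reg, State.setReg_mem, r30, r31, r32,
    r33, r34, e8, h35, Nat.reduceEqDiff, if_true, if_false] at tm t31 t32 t33 t34 t35 t8
  simp only [exec_load, exec_store, exec_add, PMF.pure_bind, post_pure_iff]
  simp only [State.tick_reg, State.tick_mem, State.setReg_reg, State.setReg_mem, State.setMem_reg,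
    Nat.reduceEqDiff, if_true, if_false, t31, t32, t33, t34, t35, t8]
  refine ⟨by ring, by ring, by ring, ?_, ?_⟩
  · intro x hx
    simp only [State.setMem_mem, State.setReg_mem, State.tick_mem, tm]
    rw [if_neg (by omega), if_neg (by omega), if_neg (by omega)]
    exact low x hx
  · intro p
    have b3 : (p : ℕ) * n + n ≤ M * n := by
      have := Nat.mul_le_mul_right n (show (p : ℕ) + 1 ≤ M by omega)
      rwa [Nat.succ_mul] at this
    simp only [State.setMem_mem, State.setReg_mem, State.tick_mem, tm]
    refine ⟨fun t => ?_, ?_, ?_⟩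
    · rw [if_neg (by omega), if_neg (by omega)]
      by_cases hp : p.val = ℓ
      · rw [if_pos (by rw [hp]; omega), if_pos hp, low _ (by rw [hp]; omega), ← hy t]
        congr 1
        rw [hp]
        omega
      · rw [if_neg hp, if_neg, (stored p).1 t]
        rintro ⟨h1, h2⟩
        have h3 : (p : ℕ) * n + t = ℓ * n + (c 11 + p * n + t - (c 11 + ℓ * n)) := by omega
        exact hp (row_index_inj t.isLt (by omega) h3).1
    · by_cases hp : p.val = ℓ
      · rw [if_neg (by omega), if_pos (by omega), if_pos hp, if_neg (by omega), low _ (by omega), hb]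
      · rw [if_neg (by omega), if_neg (by omega), if_neg hp, if_neg (by omega), (stored p).2.1]
    · by_cases hp : p.val = ℓ
      · rw [if_pos (by omega), if_pos hp]
      · rw [if_neg (by omega), if_neg (by omega), if_neg hp, if_neg (by omega), (stored p).2.2]

theorem sim_filterBody (L : Layout q n k σ m M c) (hmM : m ≤ M) {S : State} {mem₀ : ℕ → ℕ} {j : ℕ}
    (hj : j < M) {p : ℕ × (Fin m → Sample q n)} (h : FilterRel c mem₀ j p S) {y : Sample q n}
    (hy : ∀ t : Fin n, mem₀ (j * n + t) = (y.1 t).val) (hb : mem₀ (c 10 + j) = y.2.val) :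
    Sim (exec bit O .filterBody S) (filterStep k σ y p) (FilterRel c mem₀ (j + 1)) := by
  have hst : Post (exec bit O .filterBody S) fun S' => ∀ i < 30, S'.reg i = c i :=
    (post_stable (c := c) _ rfl S h.env).mono fun _ h => h.1
  have e := h.env
  have l11 := L.c11
  have l10 := L.c10
  have b1 : j * n + n ≤ M * n := by
    have := Nat.mul_le_mul_right n hj
    rwa [Nat.succ_mul] at this
  have main : Sim (exec bit O .filterBody S) (filterStep k σ y p) fun p' S' =>
      S'.reg 30 = (j + 1) * n ∧ S'.reg 31 = c 10 + (j + 1) ∧ S'.reg 32 = c 11 + p'.1 * n ∧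
      S'.reg 33 = c 12 + p'.1 ∧ S'.reg 34 = c 13 + p'.1 ∧ p'.1 ≤ j + 1 ∧
      (∀ x < c 11, S'.mem x = mem₀ x) ∧ Stored c S'.mem p'.2 := by
    simp only [Prog.filterBody, Prog.block, exec_seq]
    -- weigh the row
    have hw := post_weigh (bit := bit) (O := O) (S := S) (n := n)
      ((e 1 (by norm_num)).trans L.c1) ((e 8 (by norm_num)).trans L.c8)
    rw [sum_range_hammingNorm (x := y.1) (f := fun t => S.mem (S.reg 30 + t))
      fun t => by rw [h.r30, ← hy t]; exact h.low _ (by omega)] at hw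
    have fr := fun r (hr : Prog.weigh.writes r = false) =>
      post_reg (bit := bit) (O := O) (r := r) _ hr S
    have henv := (post_stable (bit := bit) (O := O) (c := c) .weigh rfl S e).mono fun _ h => h.1
    refine Post.bind_sim (hw.and (henv.and ((post_mem .weigh rfl S).and ((fr 30 rfl).and
      ((fr 31 rfl).and ((fr 32 rfl).and ((fr 33 rfl).and (fr 34 rfl)))))))) ?_
    rintro T ⟨t35, te, tm, t30, t31, t32, t33, t34⟩
    have hT : FilterRel c mem₀ j p T := ⟨te, t30.trans h.r30, t31.trans h.r31, t32.trans h.r32,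
      t33.trans h.r33, t34.trans h.r34, h.le, by rw [tm]; exact h.low, by rw [tm]; exact h.stored⟩
    clear fr henv hw
    -- decide
    have hc := sim_coins (bit := bit) (O := O) (S := T) (n := n) (k := k) (σ := σ)
      (w := hammingNorm y.1) ((te 1 (by norm_num)).trans L.c1) ((te 3 (by norm_num)).trans L.c3)
      ((te 8 (by norm_num)).trans L.c8) ((te 20 (by norm_num)).trans L.c20)
      ((te 21 (by norm_num)).trans L.c21) ((te 22 (by norm_num)).trans L.c22) t35
    have fr := fun r (hr : Prog.coins.writes r = false) =>
      post_reg (bit := bit) (O := O) (r := r) _ hr T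
    have henv := (post_stable (bit := bit) (O := O) (c := c) .coins rfl T te).mono fun _ h => h.1
    rw [filterStep, PMF.map]
    refine (hc.and_post (henv.and ((post_mem .coins rfl T).and ((fr 30 rfl).and
      ((fr 31 rfl).and ((fr 32 rfl).and ((fr 33 rfl).and ((fr 34 rfl).and
      (fr 35 rfl))))))))).bind ?_
    rintro a U ⟨u38, ue, um, u30, u31, u32, u33, u34, u35⟩
    have hU : FilterRel c mem₀ j p U := ⟨ue, u30.trans hT.r30, u31.trans hT.r31, u32.trans hT.r32,
      u33.trans hT.r33, u34.trans hT.r34, h.le, by rw [um]; exact hT.low,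
      by rw [um]; exact hT.stored⟩
    clear fr henv hc
    refine Post.sim ?_
    simp only [exec_ifZero]
    have U1 : FilterRel c mem₀ j p (U.tick 1) := ⟨hU.1, hU.2, hU.3, hU.4, hU.5, hU.6, hU.7, hU.8,
      hU.9⟩
    by_cases ha : a = true
    · rw [if_pos (u38.2 ha)]
      have hap := post_append (bit := bit) (O := O) L hj hmM U1 hy hb (u35.trans t35)
      have fr := fun r (hr : Prog.append.writes r = false) =>
        post_reg (bit := bit) (O := O) (r := r) _ hr (U.tick 1)
      refine (hap.and ((fr 30 rfl).and ((fr 31 rfl).and ((fr 1 rfl).and (fr 8 rfl))))).bind ?_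
      rintro V ⟨⟨v32, v33, v34, vl, vs⟩, v30, v31, v1, v8⟩
      have v1' : V.reg 1 = n := v1.trans ((ue 1 (by norm_num)).trans L.c1)
      have v8' : V.reg 8 = 1 := v8.trans ((ue 8 (by norm_num)).trans L.c8)
      have v30' : V.reg 30 = j * n := v30.trans hU.r30
      have v31' : V.reg 31 = c 10 + j := v31.trans hU.r31
      simp only [exec_add, PMF.pure_bind, post_pure_iff, ha, if_true]
      simp only [State.tick_reg, State.tick_mem, State.setReg_reg, State.setReg_mem,
        Nat.reduceEqDiff, if_true, if_false, v1', v8', v30', v31', v32, v33, v34]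
      exact ⟨by ring, by ring, trivial, trivial, trivial, by have := h.le; omega, vl, vs⟩
    · rw [if_neg (fun h => ha (u38.1 h))]
      have u1' : U.reg 1 = n := (ue 1 (by norm_num)).trans L.c1
      have u8' : U.reg 8 = 1 := (ue 8 (by norm_num)).trans L.c8
      simp only [exec_skip, exec_add, PMF.pure_bind, post_pure_iff, if_neg ha]
      simp only [State.tick_reg, State.tick_mem, State.setReg_reg, State.setReg_mem,
        Nat.reduceEqDiff, if_true, if_false, u1', u8', hU.r30, hU.r31, hU.r32, hU.r33, hU.r34]
      exact ⟨by ring, by ring, trivial, trivial, trivial, by have := h.le; omega, hU.low,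
        hU.stored⟩
  refine (main.and_post hst).mono ?_
  rintro p' S' ⟨⟨a1, a2, a3, a4, a5, a6, a7, a8⟩, a0⟩
  exact ⟨a0, a1, a2, a3, a4, a5, a6, a7, a8⟩

/-- Blank memory already represents the default list of zero samples, so the relation holds before
anything is accepted. -/
theorem sim_filter (L : Layout q n k σ m M c) (hmM : m ≤ M) {S : State}
    (henv : ∀ i < 30, S.reg i = c i) {A : Matrix (Fin M) (Fin n) (ZMod q)} {b : Fin M → ZMod q}
    (hin : HasInput c S.mem A b) (hz : ∀ x, c 11 ≤ x → S.mem x = 0) :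
    Sim (exec bit O .filter S)
      (drive (filterStep k σ) (fun j => (A j, b j)) M (0, fun _ : Fin m => (0, 0)))
      fun p S' => (∀ i < 30, S'.reg i = c i) ∧ HasInput c S'.mem A b ∧ Stored c S'.mem p.2 := by
  have e := henv
  simp only [Prog.filter, Prog.block, exec_seq, exec_const, exec_mov (show 31 ≠ 10 by decide),
    exec_mov (show 32 ≠ 11 by decide), exec_mov (show 33 ≠ 12 by decide),
    exec_mov (show 34 ≠ 13 by decide), PMF.pure_bind]
  refine (Sim.loop (n := M) (I := FilterRel c S.mem) ?_ ?_ ?_).mono ?_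
  · simp [e, L.c5]
  · refine ⟨fun i hi => ?_, ?_, ?_, ?_, ?_, ?_, le_rfl, fun x _ => rfl, fun p => ?_⟩
    · have hne : ∀ d, 30 ≤ d → i ≠ d := fun d hd => by omega
      simp [hne, e i hi]
    · simp
    · simp [e]
    · simp [e]
    · simp [e]
    · simp [e]
    · have l12 := L.c12
      have l13 := L.c13
      simp only [State.tick_mem, State.setReg_mem, Pi.zero_apply, ZMod.val_zero, hammingNorm_zero]
      exact ⟨fun t => hz _ (by omega), hz _ (by omega), hz _ (by omega)⟩
  · intro j hj p T hT
    rw [dif_pos hj]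
    have l10 := L.c10
    exact sim_filterBody L hmM hj (S := T.tick 1)
      ⟨hT.1, hT.2, hT.3, hT.4, hT.5, hT.6, hT.7, hT.8, hT.9⟩
      (fun t => (hin ⟨j, hj⟩).1 t) ((hin ⟨j, hj⟩).2)
  · intro p T hT
    have l11 := L.c11
    have l10 := L.c10
    refine ⟨hT.env, fun j => ⟨fun t => ?_, ?_⟩, hT.stored⟩
    · rw [hT.low _ (by have := row_index_lt j.isLt t.isLt; omega)]
      exact (hin j).1 t
    · rw [hT.low _ (by omega)]
      exact (hin j).2

end segments
end
end SparseLPN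

/-! ### Planted rows: specification, program and the single entry -/

namespace SparseLPN
noncomputable section
open scoped ENNReal

/-- The `t`-th position of the `i`-th block. -/
def blockIdx {k n : ℕ} (i : Fin k) (t : Fin n) : Fin (k * n) :=
  ⟨i * n + t, row_index_lt i.isLt t.isLt⟩

/-- The next entry of a random vector with `r` nonzero entries in the `L` remaining positions. -/
def entryGen (q L r : ℕ) : PMF (ZMod q) :=
  (PMF.uniformOfFintype (Fin (L - 1 + 1))).bind fun u =>
    if u.val < r then (PMF.uniformOfFintype (Fin (q - 2 + 1))).map fun v => ((v.val + 1 : ℕ) : ZMod q)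
    else PMF.pure 0

/-- The numbers of remaining positions and remaining nonzero entries outside a planted block, and
the part of the row that is already there. -/
abbrev RowState (q N : ℕ) : Type := (ℕ × ℕ) × (Fin N → ZMod q)

/-- Fill one position of a row with the planted block `a` at `i`. -/
def rowStep {q n k : ℕ} (i : Fin k) (a : Fin n → ZMod q) (t : ℕ) (p : RowState q (k * n)) :
    PMF (RowState q (k * n)) :=
  if h : t < k * n then
    if hb : i * n ≤ t ∧ t - i * n < n then
      PMF.pure (p.1, Function.update p.2 ⟨t, h⟩ (a ⟨t - i * n, hb.2⟩))
    else (entryGen q p.1.1 p.1.2).map fun v =>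
      ((p.1.1 - 1, if v = 0 then p.1.2 else p.1.2 - 1), Function.update p.2 ⟨t, h⟩ v)
  else PMF.pure p

/-- A row of weight `w` with the planted block `a` at `i`. -/
def rowGen {q n k : ℕ} (w : ℕ) (i : Fin k) (a : Fin n → ZMod q) : PMF (Fin (k * n) → ZMod q) :=
  (iter (rowStep i a) (k * n) ((k * n - n, w - hammingNorm a), 0)).map Prod.snd

/-- A noise value: uniform if the bit is set, otherwise `0`. -/
def noiseOf (q : ℕ) [NeZero q] (bit : PMF Bool) : PMF (ZMod q) :=
  bit.bind fun c => cond c (PMF.uniformOfFintype (ZMod q)) (PMF.pure 0)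

/-- The sum of `r` noise values. -/
def noiseSum (q : ℕ) [NeZero q] (bit : PMF Bool) (r : ℕ) : PMF (ZMod q) :=
  iter (fun _ e => (noiseOf q bit).map fun x => e + x) r 0

/-- A sample for the oracle with the planted sample `y`, when the secret is shifted by `u`. -/
def plantSample {q n k : ℕ} [NeZero q] (bit : PMF Bool) (w : ℕ) (i : Fin k)
    (u : Fin (k * n) → ZMod q) (y : Sample q n) : PMF (Sample q (k * n)) :=
  (rowGen w i y.1).bind fun x =>
    (noiseSum q bit (k - 1)).map fun e => (x, y.2 + ∑ t, x t * u t + e)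

/-- One call of the oracle: a candidate for the secret. -/
def trial {q n k m : ℕ} [NeZero q] [NeZero k] (bit : PMF Bool) (O : Solver q (k * n) m) (w : ℕ)
    (f : Fin m → Sample q n) : PMF (Fin n → ZMod q) :=
  (PMF.uniformOfFintype (Fin k)).bind fun i =>
    (iid (PMF.uniformOfFintype (ZMod q)) (k * n)).bind fun u =>
      (indep fun j => plantSample bit w i u (f j)).bind fun R =>
        (O (Matrix.of fun j => (R j).1) fun j => (R j).2).map fun z t =>
          z (blockIdx i t) - u (blockIdx i t)

namespace Prog

/-- `reg d := reg a + reg b` modulo `reg 0` -/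
def zadd (d a b : ℕ) : Prog := block [add d a b, mulMod d d 8 0]

/-- Draw the shift. -/
def genShift : Prog := block [mov 36 14, loop 9 (block [rand 37 23, store 36 37, add 36 36 8])]

/-- Draw an entry of the row into register 37. -/
def genEntry : Prog := block [sub 57 57 8, rand 42 57, add 42 42 8, sub 42 42 56,
  ifZero 42 (block [rand 37 24, add 37 37 8, sub 56 56 8]) (const 37 0)]

/-- Get the next entry of the row into register 37. -/
def rowEntry : Prog := block [sub 40 49 39, sub 41 39 49, add 42 41 8, sub 42 42 1,
  ifZero 40 (ifZero 42 (block [add 43 52 41, load 37 43]) genEntry) genEntry]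

def rowBody : Prog := block [rowEntry, store 50 37, add 50 50 8, load 40 36, add 36 36 8,
  mulMod 40 37 40 0, zadd 55 55 40, add 39 39 8]

/-- Add a noise value to register 55. -/
def addNoise : Prog := block [noise 37, ifZero 37 skip (block [rand 37 23, zadd 55 55 37])]

/-- Make one sample for the oracle. -/
def genRow : Prog := block [load 55 53, load 56 54, sub 56 20 56, sub 57 9 1, mov 36 14, const 39 0,
  loop 9 rowBody, loop 25 addNoise, store 51 55, add 51 51 8, add 52 52 1, add 53 53 8,
  add 54 54 8]

end Prog

section segments
variable {q m k σ n M : ℕ} [NeZero q] {bit : PMF Bool} {O : Solver q (k * n) m}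
  {c : ℕ → ℕ}

theorem exec_rand_fin {k' : ℕ} [NeZero k'] {d a : ℕ} {S : State} (h : S.reg a = k' - 1) :
    exec bit O (.rand d a) S =
      (PMF.uniformOfFintype (Fin k')).map fun x : Fin k' => (S.setReg d x.val).tick 1 := by
  have hp := Nat.pos_of_ne_zero (NeZero.ne k')
  have e1 : S.reg a + 1 = k' := by omega
  rw [exec_rand rfl, ← map_uniform_equiv (finCongr e1), PMF.map_comp]
  rfl

theorem exec_zadd {d a b : ℕ} {S : State} (h0 : S.reg 0 = q) (h8 : S.reg 8 = 1) (hd0 : d ≠ 0)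
    (hd8 : d ≠ 8) :
    exec bit O (.zadd d a b) S = PMF.pure ((((S.setReg d (S.reg a + S.reg b)).tick 1).setReg d
      ((S.reg a + S.reg b) % q)).tick 1) := by
  simp [Prog.zadd, Prog.block, h0, h8, hd0.symm, hd8.symm, NeZero.ne q]

theorem sim_genShift (L : Layout q n k σ m M c) {S : State} (e : ∀ i < 30, S.reg i = c i) :
    Sim (exec bit O .genShift S) (iid (PMF.uniformOfFintype (ZMod q)) (k * n)) fun u S' =>
      (∀ t : Fin (k * n), S'.mem (c 14 + t) = (u t).val) ∧
      ∀ x, x < c 14 ∨ c 15 ≤ x → S'.mem x = S.mem x := by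
  rw [iid_eq_indep]
  simp only [Prog.genShift, Prog.block, exec_seq, exec_mov (show 36 ≠ 14 by decide), PMF.pure_bind]
  have l15 := L.c15
  refine (Sim.loop_indep (n := k * n) (I := fun j (u : Fin (k * n) → ZMod q) T =>
    (T.reg 8 = 1 ∧ T.reg 23 = q - 1 ∧ T.reg 36 = c 14 + j) ∧
    (∀ t : Fin (k * n), t.val < j → T.mem (c 14 + t) = (u t).val) ∧
      ∀ x, x < c 14 ∨ c 15 ≤ x → T.mem x = S.mem x) ?_ ?_ ?_).mono ?_
  · simp [e, L.c9]
  · intro f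
    simp [e, L.c8, L.c23]
  · rintro j hj u T ⟨⟨i8, i23, i36⟩, im, io⟩
    rw [exec_seq, exec_rand_zmod (p := q) (by simpa using i23)]
    refine Sim.bind_post (Sim.map_left (R := fun x T' => T' =
      ((((T.tick 1).setReg 37 x.val).tick 1))) fun x _ => rfl) ?_
    rintro x T' rfl
    simp only [exec_seq, exec_store, exec_add, PMF.pure_bind, post_pure_iff]
    simp only [State.tick_reg, State.tick_mem, State.setReg_reg, State.setReg_mem, State.setMem_reg,
      State.setMem_mem, Nat.reduceEqDiff, if_true, if_false, i8, i23, i36]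
    refine ⟨⟨trivial, trivial, by ring⟩, fun t ht => ?_, fun x hx => ?_⟩
    · by_cases htj : t = ⟨j, hj⟩
      · subst htj; simp
      · have : t.val ≠ j := fun h => htj (Fin.ext h)
        rw [if_neg (by omega), Function.update_of_ne htj]
        exact im t (by omega)
    · rw [if_neg (by omega)]
      exact io x hx
  · rintro u T ⟨-, h, h'⟩
    exact ⟨fun t => h t t.isLt, h'⟩

theorem sim_genEntry {S : State} {ℓ r : ℕ} (hq : 2 ≤ q) (h8 : S.reg 8 = 1) (h24 : S.reg 24 = q - 2)
    (h57 : S.reg 57 = ℓ) (h56 : S.reg 56 = r) :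
    Sim (exec bit O .genEntry S) (entryGen q ℓ r) fun v S' => S'.reg 37 = v.val ∧
      S'.reg 57 = ℓ - 1 ∧ S'.reg 56 = if v = 0 then r else r - 1 := by
  simp only [Prog.genEntry, Prog.block, exec_seq, exec_sub, PMF.pure_bind]
  rw [exec_rand (v := ℓ - 1) (by simp [h8, h57]), entryGen]
  refine Sim.bind (Sim.map_left (R := fun (u : Fin (ℓ - 1 + 1)) T => T =
    (((S.setReg 57 (S.reg 57 - S.reg 8)).tick 1).setReg 42 u.val).tick 1) fun u _ => rfl) ?_
  rintro u T rfl
  simp only [exec_add, PMF.pure_bind, exec_ifZero]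
  by_cases hu : u.val < r
  · rw [if_pos (by simp [h8, h56]; omega), if_pos hu, exec_seq,
      exec_rand (v := q - 2) (by simp [h24]), PMF.map]
    refine Sim.bind (Sim.map_left (R := fun (v : Fin (q - 2 + 1)) T' => T'.reg 37 = v.val ∧
      T'.reg 57 = ℓ - 1 ∧ T'.reg 56 = r ∧ T'.reg 8 = 1) fun v _ => ?_) ?_
    · simp [h8, h57, h56]
    · rintro v T' ⟨t37, t57, t56, t8⟩
      refine Post.sim ?_
      -- v is at most q - 2, so v + 1 does not wrap around and runs through the nonzero residues.
      have hv : ((v.val + 1 : ℕ) : ZMod q).val = v.val + 1 :=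
        ZMod.val_cast_of_lt (by have := v.isLt; omega)
      have hv0 : ((v.val + 1 : ℕ) : ZMod q) ≠ 0 := by
        intro h0
        rw [h0, ZMod.val_zero] at hv
        omega
      simp only [exec_seq, exec_add, exec_sub, PMF.pure_bind, post_pure_iff, if_neg hv0, hv]
      simp [t37, t57, t56, t8]
  · rw [if_neg (by simp [h8, h56]; omega), if_neg hu]
    refine Post.sim ?_
    simp [h8, h57, h56]

theorem sim_rowEntry {S : State} {ℓ r t : ℕ} {i : Fin k} {a : Fin n → ZMod q} {x : Fin (k * n) → ZMod q}
    (hq : 2 ≤ q) (ht : t < k * n) (h1 : S.reg 1 = n) (h8 : S.reg 8 = 1) (h24 : S.reg 24 = q - 2)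
    (h57 : S.reg 57 = ℓ) (h56 : S.reg 56 = r) (h49 : S.reg 49 = i * n) (h39 : S.reg 39 = t)
    (ha : ∀ s : Fin n, S.mem (S.reg 52 + s) = (a s).val) :
    Sim (exec bit O .rowEntry S) (rowStep i a t ((ℓ, r), x)) fun p S' =>
      p.2 = Function.update x ⟨t, ht⟩ (p.2 ⟨t, ht⟩) ∧
      S'.reg 37 = (p.2 ⟨t, ht⟩).val ∧ S'.reg 57 = p.1.1 ∧ S'.reg 56 = p.1.2 := by
  simp only [Prog.rowEntry, Prog.block, exec_seq, exec_sub, exec_add, PMF.pure_bind]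
  rw [rowStep, dif_pos ht, exec_ifZero]
  simp only [State.tick_reg, State.setReg_reg, Nat.reduceEqDiff, if_false, if_true, h1, h8, h49, h39]
  have gen : ∀ T : State, T.reg 8 = 1 → T.reg 24 = q - 2 → T.reg 57 = ℓ → T.reg 56 = r →
      Sim (exec bit O .genEntry T) ((entryGen q ℓ r).map fun v =>
        (((ℓ - 1, if v = 0 then r else r - 1), Function.update x ⟨t, ht⟩ v) : RowState q (k * n)))
        fun p S' => p.2 = Function.update x ⟨t, ht⟩ (p.2 ⟨t, ht⟩) ∧
          S'.reg 37 = (p.2 ⟨t, ht⟩).val ∧ S'.reg 57 = p.1.1 ∧ S'.reg 56 = p.1.2 := by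
    intro T t8 t24 t57 t56
    refine (sim_genEntry hq t8 t24 t57 t56).map ?_
    rintro v T' ⟨h37, h57, h56⟩
    simp [h37, h57, h56]
  by_cases hb : i * n ≤ t ∧ t - i * n < n
  · rw [dif_pos hb, if_pos (by omega), exec_ifZero, if_pos (by simp; omega)]
    refine Post.sim ?_
    have := ha ⟨t - i * n, hb.2⟩
    simp only at this
    simp only [exec_seq, exec_add, exec_load, PMF.pure_bind, post_pure_iff]
    simp [this, h57, h56]
  · rw [dif_neg hb]
    by_cases hb' : i * n ≤ t
    · rw [if_pos (by omega), exec_ifZero, if_neg (by simp; omega)]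
      apply gen <;> simp [h8, h24, h57, h56]
    · rw [if_neg (by omega)]
      apply gen <;> simp [h8, h24, h57, h56]

end segments
end
end SparseLPN

/-! ### Simulating one planted sample -/

namespace SparseLPN
noncomputable section
open scoped ENNReal

section segments
variable {q m k σ n M : ℕ} [NeZero q] {bit : PMF Bool} {O : Solver q (k * n) m}
  {c : ℕ → ℕ}

/-- Filling a coordinate that is still zero adds exactly its own term; this is how the label is kept
up to date entry by entry. -/
theorem sum_update_mul {ι : Type} [Fintype ι] [DecidableEq ι] {R : Type} [CommRing R] (x u : ι → R)
    (t : ι) (v : R) (h : x t = 0) :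
    ∑ s, Function.update x t v s * u s = ∑ s, x s * u s + v * u t := by
  have : Function.update x t v = x + Pi.single t v := by
    ext s
    by_cases hs : s = t
    · subst hs; simp [h]
    · simp [hs]
  simp [this, add_mul, Finset.sum_add_distrib, Pi.single_apply]

/-- The relation between the specification and the machine after `t` entries of a row. -/
structure RowRel {q n k : ℕ} (c mem₀ : ℕ → ℕ) (a₀ p₀ : ℕ) (i : Fin k) (u : Fin (k * n) → ZMod q)
    (b : ZMod q) (t : ℕ) (p : RowState q (k * n)) (S : State) : Prop where
  env : ∀ i < 30, S.reg i = c i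
  r49 : S.reg 49 = i * n
  r52 : S.reg 52 = a₀
  r57 : S.reg 57 = p.1.1
  r56 : S.reg 56 = p.1.2
  r39 : S.reg 39 = t
  r50 : S.reg 50 = p₀ + t
  r36 : S.reg 36 = c 14 + t
  r55 : S.reg 55 = (b + ∑ s, p.2 s * u s).val
  zero : ∀ s : Fin (k * n), t ≤ s → p.2 s = 0
  row : ∀ s : Fin (k * n), s < t → S.mem (p₀ + s) = (p.2 s).val
  frame : ∀ x, x < p₀ ∨ p₀ + k * n ≤ x → S.mem x = mem₀ x

theorem sim_rowBody (L : Layout q n k σ m M c) (hq : 2 ≤ q) {mem₀ : ℕ → ℕ} {a₀ p₀ : ℕ} {i : Fin k}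
    {u : Fin (k * n) → ZMod q} {b : ZMod q} {a : Fin n → ZMod q} {t : ℕ} {p : RowState q (k * n)}
    {S : State} (ha : ∀ s : Fin n, mem₀ (a₀ + s) = (a s).val) (ha₀ : a₀ + n ≤ p₀)
    (hu : ∀ s : Fin (k * n), mem₀ (c 14 + s) = (u s).val) (hp₀ : c 14 + k * n ≤ p₀)
    (ht : t < k * n) (h : RowRel c mem₀ a₀ p₀ i u b t p S) :
    Sim (exec bit O .rowBody S) (rowStep i a t p) (RowRel c mem₀ a₀ p₀ i u b (t + 1)) := by
  have e := h.env
  have hst : Post (exec bit O .rowBody S) fun S' => ∀ i < 30, S'.reg i = c i :=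
    (post_stable (c := c) _ rfl S e).mono fun _ h => h.1
  have f49 := post_reg (bit := bit) (O := O) (r := 49) .rowBody rfl S
  have f52 := post_reg (bit := bit) (O := O) (r := 52) .rowBody rfl S
  have main : Sim (exec bit O .rowBody S) (rowStep i a t p) fun p' S' =>
      p'.2 = Function.update p.2 ⟨t, ht⟩ (p'.2 ⟨t, ht⟩) ∧ S'.reg 57 = p'.1.1 ∧
      S'.reg 56 = p'.1.2 ∧ S'.reg 39 = t + 1 ∧ S'.reg 50 = p₀ + (t + 1) ∧
      S'.reg 36 = c 14 + (t + 1) ∧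
      S'.reg 55 = (b + ∑ s, p.2 s * u s + p'.2 ⟨t, ht⟩ * u ⟨t, ht⟩).val ∧
      ∀ x, S'.mem x = if x = p₀ + t then (p'.2 ⟨t, ht⟩).val else S.mem x := by
    simp only [Prog.rowBody, Prog.block, exec_seq]
    have hs := sim_rowEntry (bit := bit) (O := O) (S := S) (ℓ := p.1.1) (r := p.1.2) (i := i) (a := a)
      (x := p.2) hq ht ((e 1 (by norm_num)).trans L.c1) ((e 8 (by norm_num)).trans L.c8)
      ((e 24 (by norm_num)).trans L.c24) h.r57 h.r56 h.r49 h.r39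
      (fun s => by
        rw [h.r52, h.frame _ (Or.inl (by have := s.isLt; omega))]; exact ha s)
    have fr := fun r (hr : Prog.rowEntry.writes r = false) =>
      post_reg (bit := bit) (O := O) (r := r) _ hr S
    refine Sim.bind_post (hs.and_post ((fr 0 rfl).and ((fr 8 rfl).and ((fr 50 rfl).and
      ((fr 39 rfl).and ((fr 36 rfl).and ((fr 55 rfl).and (post_mem .rowEntry rfl S)))))))) ?_
    rintro p' T ⟨⟨hp, t37, t57, t56⟩, t0, t8, t50, t39, t36, t55, tm⟩
    rw [e 0 (by norm_num), L.c0] at t0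
    rw [e 8 (by norm_num), L.c8] at t8
    rw [h.r50] at t50
    rw [h.r39] at t39
    rw [h.r36] at t36
    rw [h.r55] at t55
    have hm : S.mem (c 14 + t) = (u ⟨t, ht⟩).val := by
      rw [h.frame _ (Or.inl (by omega))]; exact hu ⟨t, ht⟩
    have hne : c 14 + t ≠ p₀ + t := by omega
    simp only [exec_store, exec_add, exec_load, exec_mulMod, PMF.pure_bind]
    rw [exec_zadd (q := q) (by simp [t0]) (by simp [t8]) (by decide) (by decide)]
    simp only [PMF.pure_bind, post_pure_iff]
    simp only [State.tick_reg, State.tick_mem, State.setReg_reg, State.setReg_mem, State.setMem_reg,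
      State.setMem_mem, Nat.reduceEqDiff, if_true, if_false, t0, t8, t50, t39, t36, t55, t37, t57,
      t56, tm, hm, hne, NeZero.ne q, ZMod.val_add, ZMod.val_mul, ← hp, add_assoc]
    simp [add_assoc]
  refine (main.and_post (hst.and (f49.and f52))).mono ?_
  rintro p' S' ⟨⟨hp, h57, h56, h39, h50, h36, h55, hm⟩, he, h49, h52⟩
  refine ⟨he, h49.trans h.r49, h52.trans h.r52, h57, h56, h39, h50, h36, ?_, ?_, ?_, ?_⟩
  · rw [h55, hp, sum_update_mul _ _ _ _ (h.zero _ le_rfl), Function.update_self, add_assoc]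
  · intro s hs
    rw [hp, Function.update_of_ne (fun e => by simp [e] at hs)]
    exact h.zero s (by omega)
  · intro s hs
    rw [hm]
    by_cases hst : s = ⟨t, ht⟩
    · subst hst; simp
    · have : s.val ≠ t := fun h => hst (Fin.ext h)
      rw [if_neg (by omega), hp, Function.update_of_ne hst]
      exact h.row s (by omega)
  · intro x hx
    rw [hm, if_neg (by omega)]
    exact h.frame x hx

theorem sim_addNoise {S : State} {e : ZMod q} (h0 : S.reg 0 = q) (h8 : S.reg 8 = 1)
    (h23 : S.reg 23 = q - 1) (h55 : S.reg 55 = e.val) :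
    Sim (exec bit O .addNoise S) ((noiseOf q bit).map fun x => e + x)
      fun e' S' => S'.reg 55 = e'.val := by
  simp only [Prog.addNoise, Prog.block, exec_seq]
  have key : (noiseOf q bit).map (fun x => e + x) = bit.bind fun d => 
      (cond d (PMF.uniformOfFintype (ZMod q)) (PMF.pure 0)).map fun x => e + x := by
    rw [noiseOf, PMF.map_bind]
  rw [key, exec_noise]
  refine Sim.bind (Sim.map_left (R := fun d T => T = (S.setReg 37 (cond d 1 0)).tick 1)
    fun _ _ => rfl) ?_
  rintro d T rfl
  rw [exec_ifZero]
  cases d with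
  | false =>
    simp only [cond_false, PMF.pure_map, add_zero]
    refine Post.sim ?_
    simp [h55]
  | true =>
    rw [if_neg (by simp), cond_true, exec_seq, exec_rand_zmod (p := q) (by simpa using h23)]
    refine Sim.map (R := fun (x : ZMod q) T => T.reg 55 = (e + x).val) ?_ fun x T h => h
    refine Sim.bind_post (Sim.map_left (R := fun (x : ZMod q) T' => T' =
      (((((S.setReg 37 1).tick 1).tick 1).setReg 37 x.val).tick 1)) fun x _ => rfl) ?_
    rintro x T rfl
    rw [exec_zadd (q := q) (by simp [h0]) (by simp [h8]) (by decide) (by decide)]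
    simp [h55, ZMod.val_add]

/-- Register 55 starts as the planted label, collects the inner product of the new row with the
shift while the row is written, and then receives the k - 1 further noise values. -/
theorem sim_genRow (L : Layout q n k σ m M c) (hq : 2 ≤ q) {S : State} {j : ℕ} (hj : j < m)
    (hmM : m ≤ M) {i : Fin k} {u : Fin (k * n) → ZMod q} {f : Fin m → Sample q n}
    (e : ∀ i < 30, S.reg i = c i) (h49 : S.reg 49 = i * n) (h50 : S.reg 50 = c 15 + j * (k * n))
    (h51 : S.reg 51 = c 16 + j) (h52 : S.reg 52 = c 11 + j * n) (h53 : S.reg 53 = c 12 + j)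
    (h54 : S.reg 54 = c 13 + j) (hf : Stored c S.mem f)
    (hu : ∀ s : Fin (k * n), S.mem (c 14 + s) = (u s).val) :
    Sim (exec bit O .genRow S) (plantSample bit (k * σ) i u (f ⟨j, hj⟩)) fun y S' =>
      S'.reg 50 = c 15 + (j + 1) * (k * n) ∧ S'.reg 51 = c 16 + (j + 1) ∧
      S'.reg 52 = c 11 + (j + 1) * n ∧ S'.reg 53 = c 12 + (j + 1) ∧ S'.reg 54 = c 13 + (j + 1) ∧
      (∀ s : Fin (k * n), S'.mem (c 15 + j * (k * n) + s) = (y.1 s).val) ∧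
      S'.mem (c 16 + j) = y.2.val ∧
      ∀ x, (x < c 15 + j * (k * n) ∨ c 15 + (j + 1) * (k * n) ≤ x) → x ≠ c 16 + j →
        S'.mem x = S.mem x := by
  obtain ⟨f1, f2, f3⟩ := hf ⟨j, hj⟩
  simp only at f1 f2 f3
  have l12 := L.c12
  have l13 := L.c13
  have l14 := L.c14
  have l15 := L.c15
  have l16 := L.c16
  have jn : j * n + n ≤ M * n := by
    have := Nat.mul_le_mul_right n (show j + 1 ≤ M by omega)
    rwa [Nat.succ_mul] at this
  have jk : j * (k * n) + k * n ≤ m * (k * n) := by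
    have := Nat.mul_le_mul_right (k * n) (show j + 1 ≤ m by omega)
    rwa [Nat.succ_mul] at this
  simp only [Prog.genRow, Prog.block, exec_seq, exec_load, exec_sub, exec_const, PMF.pure_bind,
    exec_mov (show 36 ≠ 14 by decide)]
  rw [plantSample]
  set y := f ⟨j, hj⟩ with hy
  refine Sim.bind (R := fun (x : Fin (k * n) → ZMod q) T => (∀ i < 30, T.reg i = c i) ∧
    T.reg 51 = c 16 + j ∧ T.reg 52 = c 11 + j * n ∧ T.reg 53 = c 12 + j ∧ T.reg 54 = c 13 + j ∧
    T.reg 50 = c 15 + (j + 1) * (k * n) ∧ T.reg 55 = (y.2 + ∑ s, x s * u s).val ∧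
    (∀ s : Fin (k * n), T.mem (c 15 + j * (k * n) + s) = (x s).val) ∧
    ∀ x, (x < c 15 + j * (k * n) ∨ c 15 + (j + 1) * (k * n) ≤ x) → T.mem x = S.mem x) ?_ ?_
  · rw [rowGen]
    have fr := fun r (hr : (Prog.loop 9 Prog.rowBody).writes r = false) T =>
      post_reg (bit := bit) (O := O) (r := r) _ hr T
    refine (Sim.map (R := fun p T => RowRel c S.mem (c 11 + j * n) (c 15 + j * (k * n)) i u y.2
      (k * n) p T ∧ T.reg 51 = c 16 + j ∧ T.reg 53 = c 12 + j ∧ T.reg 54 = c 13 + j) ?_ ?_)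
    · refine Sim.and_post (Sim.loop (n := k * n) (I := RowRel c S.mem (c 11 + j * n)
        (c 15 + j * (k * n)) i u y.2) ?_ ?_ ?_) ?_
      · simp [e, L.c9]
      · have hlow : ∀ i < 30, ∀ d, 30 ≤ d → i ≠ d := fun i hi d hd => by omega
        refine ⟨fun i hi => ?_, ?_, ?_, ?_, ?_, ?_, ?_, ?_, ?_, ?_, ?_, ?_⟩
        · simp [hlow i hi, e i hi]
        · simpa using h49
        · simpa using h52
        · simp [e, L.c9, L.c1]
        · simp [e, L.c20, h54, f3]
        · simp
        · simp [h50]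
        · simp [e]
        · simp [h53, f2]
        · intro s _; rfl
        · intro s hs; omega
        · intro x _; rfl
      · intro t ht p T hT
        refine sim_rowBody L hq f1 (by omega) hu (by omega) ht ?_
        exact ⟨hT.env, hT.r49, hT.r52, hT.r57, hT.r56, hT.r39, hT.r50, hT.r36, hT.r55, hT.zero,
          hT.row, hT.frame⟩
      · refine (((fr 51 rfl _).and ((fr 53 rfl _).and (fr 54 rfl _)))).mono ?_
        rintro T ⟨t51, t53, t54⟩
        refine ⟨t51.trans ?_, t53.trans ?_, t54.trans ?_⟩ <;> simp [h51, h53, h54]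
    · rintro p T ⟨hT, t51, t53, t54⟩
      refine ⟨hT.env, t51, hT.r52, t53, t54, ?_, hT.r55, fun s => hT.row s s.isLt, fun x hx => ?_⟩
      · rw [hT.r50]; ring
      · exact hT.frame x (by rw [Nat.succ_mul] at hx; omega)
  · rintro x T ⟨te, t51, t52, t53, t54, t50, t55, tr, tf⟩
    set b := y.2 + ∑ s, x s * u s with hb
    -- The machine adds the noise values to the label one by one, the specification adds their sum;
    -- associativity identifies the two.
    have hns : (noiseSum q bit (k - 1)).map (fun d => ((x, b + d) : Sample q (k * n))) =
        (iter (fun _ e => (noiseOf q bit).map fun x => e + x) (k - 1) b).map fun d => (x, d) := by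
      have : ∀ r, (noiseSum q bit r).map (fun d => b + d) =
          iter (fun _ e => (noiseOf q bit).map fun x => e + x) r b := by
        intro r
        rw [noiseSum]
        induction r with
        | zero => simp [iter, PMF.pure_map]
        | succ r ih =>
          simp only [iter, ← ih, PMF.map_bind, PMF.bind_map]
          congr 1
          ext1 z
          simp only [Function.comp, PMF.map_comp]
          congr 1
          ext1 w
          simp [add_assoc]
      rw [← this, PMF.map_comp]
      rfl
    rw [hns]
    have hl : Sim (exec bit O (.loop 25 .addNoise) T)
        (iter (fun _ e => (noiseOf q bit).map fun x => e + x) (k - 1) b) fun d T' =>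
        T'.reg 55 = d.val ∧ T'.reg 0 = q ∧ T'.reg 8 = 1 ∧ T'.reg 23 = q - 1 := by
      refine Sim.loop (n := k - 1) (I := fun _ (d : ZMod q) T' =>
        T'.reg 55 = d.val ∧ T'.reg 0 = q ∧ T'.reg 8 = 1 ∧ T'.reg 23 = q - 1) ?_ ?_ ?_
      · rw [te 25 (by norm_num), L.c25]
      · simp [t55, te, L.c0, L.c8, L.c23]
      · rintro s hs d T' ⟨h55, h0, h8, h23⟩
        have fr := fun r (hr : Prog.addNoise.writes r = false) =>
          post_reg (bit := bit) (O := O) (r := r) _ hr (T'.tick 1)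
        refine ((sim_addNoise (S := T'.tick 1) h0 h8 h23 h55).and_post ((fr 0 rfl).and
          ((fr 8 rfl).and (fr 23 rfl)))).mono ?_
        rintro d' T'' ⟨a, b, c, d⟩
        exact ⟨a, b.trans h0, c.trans h8, d.trans h23⟩
    have fr := fun r (hr : (Prog.loop 25 Prog.addNoise).writes r = false) =>
      post_reg (bit := bit) (O := O) (r := r) _ hr T
    have henv := (post_stable (bit := bit) (O := O) (c := c) (.loop 25 .addNoise) rfl T te).mono
      fun _ h => h.1
    refine Sim.map (R := fun d S' => S'.reg 50 = c 15 + (j + 1) * (k * n) ∧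
      S'.reg 51 = c 16 + (j + 1) ∧
      S'.reg 52 = c 11 + (j + 1) * n ∧ S'.reg 53 = c 12 + (j + 1) ∧ S'.reg 54 = c 13 + (j + 1) ∧
      ∀ z, S'.mem z = if z = c 16 + j then d.val else T.mem z) ?_ ?_
    · refine Sim.bind_post (hl.and_post (henv.and ((fr 50 rfl).and ((fr 51 rfl).and ((fr 52 rfl).and
        ((fr 53 rfl).and ((fr 54 rfl).and (post_mem _ rfl T)))))))) ?_
      rintro d T' ⟨⟨v55, v0, v8, -⟩, ve, v50, v51, v52, v53, v54, vm⟩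
      have v1 := (ve 1 (by norm_num)).trans L.c1
      rw [t50] at v50
      rw [t51] at v51
      rw [t52] at v52
      rw [t53] at v53
      rw [t54] at v54
      simp only [exec_store, exec_add, PMF.pure_bind, post_pure_iff]
      simp only [State.tick_reg, State.tick_mem, State.setReg_reg, State.setReg_mem,
        State.setMem_reg, State.setMem_mem, Nat.reduceEqDiff, if_true, if_false, v1, v8, v50, v51,
        v52, v53, v54, v55, vm, add_assoc, true_and]
      refine ⟨?_, fun z => trivial⟩
      ring
    · rintro d T' ⟨a50, a51, a52, a53, a54, am⟩
      refine ⟨a50, a51, a52, a53, a54, fun s => ?_, ?_, fun z hz hz' => ?_⟩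
      · rw [am, if_neg (by have := s.isLt; omega)]; exact tr s
      · rw [am, if_pos rfl]
      · rw [am, if_neg hz']; exact tf z hz

end segments
end
end SparseLPN

/-! ### One call of the oracle -/

namespace SparseLPN
noncomputable section
open scoped ENNReal

/-- The number of samples that a candidate for the secret does not satisfy. -/
def score {q n M : ℕ} [NeZero q] (A : Matrix (Fin M) (Fin n) (ZMod q)) (b : Fin M → ZMod q)
    (z : Fin n → ZMod q) : ℕ :=
  (Finset.univ.filter fun j => ∑ t, A j t * z t ≠ b j).card

/-- Replace the best candidate and its score if the new candidate is better. -/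
def better {q n M : ℕ} [NeZero q] (A : Matrix (Fin M) (Fin n) (ZMod q)) (b : Fin M → ZMod q)
    (p : ℕ × (Fin n → ZMod q)) (z : Fin n → ZMod q) : ℕ × (Fin n → ZMod q) :=
  if score A b z < p.1 then (score A b z, z) else p

namespace Prog

def genRows : Prog := block [mov 50 15, mov 51 16, mov 52 11, mov 53 12, mov 54 13, loop 4 genRow]

def extract : Prog := block [add 36 17 49, add 40 14 49, mov 41 18, loop 1 (block [load 37 36,
  load 42 40, sub 42 0 42, zadd 37 37 42, store 41 37, add 36 36 8, add 40 40 8, add 41 41 8])]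

/-- Put a candidate into the memory. -/
def genCandidate : Prog := block [rand 48 25, mul 49 1 48, genShift, genRows, query 15 17, extract]

/-- Compare register 55 with the label of the current sample. -/
def compare : Prog := block [load 37 31, add 31 31 8, sub 42 37 55, sub 44 55 37, add 42 42 44,
  ifZero 42 skip (add 43 43 8)]

def scoreEntry : Prog := block [load 37 30, load 42 41, mulMod 37 37 42 0, zadd 55 55 37,
  add 30 30 8, add 41 41 8]

def scoreBody : Prog := block [const 55 0, mov 41 18, loop 1 scoreEntry, compare]

/-- Put the score of the candidate into register 43. -/
def getScore : Prog := block [const 43 0, const 30 0, mov 31 10, loop 5 scoreBody]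

/-- Keep the better candidate. -/
def update : Prog := block [add 42 43 8, sub 42 42 47,
  ifZero 42 (block [mov 47 43, mov 36 18, mov 32 19, copy 36 32]) skip]

def trialBody : Prog := block [genCandidate, getScore, update]

end Prog

section segments
variable {q m k σ n M : ℕ} [NeZero q] {bit : PMF Bool} {O : Solver q (k * n) m}
  {c : ℕ → ℕ}

theorem Stored.of_eq (L : Layout q n k σ m M c) (hmM : m ≤ M) {mem mem' : ℕ → ℕ}
    {f : Fin m → Sample q n} (h : Stored c mem f)
    (hm : ∀ x, c 11 ≤ x → x < c 14 → mem' x = mem x) : Stored c mem' f := by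
  have l12 := L.c12
  have l13 := L.c13
  have l14 := L.c14
  intro p
  have hp := p.isLt
  have : p.val * n + n ≤ M * n := by
    have := Nat.mul_le_mul_right n (show p.val + 1 ≤ M by omega)
    rwa [Nat.succ_mul] at this
  refine ⟨fun t => ?_, ?_, ?_⟩
  · rw [hm _ (by omega) (by have := t.isLt; omega)]; exact (h p).1 t
  · rw [hm _ (by omega) (by omega)]; exact (h p).2.1
  · rw [hm _ (by omega) (by omega)]; exact (h p).2.2

theorem sim_genRows (L : Layout q n k σ m M c) (hq : 2 ≤ q) (hmM : m ≤ M) {S : State} {i : Fin k}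
    {u : Fin (k * n) → ZMod q} {f : Fin m → Sample q n}
    (e : ∀ i < 30, S.reg i = c i) (h49 : S.reg 49 = i * n) (hf : Stored c S.mem f)
    (hu : ∀ s : Fin (k * n), S.mem (c 14 + s) = (u s).val) :
    Sim (exec bit O .genRows S) (indep fun j => plantSample bit (k * σ) i u (f j)) fun R S' =>
      (∀ j : Fin m, (∀ s : Fin (k * n), S'.mem (c 15 + j * (k * n) + s) = ((R j).1 s).val) ∧
        S'.mem (c 16 + j) = (R j).2.val) ∧
      ∀ x, (x < c 15 ∨ c 17 ≤ x) → S'.mem x = S.mem x := by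
  simp only [Prog.genRows, Prog.block, exec_seq, exec_mov (show 50 ≠ 15 by decide),
    exec_mov (show 51 ≠ 16 by decide), exec_mov (show 52 ≠ 11 by decide),
    exec_mov (show 53 ≠ 12 by decide), exec_mov (show 54 ≠ 13 by decide), PMF.pure_bind]
  have l12 := L.c12
  have l13 := L.c13
  have l14 := L.c14
  have l15 := L.c15
  have l16 := L.c16
  have l17 := L.c17
  refine (Sim.loop_indep (n := m) (I := fun j (R : Fin m → Sample q (k * n)) T =>
    ((∀ i < 30, T.reg i = c i) ∧ T.reg 49 = i * n ∧ T.reg 50 = c 15 + j * (k * n) ∧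
      T.reg 51 = c 16 + j ∧ T.reg 52 = c 11 + j * n ∧ T.reg 53 = c 12 + j ∧
      T.reg 54 = c 13 + j) ∧
    (∀ l : Fin m, l.val < j →
      (∀ s : Fin (k * n), T.mem (c 15 + l * (k * n) + s) = ((R l).1 s).val) ∧
        T.mem (c 16 + l) = (R l).2.val) ∧
      ∀ x, (x < c 15 ∨ c 17 ≤ x) → T.mem x = S.mem x) ?_ ?_ ?_).mono ?_
  · simp [e, L.c4]
  · intro f
    have hlow : ∀ i < 30, ∀ d, 30 ≤ d → i ≠ d := fun i hi d hd => by omega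
    refine ⟨⟨fun i hi => ?_, ?_⟩, ?_⟩
    · simp [hlow i hi, e i hi]
    · simp [e, h49]
    · simp
  · rintro j hj R T ⟨⟨te, t49, t50, t51, t52, t53, t54⟩, tr, tm⟩
    have jk : j * (k * n) + k * n ≤ m * (k * n) := by
      have := Nat.mul_le_mul_right (k * n) (show j + 1 ≤ m by omega)
      rwa [Nat.succ_mul] at this
    have hf' : Stored c T.mem f := hf.of_eq L hmM fun x _ hx => tm x (by omega)
    have hu' : ∀ s : Fin (k * n), T.mem (c 14 + s) = (u s).val := fun s => by
      rw [tm _ (by have := s.isLt; omega)]; exact hu s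
    refine ((sim_genRow (S := T.tick 1) L hq hj hmM te t49 t50 t51 t52 t53 t54 hf' hu').and_post
      (((post_stable (c := c) _ rfl (T.tick 1) te).mono fun _ h => h.1).and
        (post_reg (r := 49) _ rfl (T.tick 1)))).mono ?_
    rintro y T' ⟨⟨v50, v51, v52, v53, v54, vr, vb, vm⟩, ve, v49⟩
    refine ⟨⟨ve, v49.trans t49, v50, v51, v52, v53, v54⟩, fun l hl => ?_, fun x hx => ?_⟩
    · by_cases hlj : l = ⟨j, hj⟩
      · subst hlj
        rw [Function.update_self]
        exact ⟨vr, vb⟩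
      · have hlj' : l.val < j := by
          have : l.val ≠ j := fun h => hlj (Fin.ext h)
          omega
        have lk : l * (k * n) + k * n ≤ j * (k * n) := by
          have := Nat.mul_le_mul_right (k * n) (show l + 1 ≤ j by omega)
          rwa [Nat.succ_mul] at this
        rw [Function.update_of_ne hlj]
        refine ⟨fun s => ?_, ?_⟩
        · have := s.isLt
          rw [vm _ (by omega) (by omega)]
          exact (tr l hlj').1 s
        · rw [vm _ (by rw [Nat.succ_mul]; omega) (by omega)]
          exact (tr l hlj').2
    · rw [vm x (by rw [Nat.succ_mul]; omega) (by omega)]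
      exact tm x hx
  · rintro R T ⟨-, h, h'⟩
    exact ⟨fun j => h j j.isLt, h'⟩

theorem post_extract (L : Layout q n k σ m M c) {S : State} {i : Fin k}
    {u z : Fin (k * n) → ZMod q} (e : ∀ i < 30, S.reg i = c i) (h49 : S.reg 49 = i * n)
    (hu : ∀ s : Fin (k * n), S.mem (c 14 + s) = (u s).val)
    (hz : ∀ s : Fin (k * n), S.mem (c 17 + s) = (z s).val) :
    Post (exec bit O .extract S) fun S' =>
      (∀ t : Fin n, S'.mem (c 18 + t) = (z (blockIdx i t) - u (blockIdx i t)).val) ∧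
      ∀ x, (x < c 18 ∨ c 19 ≤ x) → S'.mem x = S.mem x := by
  have l15 := L.c15
  have l16 := L.c16
  have l17 := L.c17
  have l18 := L.c18
  have l19 := L.c19
  simp only [Prog.extract, Prog.block, exec_seq, exec_add, exec_mov (show 41 ≠ 18 by decide),
    PMF.pure_bind]
  refine (Post.loop (n := n) (I := fun j T => (T.reg 0 = q ∧ T.reg 8 = 1 ∧
    T.reg 36 = c 17 + (i * n + j) ∧ T.reg 40 = c 14 + (i * n + j) ∧ T.reg 41 = c 18 + j) ∧
    (∀ t : Fin n, t.val < j → T.mem (c 18 + t) = (z (blockIdx i t) - u (blockIdx i t)).val) ∧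
      ∀ x, (x < c 18 ∨ c 18 + j ≤ x) → T.mem x = S.mem x) ?_ ?_ ?_).mono ?_
  · simp [e, L.c1]
  · simp [e, h49, L.c0, L.c8]
  · rintro j hj T ⟨⟨t0, t8, t36, t40, t41⟩, tr, tm⟩
    have hij := row_index_lt i.isLt hj
    have m1 : T.mem (c 17 + (i * n + j)) = (z (blockIdx i ⟨j, hj⟩)).val := by
      rw [tm _ (by omega)]; exact hz (blockIdx i ⟨j, hj⟩)
    have m2 : T.mem (c 14 + (i * n + j)) = (u (blockIdx i ⟨j, hj⟩)).val := by
      rw [tm _ (by omega)]; exact hu (blockIdx i ⟨j, hj⟩)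
    simp only [exec_seq, exec_load, exec_sub, PMF.pure_bind]
    rw [exec_zadd (q := q) (by simp [t0]) (by simp [t8]) (by decide) (by decide)]
    simp only [exec_store, exec_add, PMF.pure_bind, post_pure_iff]
    simp only [State.tick_reg, State.tick_mem, State.setReg_reg, State.setReg_mem, State.setMem_reg,
      State.setMem_mem, Nat.reduceEqDiff, if_true, if_false, t0, t8, t36, t40, t41, m1, m2,
      add_assoc, true_and]
    -- q - u.val represents -u; it equals q when u = 0, and the final reduction takes care of that.
    have hval : ((z (blockIdx i ⟨j, hj⟩)).val + (q - (u (blockIdx i ⟨j, hj⟩)).val)) % q =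
        (z (blockIdx i ⟨j, hj⟩) - u (blockIdx i ⟨j, hj⟩)).val := by
      have hlt := ZMod.val_lt (u (blockIdx i ⟨j, hj⟩))
      rw [← ZMod.val_natCast, Nat.cast_add, Nat.cast_sub hlt.le]
      simp [sub_eq_add_neg]
    refine ⟨fun t ht => ?_, fun x hx => ?_⟩
    · by_cases htj : t = ⟨j, hj⟩
      · subst htj; rw [if_pos rfl, hval]
      · have : t.val ≠ j := fun h => htj (Fin.ext h)
        rw [if_neg (by omega)]
        exact tr t (by omega)
    · rw [if_neg (by omega)]
      exact tm x (by omega)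
  · rintro T ⟨-, h, h'⟩
    exact ⟨fun t => h t t.isLt, fun x hx => h' x (by omega)⟩

theorem sim_genCandidate [NeZero k] (L : Layout q n k σ m M c) (hq : 2 ≤ q) (hmM : m ≤ M)
    {S : State} {f : Fin m → Sample q n} (e : ∀ i < 30, S.reg i = c i) (hf : Stored c S.mem f) :
    Sim (exec bit O .genCandidate S) (trial bit O (k * σ) f) fun z S' =>
      (∀ t : Fin n, S'.mem (c 18 + t) = (z t).val) ∧
      ∀ x, (x < c 14 ∨ c 19 ≤ x) → S'.mem x = S.mem x := by
  have l12 := L.c12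
  have l13 := L.c13
  have l14 := L.c14
  have l15 := L.c15
  have l16 := L.c16
  have l17 := L.c17
  have l18 := L.c18
  have l19 := L.c19
  have hmn : m * n ≤ M * n := Nat.mul_le_mul_right n hmM
  simp only [Prog.genCandidate, Prog.block, exec_seq]
  rw [exec_rand_fin (k' := k) (by rw [e 25 (by norm_num), L.c25]), trial]
  refine Sim.bind (Sim.map_left (R := fun (i : Fin k) T => T = (S.setReg 48 i.val).tick 1)
    fun _ _ => rfl) ?_
  rintro i T rfl
  rw [exec_mul (by decide) (by decide), PMF.pure_bind]
  set T := ((((S.setReg 48 i.val).tick 1).setReg 49 _).tick _) with hT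
  have te : ∀ i < 30, T.reg i = c i := by
    intro i hi
    have hlow : ∀ d, 30 ≤ d → i ≠ d := fun d hd => by omega
    simp [hT, hlow, e i hi]
  have t49 : T.reg 49 = i * n := by simp [hT, e, L.c1, mul_comm]
  have tm : T.mem = S.mem := rfl
  clear_value T
  refine Sim.bind ((sim_genShift L te).and_post
    (((post_stable (c := c) _ rfl T te).mono fun _ h => h.1).and (post_reg (r := 49) _ rfl T))) ?_
  rintro u U ⟨⟨uu, um⟩, ue, u49⟩
  have hf' : Stored c U.mem f := hf.of_eq L hmM fun x _ hx => by rw [um x (by omega), tm]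
  refine Sim.bind ((sim_genRows L hq hmM ue (u49.trans t49) hf' uu).and_post
    (((post_stable (c := c) _ rfl U ue).mono fun _ h => h.1).and (post_reg (r := 49) _ rfl U))) ?_
  rintro R V ⟨⟨vR, vm⟩, ve, v49⟩
  have hR : V.readMatrix q (k * n) m (c 15) = Matrix.of fun j => (R j).1 := by
    ext j s
    show ((V.mem (c 15 + j * (k * n) + s) : ℕ) : ZMod q) = _
    rw [(vR j).1 s]
    simp
  -- A query expects the labels directly behind the rows, which is how c 16 is laid out.
  have hb : V.readVec q m (c 15 + m * (k * n)) = fun j => (R j).2 := by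
    ext j
    show ((V.mem (c 15 + m * (k * n) + j) : ℕ) : ZMod q) = _
    rw [← l16, (vR j).2]
    simp
  have hquery : exec bit O (.query 15 17) V = (O (Matrix.of fun j => (R j).1) fun j => (R j).2).map
      fun z => (V.writeVec (c 17) z).tick (1 + m * (k * n) + m + k * n) := by
    show (O (V.readMatrix q (k * n) m (V.reg 15)) (V.readVec q m (V.reg 15 + m * (k * n)))).map _ = _
    rw [ve 15 (by norm_num), ve 17 (by norm_num), hR, hb]
  rw [hquery]
  refine Sim.map (R := fun z S' =>
      (∀ t : Fin n, S'.mem (c 18 + t) = (z (blockIdx i t) - u (blockIdx i t)).val) ∧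
      ∀ x, (x < c 14 ∨ c 19 ≤ x) → S'.mem x = S.mem x) ?_ fun z T h => h
  refine Sim.bind_post (Sim.map_left (R := fun z T => T =
    (V.writeVec (c 17) z).tick (1 + m * (k * n) + m + k * n)) fun _ _ => rfl) ?_
  rintro z W rfl
  have hw : ∀ x, (x < c 17 ∨ c 18 ≤ x) → 
      ((V.writeVec (c 17) z).tick (1 + m * (k * n) + m + k * n)).mem x = V.mem x := by
    intro x hx
    show (if h : c 17 ≤ x ∧ x - c 17 < k * n then _ else V.mem x) = _
    rw [dif_neg (by omega)]
  refine (post_extract (S := (V.writeVec (c 17) z).tick (1 + m * (k * n) + m + k * n)) (i := i) (u := u) (z := z) L ve (v49.trans (u49.trans t49)) ?_ ?_).mono ?_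
  · intro s
    have := s.isLt
    rw [hw _ (by omega), vm _ (by omega)]
    exact uu s
  · intro s
    show (if h : c 17 ≤ c 17 + s ∧ c 17 + s - c 17 < k * n then _ else V.mem _) = _
    rw [dif_pos (by have := s.isLt; omega)]
    congr 2
    ext
    simp
  · rintro X ⟨xz, xm⟩
    refine ⟨xz, fun x hx => ?_⟩
    rw [xm x (by omega), hw x (by omega), vm x (by omega), um x (by omega), tm]

end segments
end
end SparseLPN

/-! ### Scoring, keeping the best candidate, and the whole search -/

namespace SparseLPN
noncomputable section
open scoped ENNReal

namespace Prog

/-- Write zeros to the place of the best candidate. -/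
def clear : Prog := block [const 37 0, mov 36 19, loop 1 (block [store 36 37, add 36 36 8])]

/-- Everything after the constants are in place. -/
def search : Prog := block [filter, clear, mov 47 29, loop 26 trialBody, mov 36 19, const 32 0,
  copy 36 32]

end Prog

theorem sum_ite_lt_succ {R : Type} [AddCommMonoid R] {n s : ℕ} (g : Fin n → R) (hs : s < n) :
    ∑ t : Fin n, (if t.val < s + 1 then g t else 0) =
      ∑ t : Fin n, (if t.val < s then g t else 0) + g ⟨s, hs⟩ := by
  have : g ⟨s, hs⟩ = ∑ t : Fin n, if t = ⟨s, hs⟩ then g t else 0 := by simp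
  rw [this, ← Finset.sum_add_distrib]
  refine Finset.sum_congr rfl fun t _ => ?_
  have : t = ⟨s, hs⟩ ↔ t.val = s := Fin.ext_iff
  by_cases h1 : t.val < s
  · simp [this, h1, h1.ne, Nat.lt_succ_of_lt h1]
  · by_cases h2 : t.val = s
    · simp [this, h2]
    · simp [this, h1, h2, show ¬ t.val < s + 1 by omega]

section segments
variable {q m k σ n M : ℕ} [NeZero q] {bit : PMF Bool} {O : Solver q (k * n) m}
  {c : ℕ → ℕ} {A : Matrix (Fin M) (Fin n) (ZMod q)} {b : Fin M → ZMod q} {z : Fin n → ZMod q}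

theorem post_scoreBody {S : State} {j : ℕ} (hj : j < M) (e : ∀ i < 30, S.reg i = c i)
    (L : Layout q n k σ m M c) (h30 : S.reg 30 = j * n) (h31 : S.reg 31 = c 10 + j)
    (hin : HasInput c S.mem A b) (hz : ∀ t : Fin n, S.mem (c 18 + t) = (z t).val) :
    Post (exec bit O .scoreBody S) fun S' => S'.reg 30 = (j + 1) * n ∧
      S'.reg 31 = c 10 + (j + 1) ∧
      S'.reg 43 = S.reg 43 + if ∑ t, A ⟨j, hj⟩ t * z t ≠ b ⟨j, hj⟩ then 1 else 0 := by
  obtain ⟨hA, hb⟩ := hin ⟨j, hj⟩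
  simp only at hA hb
  simp only [Prog.scoreBody, Prog.block, exec_seq, exec_const, exec_mov (show 41 ≠ 18 by decide),
    PMF.pure_bind]
  refine (Post.loop (n := n) (I := fun s T => T.reg 0 = q ∧ T.reg 8 = 1 ∧
    T.reg 30 = j * n + s ∧ T.reg 31 = c 10 + j ∧ T.reg 41 = c 18 + s ∧ T.reg 43 = S.reg 43 ∧
    T.reg 55 = (∑ t : Fin n, if t.val < s then A ⟨j, hj⟩ t * z t else 0).val ∧
    T.mem = S.mem) ?_ ?_ ?_).bind ?_
  · simp [e, L.c1]
  · simp [e, L.c0, L.c8, h30, h31]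
  · rintro s hs T ⟨t0, t8, t30, t31, t41, t43, t55, tm⟩
    have m1 := hA ⟨s, hs⟩
    have m2 := hz ⟨s, hs⟩
    simp only at m1 m2
    simp only [Prog.scoreEntry, Prog.block, exec_seq, exec_load, exec_mulMod, PMF.pure_bind]
    rw [exec_zadd (q := q) (by simp [t0]) (by simp [t8]) (by decide) (by decide)]
    simp only [exec_add, PMF.pure_bind, post_pure_iff]
    simp only [State.tick_reg, State.tick_mem, State.setReg_reg, State.setReg_mem,
      Nat.reduceEqDiff, if_true, if_false, t0, t8, t30, t31, t41, t43, t55, tm, m1, m2,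
      add_assoc, true_and, NeZero.ne q, sum_ite_lt_succ _ hs, ZMod.val_add, ZMod.val_mul]
  · rintro T ⟨t0, t8, t30, t31, t41, t43, t55, tm⟩
    simp only [Fin.is_lt, if_true] at t55
    -- Both truncated differences vanish only for equal numbers, so their sum tests for inequality.
    have hcmp : ∀ v w : ZMod q, w.val - v.val + (v.val - w.val) = 0 ↔ ¬ v ≠ w := by
      intro v w
      rw [not_not]
      refine ⟨fun h => ZMod.val_injective q (by omega), ?_⟩
      rintro rfl
      omega
    simp only [Prog.compare, Prog.block, exec_seq, exec_load, exec_add, exec_sub, PMF.pure_bind,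
      exec_ifZero]
    simp only [State.tick_reg, State.setReg_reg, Nat.reduceEqDiff, if_true, if_false, t8, t31, t43,
      t55, tm, hb, hcmp]
    by_cases h : ∑ t, A ⟨j, hj⟩ t * z t ≠ b ⟨j, hj⟩
    · rw [if_neg (not_not.2 h), if_pos h]
      simp [t30, add_assoc, Nat.succ_mul]
    · rw [if_pos h, if_neg h]
      simp [t30, t43, add_assoc, Nat.succ_mul]

theorem post_getScore (L : Layout q n k σ m M c) {S : State} (e : ∀ i < 30, S.reg i = c i)
    (hin : HasInput c S.mem A b) (hz : ∀ t : Fin n, S.mem (c 18 + t) = (z t).val) :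
    Post (exec bit O .getScore S) fun S' => S'.reg 43 = score A b z := by
  simp only [Prog.getScore, Prog.block, exec_seq, exec_const, exec_mov (show 31 ≠ 10 by decide),
    PMF.pure_bind]
  refine (Post.loop (n := M) (I := fun j T => (∀ i < 30, T.reg i = c i) ∧
    T.reg 30 = j * n ∧ T.reg 31 = c 10 + j ∧
    T.reg 43 = ∑ l : Fin M, (if l.val < j then if ∑ t, A l t * z t ≠ b l then 1 else 0 else 0) ∧
    T.mem = S.mem) ?_ ?_ ?_).mono ?_
  · simp [e, L.c5]
  · have hlow : ∀ i < 30, ∀ d, 30 ≤ d → i ≠ d := fun i hi d hd => by omega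
    refine ⟨fun i hi => ?_, ?_⟩
    · simp [hlow i hi, e i hi]
    · simp [e]
  · rintro j hj T ⟨te, t30, t31, t43, tm⟩
    have hp := post_scoreBody (bit := bit) (O := O) (S := T.tick 1) (A := A) (b := b) (z := z) hj te L
      t30 t31 (by rw [State.tick_mem, tm]; exact hin) (by rw [State.tick_mem, tm]; exact hz)
    refine (hp.and (((post_stable (c := c) _ rfl (T.tick 1) te).mono fun _ h => h.1).and
      (post_mem _ rfl _))).mono ?_
    rintro T' ⟨⟨v30, v31, v43⟩, ve, vm⟩
    refine ⟨ve, v30, v31, ?_, vm.trans tm⟩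
    rw [v43, State.tick_reg, t43, sum_ite_lt_succ _ hj]
  · rintro T ⟨-, -, -, h, -⟩
    rw [h, score, Finset.card_filter]
    simp

/-- The relation between the best candidate so far with its score and the machine. -/
structure TrialRel (c : ℕ → ℕ) (A : Matrix (Fin M) (Fin n) (ZMod q)) (b : Fin M → ZMod q)
    (f : Fin m → Sample q n) (p : ℕ × (Fin n → ZMod q)) (S : State) : Prop where
  env : ∀ i < 30, S.reg i = c i
  input : HasInput c S.mem A b
  stored : Stored c S.mem f
  r47 : S.reg 47 = p.1
  best : ∀ t : Fin n, S.mem (c 19 + t) = (p.2 t).val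

theorem HasInput.of_eq (L : Layout q n k σ m M c) {mem mem' : ℕ → ℕ} (h : HasInput c mem A b)
    (hm : ∀ x, x < c 11 → mem' x = mem x) : HasInput c mem' A b := by
  have l10 := L.c10
  have l11 := L.c11
  intro j
  refine ⟨fun t => ?_, ?_⟩
  · rw [hm _ (by have := row_index_lt j.isLt t.isLt; omega)]; exact (h j).1 t
  · rw [hm _ (by have := j.isLt; omega)]; exact (h j).2

theorem post_update (L : Layout q n k σ m M c) {S : State} (e : ∀ i < 30, S.reg i = c i)
    {p : ℕ × (Fin n → ZMod q)} (h47 : S.reg 47 = p.1) (h43 : S.reg 43 = score A b z)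
    (hz : ∀ t : Fin n, S.mem (c 18 + t) = (z t).val)
    (hp : ∀ t : Fin n, S.mem (c 19 + t) = (p.2 t).val) :
    Post (exec bit O .update S) fun S' => S'.reg 47 = (better A b p z).1 ∧
      (∀ t : Fin n, S'.mem (c 19 + t) = ((better A b p z).2 t).val) ∧
      ∀ x < c 19, S'.mem x = S.mem x := by
  have l19 := L.c19
  have h8 := (e 8 (by norm_num)).trans L.c8
  simp only [Prog.update, Prog.block, exec_seq, exec_add, exec_sub, PMF.pure_bind, exec_ifZero]
  simp only [State.tick_reg, State.setReg_reg, Nat.reduceEqDiff, if_true, if_false, h8, h47, h43]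
  rw [better]
  by_cases hlt : score A b z < p.1
  · rw [if_pos (by omega), if_pos hlt]
    simp only [exec_mov (show 47 ≠ 43 by decide), exec_mov (show 36 ≠ 18 by decide),
      exec_mov (show 32 ≠ 19 by decide), PMF.pure_bind]
    have fr := fun T => post_reg (bit := bit) (O := O) (r := 47) (.copy 36 32) rfl T
    refine ((post_copy (n := n) (by decide) ?_ ?_ ?_).and (fr _)).mono ?_
    · simp [e, L.c1]
    · simp [e, L.c8]
    · simp [e]; omega
    · rintro T ⟨⟨tm, -, -⟩, t47⟩
      refine ⟨by simpa [h43] using t47, fun t => ?_, fun x hx => ?_⟩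
      · have := t.isLt
        rw [tm]
        simp [e, ← hz]
      · rw [tm]
        simp only [State.tick_reg, State.tick_mem, State.setReg_reg, State.setReg_mem,
          Nat.reduceEqDiff, if_true, if_false, e 19 (by norm_num), e 18 (by norm_num)]
        rw [if_neg (by omega)]
  · rw [if_neg (by omega), if_neg hlt]
    simp [h47, hp]

theorem sim_trialBody [NeZero k] (L : Layout q n k σ m M c) (hq : 2 ≤ q) (hmM : m ≤ M)
    {f : Fin m → Sample q n} {p : ℕ × (Fin n → ZMod q)} {S : State} (h : TrialRel c A b f p S) :
    Sim (exec bit O .trialBody S) ((trial bit O (k * σ) f).map (better A b p))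
      (TrialRel c A b f) := by
  have l12 := L.c12
  have l13 := L.c13
  have l14 := L.c14
  have l15 := L.c15
  have l16 := L.c16
  have l17 := L.c17
  have l18 := L.c18
  have l19 := L.c19
  simp only [Prog.trialBody, Prog.block, exec_seq]
  refine Sim.map (R := fun z T => TrialRel c A b f (better A b p z) T) ?_ fun z T h => h
  refine Sim.bind_post ((sim_genCandidate L hq hmM h.env h.stored).and_post
    (((post_stable (c := c) _ rfl S h.env).mono fun _ h => h.1).and
      (post_reg (r := 47) _ rfl S))) ?_
  rintro z T ⟨⟨tz, tm⟩, te, t47⟩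
  have tin : HasInput c T.mem A b := h.input.of_eq L fun x hx => tm x (by omega)
  refine ((post_getScore L te tin tz).and (((post_stable (c := c) _ rfl T te).mono
    fun _ h => h.1).and ((post_mem _ rfl T).and (post_reg (r := 47) _ rfl T)))).bind ?_
  rintro U ⟨u43, ue, um, u47⟩
  refine ((post_update (A := A) (b := b) (z := z) (p := p) L ue (u47.trans (t47.trans h.r47)) u43
    (by rw [um]; exact tz) ?_).and ((post_stable (c := c) _ rfl U ue).mono fun _ h => h.1)).mono ?_
  · intro t
    rw [um, tm _ (by omega)]
    exact h.best t
  · rintro V ⟨⟨v47, vb, vm⟩, ve⟩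
    refine ⟨ve, ?_, ?_, v47, vb⟩
    · exact tin.of_eq L fun x hx => by rw [vm x (by omega), um]
    · exact h.stored.of_eq L hmM fun x _ hx => by rw [vm x (by omega), um, tm x (by omega)]

theorem post_clear (L : Layout q n k σ m M c) {S : State} (e : ∀ i < 30, S.reg i = c i) :
    Post (exec bit O .clear S) fun S' => (∀ t : Fin n, S'.mem (c 19 + t) = 0) ∧
      ∀ x < c 19, S'.mem x = S.mem x := by
  simp only [Prog.clear, Prog.block, exec_seq, exec_const, exec_mov (show 36 ≠ 19 by decide),
    PMF.pure_bind]
  refine (Post.loop (n := n) (I := fun j T => (T.reg 8 = 1 ∧ T.reg 37 = 0 ∧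
    T.reg 36 = c 19 + j) ∧ (∀ t < j, T.mem (c 19 + t) = 0) ∧
    ∀ x < c 19, T.mem x = S.mem x) ?_ ?_ ?_).mono ?_
  · simp [e, L.c1]
  · simp [e, L.c8]
  · rintro j hj T ⟨⟨t8, t37, t36⟩, tz, tm⟩
    simp only [exec_seq, exec_store, exec_add, PMF.pure_bind, post_pure_iff]
    simp only [State.tick_reg, State.tick_mem, State.setReg_reg, State.setReg_mem, State.setMem_reg,
      State.setMem_mem, Nat.reduceEqDiff, if_true, if_false, t8, t36, t37, add_assoc, true_and]
    refine ⟨fun t ht => ?_, fun x hx => ?_⟩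
    · split_ifs with h
      · rfl
      · exact tz t (by omega)
    · rw [if_neg (by omega)]
      exact tm x hx
  · rintro T ⟨-, h, h'⟩
    exact ⟨fun t => h t t.isLt, h'⟩

/-- The output distribution of the search. -/
def searchSpec [NeZero k] (bit : PMF Bool) (O : Solver q (k * n) m) (σ T : ℕ)
    (A : Matrix (Fin M) (Fin n) (ZMod q)) (b : Fin M → ZMod q) : PMF (Fin n → ZMod q) :=
  (drive (filterStep k σ) (fun j => (A j, b j)) M (0, fun _ : Fin m => (0, 0))).bind fun p =>
    (iter (fun _ r => (trial bit O (k * σ) p.2).map (better A b r)) T (M + 1, 0)).map Prod.snd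

theorem sim_search [NeZero k] (L : Layout q n k σ m M c) (hq : 2 ≤ q) (hmM : m ≤ M) {S : State}
    (e : ∀ i < 30, S.reg i = c i) (hin : HasInput c S.mem A b)
    (hz : ∀ x, c 11 ≤ x → S.mem x = 0) :
    Sim (exec bit O .search S) (searchSpec bit O σ (c 26) A b)
      fun z S' => S'.readVec q n 0 = z := by
  have l10 := L.c10
  have l11 := L.c11
  have l12 := L.c12
  have l13 := L.c13
  have l14 := L.c14
  have l15 := L.c15
  have l16 := L.c16
  have l17 := L.c17
  have l18 := L.c18
  have l19 := L.c19
  simp only [Prog.search, Prog.block, exec_seq, searchSpec]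
  refine Sim.bind (sim_filter L hmM e hin hz) ?_
  rintro p T ⟨te, tin, tst⟩
  refine Post.bind_sim ((post_clear L te).and ((post_stable (c := c) _ rfl T te).mono
    fun _ h => h.1)) ?_
  rintro U ⟨⟨uz, um⟩, ue⟩
  rw [exec_mov (by decide), PMF.pure_bind]
  refine Sim.map (R := fun r S' => S'.readVec q n 0 = r.2) ?_ fun r S' h => h
  refine Sim.bind_post (Sim.loop (n := c 26) (I := fun _ => TrialRel c A b p.2) ?_ ?_ ?_) ?_
  · simp [ue]
  · have hlow : ∀ i < 30, ∀ d, 30 ≤ d → i ≠ d := fun i hi d hd => by omega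
    refine ⟨fun i hi => ?_, ?_, ?_, ?_, ?_⟩
    · simp [hlow i hi, ue i hi]
    · exact tin.of_eq L fun x hx => um x (by omega)
    · exact tst.of_eq L hmM fun x _ hx => um x (by omega)
    · simp [ue, L.c29]
    · intro t
      simpa using uz t
  · rintro j hj r V hV
    exact sim_trialBody L hq hmM ⟨hV.env, hV.input, hV.stored, hV.r47, hV.best⟩
  · rintro r V hV
    have ve := hV.env
    simp only [exec_mov (show 36 ≠ 19 by decide), exec_const, PMF.pure_bind]
    by_cases hn : n = 0
    · subst hn
      intro S' _
      ext t
      exact t.elim0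
    have hM : M = 0 ∨ n ≤ M * n := by
      rcases Nat.eq_zero_or_pos M with h | h
      · exact Or.inl h
      · exact Or.inr (Nat.le_mul_of_pos_left n h)
    have hk : n ≤ k * n := Nat.le_mul_of_pos_left n (Nat.pos_of_ne_zero (NeZero.ne k))
    refine (post_copy (n := n) (by decide) ?_ ?_ ?_).mono ?_
    · simp [ve, L.c1]
    · simp [ve, L.c8]
    · simp [ve]; omega
    · rintro W ⟨wm, -, -⟩
      ext t
      show ((W.mem (0 + t) : ℕ) : ZMod q) = _
      have ht := t.isLt
      have := hV.best t
      rw [wm]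
      simp [ve, this]

end segments
end
end SparseLPN

/-! ### Constants, initial state and running time -/

namespace SparseLPN
noncomputable section
open scoped ENNReal

theorem Prog.cost_mono {c c' : ℕ → ℕ} {L L' : ℕ} (hc : ∀ i, c i ≤ c' i) (hL : L ≤ L') (P : Prog) :
    P.cost c L ≤ P.cost c' L' := by
  induction P with
  | query _ _ => exact hL
  | seq P Q hP hQ => exact Nat.add_le_add hP hQ
  | ifZero _ P Q hP hQ => exact Nat.add_le_add_left (Nat.add_le_add hP hQ) _
  | loop r P hP => exact Nat.add_le_add_left (Nat.mul_le_mul (hc r) (by omega)) _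
  | _ => exact le_rfl

/-- Instructions of straight-line programs on the registers. -/
inductive Arith : Type
  | const (d c : ℕ)
  | add (d a b : ℕ)
  | sub (d a b : ℕ)
  | mul (d a b : ℕ)

namespace Arith

def toProg : Arith → Prog
  | const d c => .const d c
  | add d a b => .add d a b
  | sub d a b => .sub d a b
  | mul d a b => .mul d a b

/-- The effect on the list of register values and on the time. -/
def eval : List ℕ × ℕ → Arith → List ℕ × ℕ
  | p, const d c => (p.1.set d c, p.2 + 1)
  | p, add d a b => (p.1.set d (p.1.getD a 0 + p.1.getD b 0), p.2 + 1)
  | p, sub d a b => (p.1.set d (p.1.getD a 0 - p.1.getD b 0), p.2 + 1)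
  | p, mul d a b => (p.1.set d (p.1.getD a 0 * p.1.getD b 0), p.2 + (2 * p.1.getD a 0 + 2))

/-- The registers are in range, and a product is not written to one of its factors. -/
def fits (r : ℕ) : Arith → Bool
  | const d _ => d < r
  | add d a b => d < r && a < r && b < r
  | sub d a b => d < r && a < r && b < r
  | mul d a b => d < r && a < r && b < r && d != a && d != b

end Arith

namespace Prog

/-- Compute the constants. -/
def setupList : List Arith := [.const 8 1, .mul 9 2 1, .mul 10 1 5, .add 11 10 5, .add 12 11 10,
  .add 13 12 5, .add 14 13 5, .add 15 14 9, .mul 16 9 4, .add 16 16 15, .add 17 16 4, .add 18 17 9,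
  .add 19 18 1, .mul 20 2 3, .sub 21 1 3, .sub 22 9 1, .add 22 22 8, .sub 23 0 8, .sub 24 23 8,
  .sub 25 2 8, .mul 26 6 7, .mul 27 2 26, .const 28 12, .mul 26 28 27, .add 29 5 8]

/-- The reduction. -/
def reduction : Prog := seq (block (setupList.map Arith.toProg)) search

end Prog

/-- The values of the constants. -/
def constants (q n k σ m M E D : ℕ) : ℕ → ℕ :=
  let A := n * M
  let U := A + M + A + M + M
  let Q := U + k * n
  let B := k * n * m + Q
  let Z := B + m
  fun i => [q, n, k, σ, m, M, E, D, 1, k * n, A, A + M, A + M + A, A + M + A + M, U, Q,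
    B, Z, Z + k * n, Z + k * n + n, k * σ, n - σ, k * n - n + 1, q - 1, q - 1 - 1, k - 1,
    12 * (k * (E * D)), k * (E * D), 12, M + 1].getD i 0

theorem layout_constants (q n k σ m M E D : ℕ) :
    Layout q n k σ m M (constants q n k σ m M E D) := by
  refine ⟨rfl, rfl, rfl, rfl, rfl, rfl, rfl, rfl, mul_comm _ _, rfl, ?_, rfl, rfl, rfl, ?_, rfl, rfl,
    rfl, rfl, rfl, rfl, rfl, rfl, rfl, rfl⟩
  · show _ + _ = _ + _
    rw [mul_comm M n]
    rfl
  · show _ + _ = _ + _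
    rw [add_comm, mul_comm (k * n) m]
    rfl

section run
variable {q m k σ n M : ℕ} [NeZero q] {bit : PMF Bool} {O : Solver q (k * n) m}
  {A : Matrix (Fin M) (Fin n) (ZMod q)} {b : Fin M → ZMod q}

theorem post_arith {r : ℕ} (x : Arith) (hx : x.fits r = true) {p : List ℕ × ℕ} (hp : p.1.length = r)
    {S : State} (hr : ∀ i < r, S.reg i = p.1.getD i 0) (ht : S.time = p.2) :
    Post (exec bit O x.toProg S) fun S' => (x.eval p).1.length = r ∧
      (∀ i < r, S'.reg i = (x.eval p).1.getD i 0) ∧ S'.mem = S.mem ∧ S'.time = (x.eval p).2 := by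
  have key : ∀ d v t, d < r → ∀ i < r, ((S.setReg d v).tick t).reg i = (p.1.set d v).getD i 0 := by
    intro d v t hd i hi
    by_cases h : i = d
    · subst h
      simp [hp, hd]
    · simp [h, hr i hi, List.getElem?_set_ne (Ne.symm h)]
  cases x with
  | const d c =>
    simp only [Arith.fits, decide_eq_true_eq] at hx
    exact Post.pure ⟨by simp [Arith.eval, hp], key _ _ _ hx, rfl, by simp [Arith.eval, ht]⟩
  | add d a b =>
    simp only [Arith.fits, Bool.and_eq_true, decide_eq_true_eq] at hx
    refine Post.pure ⟨by simp [Arith.eval, hp], ?_, rfl, by simp [Arith.eval, ht]⟩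
    rw [hr a hx.1.2, hr b hx.2]
    exact key _ _ _ hx.1.1
  | sub d a b =>
    simp only [Arith.fits, Bool.and_eq_true, decide_eq_true_eq] at hx
    refine Post.pure ⟨by simp [Arith.eval, hp], ?_, rfl, by simp [Arith.eval, ht]⟩
    rw [hr a hx.1.2, hr b hx.2]
    exact key _ _ _ hx.1.1
  | mul d a b =>
    simp only [Arith.fits, Bool.and_eq_true, decide_eq_true_eq, bne_iff_ne] at hx
    obtain ⟨⟨⟨⟨hd, ha⟩, hb⟩, hda⟩, hdb⟩ := hx
    rw [Arith.toProg, exec_mul hda hdb]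
    refine Post.pure ⟨by simp [Arith.eval, hp], ?_, rfl, by simp [Arith.eval, ht, hr a ha]⟩
    rw [hr a ha, hr b hb]
    exact key _ _ _ hd

theorem post_block_arith {r : ℕ} (L : List Arith) (hL : ∀ x ∈ L, x.fits r = true) (hne : L ≠ [])
    {p : List ℕ × ℕ} (hp : p.1.length = r) {S : State} (hr : ∀ i < r, S.reg i = p.1.getD i 0)
    (ht : S.time = p.2) :
    Post (exec bit O (Prog.block (L.map Arith.toProg)) S) fun S' =>
      (∀ i < r, S'.reg i = (L.foldl Arith.eval p).1.getD i 0) ∧ S'.mem = S.mem ∧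
      S'.time = (L.foldl Arith.eval p).2 := by
  induction L generalizing p S with
  | nil => exact absurd rfl hne
  | cons x L ih =>
    have h := post_arith (bit := bit) (O := O) x (hL x (by simp)) hp hr ht
    cases L with
    | nil => exact h.mono fun _ h => h.2
    | cons y L =>
      refine h.seq fun T hT => ?_
      exact (ih (fun z hz => hL z (List.mem_cons_of_mem _ hz)) (by simp) hT.1 hT.2.1 hT.2.2.2).mono
        fun T' h' => ⟨h'.1, h'.2.1.trans hT.2.2.1, h'.2.2⟩

/-- Registers are modelled by a list so that the setup can be evaluated symbolically. First factors
of products are k, n, kn, E or 12, hence the time does not involve m or M. -/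
theorem eval_setupList (E D : ℕ) : Prog.setupList.foldl Arith.eval
    ([q, n, k, σ, m, M, E, D] ++ List.replicate 22 0, 0) =
      ((List.range 30).map (constants q n k σ m M E D), 56 + 6 * k + 2 * n + 2 * (k * n) + 2 * E) := by
  simp [Prog.setupList, Arith.eval, List.range_succ, constants]
  ring

theorem post_setup {E D : ℕ} :
    Post (exec bit O (Prog.block (Prog.setupList.map Arith.toProg))
      (initState [q, n, k, σ, m, M, E, D] A b)) fun S =>
      (∀ i < 30, S.reg i = constants q n k σ m M E D i) ∧
      S.mem = (initState [q, n, k, σ, m, M, E, D] A b).mem ∧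
      S.time = 56 + 6 * k + 2 * n + 2 * (k * n) + 2 * E := by
  have h := post_block_arith (bit := bit) (O := O) (r := 30) Prog.setupList (by decide) (by decide)
    (p := ([q, n, k, σ, m, M, E, D] ++ List.replicate 22 0, 0)) (by simp)
    (S := initState [q, n, k, σ, m, M, E, D] A b) (fun i hi => by
      show [q, n, k, σ, m, M, E, D].getD i 0 = _
      interval_cases i <;> rfl) rfl
  rw [eval_setupList] at h
  refine h.mono fun S' ⟨h1, h2, h3⟩ => ⟨fun i hi => ?_, h2, h3⟩
  rw [h1 i hi]
  simp [hi]

theorem initState_mem {params : List ℕ} (x : ℕ) : (initState params A b).mem x =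
    if h : M * n ≤ x ∧ x - M * n < M then (b ⟨x - M * n, h.2⟩).val else
      if h : x < M * n then
        (A (finProdFinEquiv.symm ⟨x, h⟩).1 (finProdFinEquiv.symm ⟨x, h⟩).2).val else 0 := by
  simp only [initState, State.writeVec, Nat.zero_le, true_and, Nat.sub_zero]

theorem initState_hasInput {params : List ℕ} {c : ℕ → ℕ} (L : Layout q n k σ m M c) :
    HasInput c (initState params A b).mem A b ∧
      ∀ x, c 11 ≤ x → (initState params A b).mem x = 0 := by
  have l10 := L.c10
  have l11 := L.c11
  refine ⟨fun j => ⟨fun t => ?_, ?_⟩, fun x hx => ?_⟩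
  · have hlt := row_index_lt j.isLt t.isLt
    rw [initState_mem, dif_neg (by omega), dif_pos hlt]
    have : finProdFinEquiv.symm (⟨j * n + t, hlt⟩ : Fin (M * n)) = (j, t) := by
      rw [Equiv.symm_apply_eq]
      ext
      simp [finProdFinEquiv]
      ring
    rw [this]
  · have := j.isLt
    rw [initState_mem, dif_pos (by omega)]
    congr 2
    ext
    simp [l10]
  · rw [initState_mem, dif_neg (by omega), dif_neg (by omega)]

theorem reduction_run [NeZero k] {η : ℝ} (hq : 2 ≤ q) (hmM : m ≤ M) {E D : ℕ} :
    reductionSolver Prog.reduction [q, n, k, σ, m, M, E, D] η O A b =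
      searchSpec (coin η) O σ (12 * (k * (E * D))) A b := by
  have L := layout_constants q n k σ m M E D
  have hin := initState_hasInput (params := [q, n, k, σ, m, M, E, D]) (A := A) (b := b) L
  have hs : Sim (run Prog.reduction [q, n, k, σ, m, M, E, D] η O A b)
      (searchSpec (coin η) O σ (12 * (k * (E * D))) A b)
      fun z S' => S'.readVec q n 0 = z := by
    refine post_setup.bind_sim ?_
    rintro S ⟨e, hm, -⟩
    exact sim_search L hq hmM e (by rw [hm]; exact hin.1) (by rw [hm]; exact hin.2)
  refine pmf_ext_expect fun f => ?_
  rw [reductionSolver, expect_map]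
  exact hs.expect_eq fun z S h => by rw [h]

/-- There are at most 12a³ trials. Making the rows costs about m · kn per trial and scoring about M
· n, so the leading terms are of order m a⁵, and m a⁶ leaves room for the rest. -/
theorem reduction_time {η : ℝ} {E D a : ℕ} (hm : 0 < m) (hn : n ≤ a) (hk : k ≤ a) (hσ : σ ≤ a)
    (hE : E ≤ a) (hD : D ≤ a) (ha : 0 < a) (hM : M ≤ 4 * a * m) :
    ∀ S ∈ (run Prog.reduction [q, n, k, σ, m, M, E, D] η O A b).support,
      S.time ≤ 100000 * m * a ^ 6 := by
  set c := constants q n k σ m M E D with hc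
  have hkn : k * n ≤ a ^ 2 := by rw [sq]; exact Nat.mul_le_mul hk hn
  have hT : 12 * (k * (E * D)) ≤ 12 * a ^ 3 := by
    rw [pow_succ', sq]; gcongr
  have key : Prog.search.cost c (1 + m * (k * n) + m + k * n) ≤
      Prog.search.cost (fun i => if i = 1 then a else if i = 4 then m else if i = 5 then 4 * a * m
        else if i = 9 then a ^ 2 else if i = 25 then a else if i = 26 then 12 * a ^ 3
        else if i = 21 then a else if i = 3 then a else c i)
        (1 + m * a ^ 2 + m + a ^ 2) := by
    refine Prog.cost_mono (fun i => ?_) (by gcongr) _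
    split_ifs with h1 h4 h5 h9 h25 h26 h21 h3
    · rw [h1]; exact hn
    · rw [h4]; exact le_rfl
    · rw [h5]; exact hM
    · rw [h9]; exact hkn
    · rw [h25]; exact (Nat.sub_le k 1).trans hk
    · rw [h26]; exact hT
    · rw [h21]; exact (Nat.sub_le n σ).trans hn
    · rw [h3]; exact hσ
    · exact le_rfl
  -- Every monomial in the cost is compared with m a⁶, after which the bound is linear arithmetic in
  -- the monomials.
  have p1 : ∀ j ≤ 6, m * a ^ j ≤ m * a ^ 6 := fun j hj =>
    Nat.mul_le_mul_left m (Nat.pow_le_pow_right ha hj)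
  have p2 : ∀ j ≤ 6, a ^ j ≤ m * a ^ 6 := fun j hj =>
    (Nat.le_mul_of_pos_left _ hm).trans (p1 j hj)
  have h : Post (run Prog.reduction [q, n, k, σ, m, M, E, D] η O A b) fun S =>
      S.time ≤ 100000 * m * a ^ 6 := by
    refine post_setup.seq fun S hS => (post_stable (c := c) _ rfl S hS.1).mono fun S' h' => ?_
    have b1 := h'.2.trans (Nat.add_le_add hS.2.2.le key)
    refine b1.trans ?_
    have b3 : 56 + 6 * k + 2 * n + 2 * (k * n) + 2 * E ≤ 56 + 6 * a + 2 * a + 2 * a ^ 2 + 2 * a := by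
      omega
    have a0 := p1 0 (by norm_num)
    have a1 := p1 1 (by norm_num)
    have a2 := p1 2 (by norm_num)
    have a3 := p1 3 (by norm_num)
    have a4 := p1 4 (by norm_num)
    have a5 := p1 5 (by norm_num)
    have e0 := p2 0 (by norm_num)
    have e1 := p2 1 (by norm_num)
    have e2 := p2 2 (by norm_num)
    have e3 := p2 3 (by norm_num)
    have e4 := p2 4 (by norm_num)
    have e5 := p2 5 (by norm_num)
    have e6 := p2 6 (by norm_num)
    refine (Nat.add_le_add_right b3 _).trans ?_
    simp only [Prog.search, Prog.filter, Prog.clear, Prog.trialBody, Prog.block, Prog.cost, Prog.mov,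
      Prog.filterBody, Prog.weigh, Prog.coins, Prog.coinStep, Prog.bern, Prog.append, Prog.copy,
      Prog.genCandidate, Prog.mul, Prog.genShift, Prog.genRows, Prog.genRow, Prog.rowBody,
      Prog.rowEntry, Prog.genEntry, Prog.addNoise, Prog.zadd, Prog.skip, Prog.extract,
      Prog.getScore, Prog.scoreBody, Prog.scoreEntry, Prog.compare, Prog.update, Nat.reduceEqDiff,
      if_true, if_false]
    ring_nf at a0 a1 a2 a3 a4 a5 e0 e1 e2 e3 e4 e5 e6 ⊢
    omega
  exact h

end run
end
end SparseLPN

namespace SparseLPN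
noncomputable section
open scoped ENNReal

/-! ### The distributions of rows and of noise -/

section weights
variable {q n : ℕ} [NeZero q]

theorem card_weightSet (w : ℕ) : (weightSet q n w).card = n.choose w * (q - 1) ^ w := by
  classical
  have hsupp : ∀ x : Fin n → ZMod q, hammingNorm x = (Finset.univ.filter fun t => x t ≠ 0).card :=
    fun x => rfl
  have hmaps : Set.MapsTo (fun x : Fin n → ZMod q => Finset.univ.filter fun t => x t ≠ 0)
      (weightSet q n w) (Finset.powersetCard w (Finset.univ : Finset (Fin n))) := by
    intro x hx
    simp only [weightSet, Finset.coe_filter, Finset.mem_univ, true_and, Set.mem_ofPred_eq] at hx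
    simp [Finset.mem_powersetCard, ← hsupp, hx]
  rw [Finset.card_eq_sum_card_fiberwise hmaps]
  have hfib : ∀ S ∈ Finset.powersetCard w (Finset.univ : Finset (Fin n)),
      ((weightSet q n w).filter fun x => (Finset.univ.filter fun t => x t ≠ 0) = S).card =
        (q - 1) ^ w := by
    intro S hS
    have hS' := (Finset.mem_powersetCard.1 hS).2
    have : ((weightSet q n w).filter fun x => (Finset.univ.filter fun t => x t ≠ 0) = S) =
        Fintype.piFinset fun t => if t ∈ S then Finset.univ.erase (0 : ZMod q) else {0} := by
      ext x
      simp only [weightSet, Finset.mem_filter, Finset.mem_univ, true_and, Fintype.mem_piFinset]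
      constructor
      · rintro ⟨-, rfl⟩ t
        by_cases ht : x t = 0 <;> simp [ht]
      · intro h
        have : (Finset.univ.filter fun t => x t ≠ 0) = S := by
          ext t
          have := h t
          by_cases ht : t ∈ S
          · simpa [ht] using this
          · simpa [ht] using this
        exact ⟨by rw [hsupp, this, hS'], this⟩
    rw [this, Fintype.card_piFinset, ← hS', ← Finset.prod_const, ← Finset.prod_subset
      (Finset.subset_univ S)]
    · refine Finset.prod_congr rfl fun t ht => ?_
      simp [ht, ZMod.card]
    · intro t _ ht
      simp [ht]
  rw [Finset.sum_congr rfl hfib, Finset.sum_const, Finset.card_powersetCard, Finset.card_univ,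
    Fintype.card_fin, smul_eq_mul]

theorem exactRow_apply (hq : 2 ≤ q) {w : ℕ} (hw : w ≤ n) (x : Fin n → ZMod q) :
    exactRow q n w x = if hammingNorm x = w then ((n.choose w * (q - 1) ^ w : ℕ) : ℝ≥0∞)⁻¹ else 0 := by
  have hpos : 0 < n.choose w * (q - 1) ^ w :=
    Nat.mul_pos (Nat.choose_pos hw) (Nat.pow_pos (by omega))
  have hne : (weightSet q n w).Nonempty := by
    rw [← Finset.card_pos, card_weightSet]; exact hpos
  rw [exactRow, dif_pos hne, PMF.uniformOfFinset_apply, card_weightSet]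
  simp [weightSet]

theorem sum_by_weight {R : Type} [CommSemiring R] (F : ℕ → R) :
    ∑ a : Fin n → ZMod q, F (hammingNorm a) =
      ∑ w ∈ Finset.range (n + 1), ((n.choose w * (q - 1) ^ w : ℕ) : R) * F w := by
  have hmaps : ∀ a ∈ (Finset.univ : Finset (Fin n → ZMod q)),
      hammingNorm a ∈ Finset.range (n + 1) := by
    intro a _
    have : hammingNorm a ≤ Fintype.card (Fin n) := hammingNorm_le_card_fintype
    rw [Fintype.card_fin] at this
    exact Finset.mem_range.2 (by omega)
  rw [← Finset.sum_fiberwise_of_maps_to hmaps]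
  refine Finset.sum_congr rfl fun w _ => ?_
  rw [← card_weightSet, ← nsmul_eq_mul, ← Finset.sum_const, weightSet]
  exact Finset.sum_congr rfl fun a ha => by rw [(Finset.mem_filter.1 ha).2]

theorem coin_true_toReal {p : ℝ} (h0 : 0 ≤ p) (h1 : p ≤ 1) : (coin p true).toReal = p := by
  have : ENNReal.ofReal p ≤ 1 := by simpa using h1
  simp [coin, this, h0]

theorem coin_false_toReal {p : ℝ} (h0 : 0 ≤ p) (h1 : p ≤ 1) : (coin p false).toReal = 1 - p := by
  have : ENNReal.ofReal p ≤ 1 := by simpa using h1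
  simp only [coin, PMF.ofFintype_apply, cond_false, min_eq_left this]
  rw [ENNReal.toReal_sub_of_le this (by simp)]
  simp [h0]

theorem toReal_expect {α : Type} [Fintype α] (p : PMF α) {f : α → ℝ≥0∞} (hf : ∀ a, f a ≠ ∞) :
    (expect p f).toReal = ∑ a, (p a).toReal * (f a).toReal := by
  rw [expect_fintype, ENNReal.toReal_sum fun a _ => ENNReal.mul_ne_top (p.apply_ne_top a) (hf a)]
  simp

theorem sum_toReal {α : Type} [Fintype α] (p : PMF α) : ∑ a, (p a).toReal = 1 := by
  have := toReal_expect p (f := fun _ => 1) (by simp)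
  simpa using this.symm

theorem toReal_expect_berq {p : ℝ} (h0 : 0 ≤ p) (h1 : p ≤ 1) {f : ZMod q → ℝ≥0∞}
    (hf : ∀ a, f a ≠ ∞) :
    (expect (berq q p) f).toReal = p * ((q : ℝ)⁻¹ * ∑ a, (f a).toReal) + (1 - p) * (f 0).toReal := by
  rw [berq, expect_bind, toReal_expect _ ?_, Fintype.sum_bool, coin_true_toReal h0 h1,
    coin_false_toReal h0 h1]
  · simp only [cond_true, cond_false, expect_pure, expect_uniform, ENNReal.toReal_mul,
      ENNReal.toReal_inv, ZMod.card, ENNReal.toReal_natCast]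
    rw [ENNReal.toReal_sum fun a _ => hf a]
  · rintro (_ | _)
    · simpa using hf 0
    · simp only [cond_true, expect_uniform, ZMod.card]
      refine ENNReal.mul_ne_top (by simp [NeZero.ne q]) ?_
      exact ENNReal.sum_ne_top.2 fun a _ => hf a

theorem toReal_ite (P : Prop) [Decidable P] :
    (if P then 1 else 0 : ℝ≥0∞).toReal = if P then 1 else 0 := by
  split_ifs <;> simp

theorem berq_apply {p : ℝ} (h0 : 0 ≤ p) (h1 : p ≤ 1) (v : ZMod q) :
    (berq q p v).toReal = p / q + if v = 0 then 1 - p else 0 := by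
  classical
  rw [← expect_indicator, toReal_expect_berq h0 h1 (by intro a; split_ifs <;> simp)]
  simp only [toReal_ite, Finset.sum_ite_eq', Finset.mem_univ, if_true, eq_comm (a := (0 : ZMod q))]
  split_ifs <;> ring

/-- The sum of two independent noise values. -/
theorem berq_add {p p' : ℝ} (h0 : 0 ≤ p) (h1 : p ≤ 1) (h0' : 0 ≤ p') (h1' : p' ≤ 1) :
    ((berq q p).bind fun x => (berq q p').map fun y => x + y) = berq q (1 - (1 - p) * (1 - p')) := by
  have hp0 : 0 ≤ 1 - (1 - p) * (1 - p') := by nlinarith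
  have hp1 : 1 - (1 - p) * (1 - p') ≤ 1 := by nlinarith
  have hq : (q : ℝ) ≠ 0 := Nat.cast_ne_zero.2 (NeZero.ne q)
  classical
  ext v
  rw [← expect_indicator, ← ENNReal.toReal_eq_toReal_iff' _ (PMF.apply_ne_top _ _), berq_apply hp0 hp1]
  · have hin : ∀ x : ZMod q, (expect (berq q p') fun y => if x + y = v then (1 : ℝ≥0∞) else 0).toReal =
        p' / q + if x = v then 1 - p' else 0 := by
      intro x
      rw [toReal_expect_berq h0' h1' (by intro a; split_ifs <;> simp)]
      simp only [toReal_ite, add_zero, ← eq_sub_iff_add_eq', Finset.sum_ite_eq', Finset.mem_univ, if_true]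
      split_ifs <;> ring
    rw [expect_bind]
    simp only [expect_map]
    rw [toReal_expect_berq h0 h1]
    · simp only [hin, Finset.sum_add_distrib, Finset.sum_const, Finset.card_univ, ZMod.card,
        nsmul_eq_mul, Finset.sum_ite_eq', Finset.mem_univ, if_true, eq_comm (a := (0 : ZMod q))]
      split_ifs <;> field_simp <;> ring
    · intro x
      exact ((expect_le_one fun y => by split_ifs <;> simp).trans_lt ENNReal.one_lt_top).ne
  · exact ((expect_le_one fun y => by split_ifs <;> simp).trans_lt ENNReal.one_lt_top).ne

theorem berq_zero : berq q 0 = PMF.pure 0 := by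
  classical
  refine pmf_ext_expect fun f => ?_
  rw [berq, expect_bind, expect_fintype, Fintype.sum_bool]
  simp [coin]

theorem berq_map_add_bind {p p' : ℝ} (h0 : 0 ≤ p) (h1 : p ≤ 1) (h0' : 0 ≤ p') (h1' : p' ≤ 1)
    (c c' : ZMod q) :
    (((berq q p).map (c + ·)).bind fun x => ((berq q p').map (c' + ·)).map fun y => x + y) =
      (berq q (1 - (1 - p) * (1 - p'))).map (c + c' + ·) := by
  rw [← berq_add h0 h1 h0' h1']
  refine pmf_ext_expect fun f => ?_
  simp only [expect_bind, expect_map]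
  congr 1
  ext x
  congr 1
  ext y
  congr 1
  ring

end weights
end
end SparseLPN

/-! ### Writing a row entry by entry -/

namespace SparseLPN
noncomputable section
open scoped ENNReal

section pmf
variable {α β : Type}

theorem le_map_apply (p : PMF α) (f : α → β) (a : α) : p a ≤ p.map f (f a) := by
  rw [PMF.map_apply]
  refine le_trans ?_ (ENNReal.le_tsum a)
  simp

theorem le_bind_apply (p : PMF α) (f : α → PMF β) (a : α) (b : β) : p a * f a b ≤ p.bind f b := by
  rw [PMF.bind_apply]
  exact ENNReal.le_tsum (f := fun a => p a * f a b) a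

/-- Both sides sum to 1, so no strict inequality is possible. Lower bounds along a single path of a
chain are therefore enough to identify its law. -/
theorem pmf_eq_of_le {p r : PMF α} (h : ∀ a, p a ≤ r a) : p = r := by
  ext a
  refine le_antisymm (h a) ?_
  by_contra hlt
  have := ENNReal.tsum_lt_tsum (f := p) (g := r) (by simp [p.tsum_coe]) h (not_le.1 hlt)
  simp [p.tsum_coe, r.tsum_coe] at this

end pmf

section tail
variable {N : ℕ} (P : Fin N → Prop) [DecidablePred P]

/-- The number of positions from `t` on with a given property. -/
def tailCount (t : ℕ) : ℕ := (Finset.univ.filter fun s => P s ∧ t ≤ s.val).card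

theorem tailCount_succ {t : ℕ} (ht : t < N) :
    tailCount P t = tailCount P (t + 1) + if P ⟨t, ht⟩ then 1 else 0 := by
  have : (if P ⟨t, ht⟩ then 1 else 0) =
      ∑ s : Fin N, if s = ⟨t, ht⟩ then (if P s then 1 else 0) else 0 := by simp
  rw [tailCount, tailCount, Finset.card_filter, Finset.card_filter, this, ← Finset.sum_add_distrib]
  refine Finset.sum_congr rfl fun s _ => ?_
  have h : s = ⟨t, ht⟩ ↔ s.val = t := Fin.ext_iff
  by_cases hP : P s
  · by_cases hs : s.val = t
    · simp [hP, hs, h]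
    · by_cases h2 : t ≤ s.val
      · simp [hP, hs, h, h2, show t + 1 ≤ s.val by omega]
      · simp [hP, hs, h, h2, show ¬ t + 1 ≤ s.val by omega]
  · simp [hP]

theorem tailCount_zero : tailCount P 0 = (Finset.univ.filter P).card := by simp [tailCount]

theorem tailCount_end : tailCount P N = 0 := by
  rw [tailCount, Finset.card_eq_zero, Finset.filter_eq_empty_iff]
  rintro s - ⟨-, h⟩
  exact absurd s.isLt (by omega)

theorem tailCount_mono {Q : Fin N → Prop} [DecidablePred Q] (h : ∀ s, P s → Q s) (t : ℕ) :
    tailCount P t ≤ tailCount Q t :=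
  Finset.card_le_card fun s hs => by
    simp only [Finset.mem_filter, Finset.mem_univ, true_and] at hs ⊢
    exact ⟨h s hs.1, hs.2⟩

end tail

section rows
variable {q n k : ℕ} [NeZero q]

/-- The number of vectors of length `L` with `r` nonzero entries. -/
def weightCount (q L r : ℕ) : ℕ := L.choose r * (q - 1) ^ r

theorem card_fin_lt {L r : ℕ} (h : r ≤ L) : (Finset.univ.filter fun u : Fin L => u.val < r).card = r := by
  rw [Fin.card_filter_val_lt]
  exact min_eq_right h

/-- The next entry is zero with probability (L + 1 - r)/(L + 1), which is the proportion of vectors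
of weight r beginning with zero. -/
theorem entryGen_zero {L r : ℕ} (hr : r ≤ L + 1) :
    (weightCount q L r : ℝ≥0∞) ≤ entryGen q (L + 1) r 0 * weightCount q (L + 1) r := by
  classical
  have hge : ((L : ℝ≥0∞) + 1)⁻¹ * ((L + 1 - r : ℕ) : ℝ≥0∞) ≤ entryGen q (L + 1) r 0 := by
    rw [← expect_indicator, entryGen, expect_bind, expect_uniform]
    refine mul_le_mul' (by simp) ?_
    have hc : ((L + 1 - r : ℕ) : ℝ≥0∞) = ∑ u : Fin (L + 1), if u.val < r then 0 else 1 := by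
      have h1 := card_fin_lt hr
      have h2 := Finset.card_filter_add_card_filter_not (s := (Finset.univ : Finset (Fin (L + 1))))
        (fun u => u.val < r)
      rw [h1, Finset.card_univ, Fintype.card_fin] at h2
      have : (Finset.univ.filter fun u : Fin (L + 1) => ¬ u.val < r).card = L + 1 - r := by omega
      rw [← this, Finset.card_filter]
      push_cast
      exact Finset.sum_congr rfl fun u _ => by split_ifs <;> simp_all
    rw [hc]
    refine Finset.sum_le_sum fun u _ => ?_
    split_ifs <;> simp
  refine le_trans ?_ (mul_le_mul_left hge _)
  have hid : L.choose r * (L + 1) = (L + 1).choose r * (L + 1 - r) := Nat.choose_mul_succ_eq L r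
  have h0 : ((L : ℝ≥0∞) + 1) ≠ 0 := by simp
  have h1 : ((L : ℝ≥0∞) + 1) ≠ ∞ := by simp
  rw [← ENNReal.mul_le_mul_iff_right h0 h1, ← mul_assoc, ← mul_assoc, ENNReal.mul_inv_cancel h0 h1,
    one_mul]
  rw [weightCount, weightCount]
  have : (L + 1) * (L.choose r * (q - 1) ^ r) = (L + 1 - r) * ((L + 1).choose r * (q - 1) ^ r) := by
    calc _ = (L.choose r * (L + 1)) * (q - 1) ^ r := by ring
      _ = _ := by rw [hid]; ring
  exact_mod_cast this.le

/-- A given nonzero value has probability (r + 1)/((L + 1)(q - 1)), which is the proportion of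
vectors of weight r + 1 beginning with it. -/
theorem entryGen_ne_zero (hq : 2 ≤ q) {L r : ℕ} (hr : r ≤ L) {v : ZMod q} (hv : v ≠ 0) :
    (weightCount q L r : ℝ≥0∞) ≤ entryGen q (L + 1) (r + 1) v * weightCount q (L + 1) (r + 1) := by
  classical
  have hγ : ((q - 1 : ℕ) : ℝ≥0∞) ≠ 0 := Nat.cast_ne_zero.2 (by omega)
  have hγ' : ((q - 1 : ℕ) : ℝ≥0∞) ≠ ∞ := ENNReal.natCast_ne_top _
  have hge : ((L : ℝ≥0∞) + 1)⁻¹ * (((r + 1 : ℕ) : ℝ≥0∞) * ((q - 1 : ℕ) : ℝ≥0∞)⁻¹) ≤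
      entryGen q (L + 1) (r + 1) v := by
    rw [← expect_indicator, entryGen, expect_bind, expect_uniform]
    refine mul_le_mul' (by simp) ?_
    have hc : ((r + 1 : ℕ) : ℝ≥0∞) = ∑ u : Fin (L + 1), if u.val < r + 1 then 1 else 0 := by
      have h1 := card_fin_lt (L := L + 1) (r := r + 1) (by omega)
      rw [Finset.card_filter] at h1
      exact_mod_cast h1.symm
    rw [hc, Finset.sum_mul]
    refine Finset.sum_le_sum fun u _ => ?_
    split_ifs with hu
    · rw [one_mul, expect_map, expect_uniform]
      have hvlt := ZMod.val_lt v
      have hv0 : v.val ≠ 0 := fun h => hv ((ZMod.val_eq_zero v).1 h)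
      have hcast : (((v.val - 1) + 1 : ℕ) : ZMod q) = v := by
        rw [Nat.sub_add_cancel (by omega)]
        exact ZMod.natCast_zmod_val v
      have hq2 : q - 2 + 1 = q - 1 := by omega
      rw [Fintype.card_fin, show ((q - 2 + 1 : ℕ) : ℝ≥0∞) = ((q - 1 : ℕ) : ℝ≥0∞) by rw [hq2]]
      nth_rewrite 1 [← mul_one (((q - 1 : ℕ) : ℝ≥0∞)⁻¹)]
      gcongr
      refine le_trans ?_ (Finset.single_le_sum (fun _ _ => zero_le)
        (Finset.mem_univ (⟨v.val - 1, by omega⟩ : Fin (q - 2 + 1))))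
      simp only [hcast, if_true, le_refl]
    · simp
  refine le_trans ?_ (mul_le_mul_left hge _)
  have hid : (L + 1) * L.choose r = (L + 1).choose (r + 1) * (r + 1) := Nat.add_one_mul_choose_eq L r
  have h0 : ((L : ℝ≥0∞) + 1) ≠ 0 := by simp
  have h1 : ((L : ℝ≥0∞) + 1) ≠ ∞ := by simp
  rw [← ENNReal.mul_le_mul_iff_right h0 h1, ← mul_assoc, ← mul_assoc, ENNReal.mul_inv_cancel h0 h1,
    one_mul, weightCount, weightCount, pow_succ]
  push_cast
  have : ((r : ℝ≥0∞) + 1) * ((q - 1 : ℕ) : ℝ≥0∞)⁻¹ *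
      (((L + 1).choose (r + 1) : ℝ≥0∞) * (((q - 1 : ℕ) : ℝ≥0∞) ^ r * ((q - 1 : ℕ) : ℝ≥0∞))) =
      (((L + 1).choose (r + 1) : ℝ≥0∞) * (r + 1)) * ((q - 1 : ℕ) : ℝ≥0∞) ^ r *
        (((q - 1 : ℕ) : ℝ≥0∞)⁻¹ * ((q - 1 : ℕ) : ℝ≥0∞)) := by ring
  have hcast : ((q : ℝ≥0∞) - 1) = ((q - 1 : ℕ) : ℝ≥0∞) := by push_cast; rfl
  rw [hcast]
  rw [this, ENNReal.inv_mul_cancel hγ hγ', mul_one]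
  have hid' : ((L : ℝ≥0∞) + 1) * L.choose r = (L + 1).choose (r + 1) * (r + 1) := by exact_mod_cast hid
  rw [← hid', mul_assoc]

/-- A position outside of a block. -/
abbrev Outside (i : Fin k) (t : Fin (k * n)) : Prop := ¬ (i * n ≤ t.val ∧ t.val - i * n < n)

/-- The specification's state after `t` entries of the row `x`. -/
def rowTrace (i : Fin k) (x : Fin (k * n) → ZMod q) (t : ℕ) : RowState q (k * n) :=
  ((tailCount (Outside (n := n) i) t, tailCount (fun s => Outside i s ∧ x s ≠ 0) t),
    fun s => if s.val < t then x s else 0)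

/-- The transition probability along the path that writes x is at least the ratio of the numbers of
completions after and before the step. Inside the planted block nothing is random and the counts
stay the same. -/
theorem le_rowStep (hq : 2 ≤ q) {i : Fin k} {a : Fin n → ZMod q} {x : Fin (k * n) → ZMod q}
    (hx : ∀ s, x (blockIdx i s) = a s) {t : ℕ} (ht : t < k * n) :
    (weightCount q (rowTrace i x (t + 1)).1.1 (rowTrace i x (t + 1)).1.2 : ℝ≥0∞) ≤
      rowStep i a t (rowTrace i x t) (rowTrace i x (t + 1)) *
        weightCount q (rowTrace i x t).1.1 (rowTrace i x t).1.2 := by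
  have hL := tailCount_succ (Outside (n := n) i) ht
  have hr := tailCount_succ (fun s => Outside i s ∧ x s ≠ 0) ht
  have hle := tailCount_mono (fun s => Outside i s ∧ x s ≠ 0) (Q := Outside (n := n) i)
    (fun s h => h.1) (t + 1)
  have hupd : Function.update (rowTrace i x t).2 ⟨t, ht⟩ (x ⟨t, ht⟩) = (rowTrace i x (t + 1)).2 := by
    ext s
    by_cases hs : s = ⟨t, ht⟩
    · subst hs; simp [rowTrace]
    · have : s.val ≠ t := fun h => hs (Fin.ext h)
      rw [Function.update_of_ne hs]
      simp only [rowTrace]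
      by_cases h2 : s.val < t
      · rw [if_pos h2, if_pos (by omega)]
      · rw [if_neg h2, if_neg (by omega)]
  rw [rowStep, dif_pos ht]
  by_cases hb : i * n ≤ t ∧ t - i * n < n
  · have hout : ¬ Outside i ⟨t, ht⟩ := fun h => h hb
    rw [if_neg hout, add_zero] at hL
    rw [if_neg (fun h => hout h.1), add_zero] at hr
    have hxa : a ⟨t - i * n, hb.2⟩ = x ⟨t, ht⟩ := by
      rw [← hx]
      congr 1
      ext
      simp only [blockIdx]
      omega
    have h1 : (rowTrace i x t).1 = (rowTrace i x (t + 1)).1 := Prod.ext hL hr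
    rw [dif_pos hb, hxa, hupd, h1]
    simp
  · have hout : Outside i ⟨t, ht⟩ := hb
    rw [if_pos hout] at hL
    rw [dif_neg hb]
    have e1 : (rowTrace i x t).1.1 = (rowTrace i x (t + 1)).1.1 + 1 := hL
    have hmap : rowTrace i x (t + 1) = (((rowTrace i x t).1.1 - 1, if x ⟨t, ht⟩ = 0 then
        (rowTrace i x t).1.2 else (rowTrace i x t).1.2 - 1),
        Function.update (rowTrace i x t).2 ⟨t, ht⟩ (x ⟨t, ht⟩)) := by
      refine Prod.ext (Prod.ext ?_ ?_) hupd.symm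
      · simp [e1]
      · show _ = if _ then tailCount _ t else tailCount _ t - 1
        rw [hr]
        by_cases h0 : x ⟨t, ht⟩ = 0
        · simp [h0, rowTrace]
        · rw [if_neg h0, if_pos ⟨hout, h0⟩]
          rfl
    have := le_map_apply (entryGen q (rowTrace i x t).1.1 (rowTrace i x t).1.2)
      (fun v => (((rowTrace i x t).1.1 - 1, if v = 0 then (rowTrace i x t).1.2 else
        (rowTrace i x t).1.2 - 1), Function.update (rowTrace i x t).2 ⟨t, ht⟩ v)) (x ⟨t, ht⟩)
    rw [← hmap] at this
    refine le_trans ?_ (mul_le_mul_left this _)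
    rw [e1]
    by_cases h0 : x ⟨t, ht⟩ = 0
    · rw [if_neg (fun h => h.2 h0), add_zero] at hr
      have e2 : (rowTrace i x t).1.2 = (rowTrace i x (t + 1)).1.2 := hr
      rw [h0, e2]
      exact entryGen_zero (hle.trans (Nat.le_succ _))
    · rw [if_pos ⟨hout, h0⟩] at hr
      have e2 : (rowTrace i x t).1.2 = (rowTrace i x (t + 1)).1.2 + 1 := hr
      rw [e2]
      exact entryGen_ne_zero hq hle h0

end rows
end
end SparseLPN

/-! ### The law of a row with a planted block -/

namespace SparseLPN
noncomputable section
open scoped ENNReal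

section rows
variable {q n k : ℕ} [NeZero q]

theorem blockIdx_injective (i : Fin k) : Function.Injective (blockIdx (n := n) i) := by
  intro s t h
  have := congrArg Fin.val h
  simp only [blockIdx, Nat.add_left_cancel_iff] at this
  exact Fin.ext this

theorem sum_outside (i : Fin k) (F : Fin (k * n) → ℕ) :
    ∑ s, (if Outside (n := n) i s then F s else 0) + ∑ t, F (blockIdx i t) = ∑ s, F s := by
  have h1 : ∑ t, F (blockIdx i t) = ∑ s, if Outside (n := n) i s then 0 else F s := by
    rw [← Finset.sum_image (f := F) (g := blockIdx i) fun s _ t _ h => blockIdx_injective i h,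
      Finset.sum_congr rfl fun s _ => (ite_not (Outside (n := n) i s) (F s) 0).symm,
      ← Finset.sum_filter]
    refine Finset.sum_congr ?_ fun _ _ => rfl
    ext s
    simp only [Finset.mem_image, Finset.mem_univ, true_and, Finset.mem_filter, not_not]
    constructor
    · rintro ⟨t, rfl⟩
      have := t.isLt
      simp only [blockIdx]
      omega
    · intro h
      refine ⟨⟨s - i * n, h.2⟩, Fin.ext ?_⟩
      simp only [blockIdx]
      omega
  rw [h1, ← Finset.sum_add_distrib]
  exact Finset.sum_congr rfl fun s _ => by split_ifs <;> simp

theorem hammingNorm_eq_sum {N : ℕ} (x : Fin N → ZMod q) :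
    hammingNorm x = ∑ s, if x s ≠ 0 then 1 else 0 := by
  rw [hammingNorm, Finset.card_filter]

theorem rowTrace_zero (i : Fin k) (x : Fin (k * n) → ZMod q) : rowTrace i x 0 =
    ((k * n - n, hammingNorm x - hammingNorm fun t => x (blockIdx i t)), 0) := by
  have h1 := sum_outside (n := n) i fun _ => 1
  have h2 := sum_outside (n := n) i fun s => if x s ≠ 0 then 1 else 0
  simp only [Finset.sum_const, Finset.card_univ, Fintype.card_fin, smul_eq_mul, mul_one] at h1
  rw [← hammingNorm_eq_sum, ← hammingNorm_eq_sum] at h2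
  refine Prod.ext (Prod.ext ?_ ?_) ?_
  · simp only [rowTrace]
    rw [tailCount_zero, Finset.card_filter]
    omega
  · simp only [rowTrace]
    rw [tailCount_zero, Finset.card_filter]
    have : ∀ s, (if Outside (n := n) i s ∧ x s ≠ 0 then 1 else 0) =
        if Outside (n := n) i s then (if x s ≠ 0 then 1 else 0) else 0 := fun s => by
      split_ifs <;> simp_all
    rw [Finset.sum_congr rfl fun s _ => this s]
    omega
  · ext s
    simp [rowTrace]

theorem block_weight_le (i : Fin k) (x : Fin (k * n) → ZMod q) :
    (hammingNorm fun t => x (blockIdx i t)) ≤ hammingNorm x ∧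
      hammingNorm x - (hammingNorm fun t => x (blockIdx i t)) ≤ k * n - n := by
  have h := rowTrace_zero i x
  have h2 := sum_outside (n := n) i fun s => if x s ≠ 0 then 1 else 0
  rw [← hammingNorm_eq_sum, ← hammingNorm_eq_sum] at h2
  refine ⟨by omega, ?_⟩
  have hle := tailCount_mono (fun s => Outside i s ∧ x s ≠ 0) (Q := Outside (n := n) i)
    (fun s h => h.1) 0
  have e1 : tailCount (fun s => Outside i s ∧ x s ≠ 0) 0 = hammingNorm x -
    hammingNorm fun t => x (blockIdx i t) := congrArg (fun p : RowState q (k * n) => p.1.2) h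
  have e2 : tailCount (Outside (n := n) i) 0 = k * n - n :=
    congrArg (fun p : RowState q (k * n) => p.1.1) h
  rwa [e1, e2] at hle

/-- The ratios of consecutive counts telescope along the path of x, leaving one over the number of
completions of the block. -/
theorem le_rowGen (hq : 2 ≤ q) {w : ℕ} {i : Fin k} {a : Fin n → ZMod q} {x : Fin (k * n) → ZMod q}
    (hx : ∀ s, x (blockIdx i s) = a s) (hw : hammingNorm x = w) :
    1 ≤ rowGen w i a x * weightCount q (k * n - n) (w - hammingNorm a) := by
  have hxa : (fun t => x (blockIdx i t)) = a := funext hx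
  have h0 := rowTrace_zero i x
  rw [hxa, hw] at h0
  have key : ∀ t ≤ k * n,
      (weightCount q (rowTrace i x t).1.1 (rowTrace i x t).1.2 : ℝ≥0∞) ≤
      iter (rowStep i a) t ((k * n - n, w - hammingNorm a), 0) (rowTrace i x t) *
        weightCount q (k * n - n) (w - hammingNorm a) := by
    intro t
    induction t with
    | zero =>
      intro _
      rw [h0]
      simp [iter]
    | succ t ih =>
      intro ht
      refine (le_rowStep hq hx (show t < k * n by omega)).trans ?_
      calc _ ≤ rowStep i a t (rowTrace i x t) (rowTrace i x (t + 1)) *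
            (iter (rowStep i a) t ((k * n - n, w - hammingNorm a), 0) (rowTrace i x t) *
              weightCount q (k * n - n) (w - hammingNorm a)) := by
            gcongr
            exact ih (by omega)
        _ = (iter (rowStep i a) t ((k * n - n, w - hammingNorm a), 0) (rowTrace i x t) *
            rowStep i a t (rowTrace i x t) (rowTrace i x (t + 1))) *
              weightCount q (k * n - n) (w - hammingNorm a) := by ring
        _ ≤ _ := by
            gcongr
            exact le_bind_apply _ _ _ _
  have hend := key _ le_rfl
  have h1 : (rowTrace i x (k * n)).1 = (0, 0) := Prod.ext (tailCount_end _) (tailCount_end _)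
  have h2 : (rowTrace i x (k * n)).2 = x := by ext s; simp [rowTrace]
  rw [h1] at hend
  have hmap := le_map_apply (iter (rowStep i a) (k * n) ((k * n - n, w - hammingNorm a), 0))
    Prod.snd (rowTrace i x (k * n))
  rw [h2] at hmap
  simp only [weightCount, Nat.choose_self, pow_zero, mul_one, Nat.cast_one] at hend
  exact hend.trans (mul_le_mul_left hmap _)

/-- The number of ways to complete a block of weight `u` to a row of weight `w`. -/
def completions (q N n w u : ℕ) : ℕ := if u ≤ w then weightCount q (N - n) (w - u) else 0

theorem sum_completions {N w : ℕ} (hn : n ≤ N) :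
    ∑ a : Fin n → ZMod q, completions q N n w (hammingNorm a) = weightCount q N w := by
  have h := sum_by_weight (q := q) (n := n) (completions q N n w)
  rw [h]
  -- Vandermonde's identity, by the weight of the block; terms with weight above n or above w are
  -- zero on either side.
  have hv := Nat.add_choose_eq n (N - n) w
  rw [Nat.add_sub_cancel' hn, Finset.Nat.sum_antidiagonal_eq_sum_range_succ_mk] at hv
  rw [weightCount, hv, Finset.sum_mul]
  set F : ℕ → ℕ := fun u => n.choose u * (q - 1) ^ u * completions q N n w u with hF
  have e1 : ∑ u ∈ Finset.range (n + 1), F u = ∑ u ∈ Finset.range (n + 1 + (w + 1)), F u := by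
    refine Finset.sum_subset (Finset.range_subset_range.2 (by omega)) fun u _ hu => ?_
    rw [Finset.mem_range] at hu
    simp [hF, Nat.choose_eq_zero_of_lt (show n < u by omega)]
  have e2 : ∑ u ∈ Finset.range (w + 1), F u = ∑ u ∈ Finset.range (n + 1 + (w + 1)), F u := by
    refine Finset.sum_subset (Finset.range_subset_range.2 (by omega)) fun u _ hu => ?_
    rw [Finset.mem_range] at hu
    simp [hF, completions, show ¬ u ≤ w by omega]
  refine (e1.trans e2.symm).trans (Finset.sum_congr rfl fun u hu => ?_)
  rw [Finset.mem_range] at hu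
  have : w = u + (w - u) := by omega
  simp only [hF, completions, if_pos (show u ≤ w by omega), weightCount]
  conv_rhs => rw [this, pow_add]
  rw [Nat.add_sub_cancel_left]
  ring

/-- The distribution of a block of a uniform vector of weight `w` and length `N`. -/
def blockRow (hq : 2 ≤ q) {N w : ℕ} (hn : n ≤ N) (hw : w ≤ N) : PMF (Fin n → ZMod q) :=
  PMF.ofFintype (fun a => completions q N n w (hammingNorm a) * (weightCount q N w : ℝ≥0∞)⁻¹) (by
    have hpos : weightCount q N w ≠ 0 :=
      (Nat.mul_pos (Nat.choose_pos hw) (Nat.pow_pos (by omega))).ne'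
    rw [← Finset.sum_mul, ← Nat.cast_sum, sum_completions hn]
    exact ENNReal.mul_inv_cancel (Nat.cast_ne_zero.2 hpos) (ENNReal.natCast_ne_top _))

/-- Drawing a block from its marginal and completing it gives the joint law of a uniform row and its
block: the product of marginal and completion probability is at least the mass of the row. -/
theorem expect_rowGen (hq : 2 ≤ q) {w : ℕ} (hn : n ≤ k * n) (hw : w ≤ k * n) (i : Fin k)
    (F : (Fin n → ZMod q) → (Fin (k * n) → ZMod q) → ℝ≥0∞) :
    (expect (blockRow hq hn hw) fun a => expect (rowGen w i a) fun x => F a x) =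
      expect (exactRow q (k * n) w) fun x => F (fun t => x (blockIdx i t)) x := by
  classical
  have key : (exactRow q (k * n) w).map (fun x => ((fun t => x (blockIdx i t)), x)) =
      (blockRow hq hn hw).bind fun a => (rowGen w i a).map fun x => (a, x) := by
    refine pmf_eq_of_le fun ⟨a, x⟩ => ?_
    rw [← expect_indicator, expect_map]
    by_cases hax : (fun t => x (blockIdx i t)) = a ∧ hammingNorm x = w
    · obtain ⟨ha, hx⟩ := hax
      have h1 : (expect (exactRow q (k * n) w) fun x' =>
          if ((fun t => x' (blockIdx i t)), x') = (a, x) then 1 else 0) ≤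
          exactRow q (k * n) w x := by
        rw [← expect_indicator]
        refine expect_mono fun x' => ?_
        split_ifs with h1 h2
        · exact le_rfl
        · exact absurd (Prod.mk.inj h1).2 h2
        · simp
        · simp
      refine h1.trans ?_
      rw [exactRow_apply hq hw, if_pos hx]
      refine le_trans ?_ (le_bind_apply _ _ a _)
      refine le_trans ?_ (mul_le_mul_right (le_map_apply (rowGen w i a) (fun x => (a, x)) x) _)
      have hle := block_weight_le i x
      rw [ha, hx] at hle
      have hb : blockRow hq hn hw a = (weightCount q (k * n - n) (w - hammingNorm a) : ℝ≥0∞) *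
          (weightCount q (k * n) w : ℝ≥0∞)⁻¹ := by
        rw [blockRow, PMF.ofFintype_apply, completions, if_pos hle.1]
      rw [hb]
      have hr := le_rowGen (w := w) hq (fun s => congrFun ha s) hx
      calc _ = 1 * (weightCount q (k * n) w : ℝ≥0∞)⁻¹ := by rw [one_mul]; rfl
        _ ≤ rowGen w i a x * weightCount q (k * n - n) (w - hammingNorm a) *
            (weightCount q (k * n) w : ℝ≥0∞)⁻¹ := by gcongr
        _ = _ := by ring
    · have : (expect (exactRow q (k * n) w) fun x' =>
          if ((fun t => x' (blockIdx i t)), x') = (a, x) then (1 : ℝ≥0∞) else 0) = 0 := by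
        rw [expect_fintype]
        refine Finset.sum_eq_zero fun x' _ => ?_
        split_ifs with h
        · obtain ⟨h1, rfl⟩ := Prod.mk.inj h
          rw [exactRow_apply hq hw, if_neg fun h2 => hax ⟨h1, h2⟩, zero_mul]
        · simp
      rw [this]
      exact zero_le
  have := congrArg (fun p => expect p fun z => F z.1 z.2) key
  simpa using this.symm

theorem iter_support {α : Type} {step : ℕ → α → PMF α} {I : ℕ → α → Prop} {a : α} (h0 : I 0 a)
    (hs : ∀ t a, I t a → ∀ b ∈ (step t a).support, I (t + 1) b) (N : ℕ) :
    ∀ b ∈ (iter step N a).support, I N b := by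
  induction N with
  | zero =>
    intro b hb
    rw [iter, PMF.mem_support_pure_iff] at hb
    exact hb ▸ h0
  | succ N ih =>
    intro b hb
    obtain ⟨c, hc, hb⟩ := (PMF.mem_support_bind_iff _ _ _).1 hb
    exact hs N c (ih c hc) b hb

/-- Steps outside the block never touch its positions, and steps inside copy it. -/
theorem rowGen_support {w : ℕ} {i : Fin k} {a : Fin n → ZMod q} {x : Fin (k * n) → ZMod q}
    (hx : x ∈ (rowGen w i a).support) : ∀ s, x (blockIdx i s) = a s := by
  obtain ⟨p, hp, rfl⟩ := (PMF.mem_support_map_iff _ _ _).1 hx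
  have := iter_support (I := fun t (p : RowState q (k * n)) => ∀ s : Fin n, i * n + s < t →
    p.2 (blockIdx i s) = a s) (step := rowStep i a) (fun s h => absurd h (Nat.not_lt_zero _)) ?_ _ p hp
  · exact fun s => this s (row_index_lt i.isLt s.isLt)
  · intro t p hp p' hp' s hs
    rw [rowStep] at hp'
    have hslt := row_index_lt i.isLt s.isLt
    by_cases ht : t < k * n
    · rw [dif_pos ht] at hp'
      by_cases hst : i * n + s = t
      · subst hst
        have := s.isLt
        rw [dif_pos (by omega), PMF.mem_support_pure_iff] at hp'
        rw [hp']
        have e1 : blockIdx i s = ⟨i * n + s, ht⟩ := rfl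
        simp only [e1, Function.update_self]
        congr 1
        ext
        simp
      · have hne : blockIdx i s ≠ ⟨t, ht⟩ := fun h => hst (congrArg Fin.val h)
        split_ifs at hp' with hb
        · rw [PMF.mem_support_pure_iff] at hp'
          simp only [hp', Function.update_of_ne hne]
          exact hp s (by omega)
        · obtain ⟨v, -, rfl⟩ := (PMF.mem_support_map_iff _ _ _).1 hp'
          simp only [Function.update_of_ne hne]
          exact hp s (by omega)
    · rw [dif_neg ht, PMF.mem_support_pure_iff] at hp'
      rw [hp']
      exact hp s (by omega)

end rows
end
end SparseLPN

/-! ### Sums of noise, and planted samples as blocks of full samples -/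

namespace SparseLPN
noncomputable section
open scoped ENNReal

section noise
variable {q : ℕ} [NeZero q] {η : ℝ}

theorem one_sub_pow_mem (h0 : 0 ≤ η) (h1 : η ≤ 1) (r : ℕ) :
    0 ≤ 1 - (1 - η) ^ r ∧ 1 - (1 - η) ^ r ≤ 1 := by
  have := pow_le_one₀ (n := r) (sub_nonneg.2 h1) (by linarith : 1 - η ≤ 1)
  have := pow_nonneg (sub_nonneg.2 h1) r
  constructor <;> linarith

theorem noiseSum_eq (h0 : 0 ≤ η) (h1 : η ≤ 1) (r : ℕ) :
    noiseSum q (coin η) r = berq q (1 - (1 - η) ^ r) := by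
  induction r with
  | zero => simp [noiseSum, iter, berq_zero]
  | succ r ih =>
    have h := one_sub_pow_mem h0 h1 r
    have e : 1 - (1 - η) ^ (r + 1) = 1 - (1 - (1 - (1 - η) ^ r)) * (1 - η) := by ring
    rw [e, ← berq_add h.1 h.2 h0 h1, ← ih]
    rfl

/-- A sum is uniform as soon as one summand is, so the probabilities 1 - p of no noise multiply. The
offsets c allow one noise value to be prescribed. -/
theorem sum_indep_berq {N : ℕ} {p : Fin N → ℝ} (h0 : ∀ l, 0 ≤ p l) (h1 : ∀ l, p l ≤ 1)
    (c : Fin N → ZMod q) :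
    (indep fun l => (berq q (p l)).map (c l + ·)).map (fun es => ∑ l, es l) =
      (berq q (1 - ∏ l, (1 - p l))).map (∑ l, c l + ·) := by
  induction N with
  | zero => simp [indep, berq_zero, PMF.pure_map]
  | succ N ih =>
    have hp0 : 0 ≤ ∏ l : Fin N, (1 - p l.succ) :=
      Finset.prod_nonneg fun l _ => sub_nonneg.2 (h1 _)
    have hp1 : ∏ l : Fin N, (1 - p l.succ) ≤ 1 :=
      Finset.prod_le_one (fun l _ => sub_nonneg.2 (h1 _)) fun l _ => by linarith [h0 l.succ]
    have e := berq_map_add_bind (q := q) (h0 0) (h1 0)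
      (p' := 1 - ∏ l : Fin N, (1 - p l.succ)) (by linarith) (by linarith) (c 0) (∑ l : Fin N, c l.succ)
    rw [← ih (fun l => h0 l.succ) (fun l => h1 l.succ) fun l => c l.succ, sub_sub_cancel,
      ← Fin.prod_univ_succ (fun l => 1 - p l), ← Fin.sum_univ_succ] at e
    rw [← e]
    refine pmf_ext_expect fun f => ?_
    simp [expect_indep_succ, Fin.sum_univ_succ]

theorem expect_indep_fix {α : Type} {N : ℕ} (D : Fin N → PMF α) (i : Fin N)
    (H : α → (Fin N → α) → ℝ≥0∞) :
    (expect (D i) fun e => expect (indep fun l => if l = i then PMF.pure e else D l) fun es =>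
      H e es) = expect (indep D) fun es => H (es i) es := by
  induction N with
  | zero => exact i.elim0
  | succ N ih =>
    refine Fin.cases ?_ (fun i => ?_) i
    · simp [expect_indep_succ, Fin.succ_ne_zero]
    · simp only [expect_indep_succ, Fin.succ_inj, (Fin.succ_ne_zero i).symm, if_false,
        Fin.cons_succ]
      rw [expect_comm]
      refine expect_congr fun x _ => ?_
      exact ih (fun l => D l.succ) i fun e f => H e (Fin.cons x f)

/-- Fresh noise values, except for one that is fixed. -/
def fixedNoise (q : ℕ) [NeZero q] (η : ℝ) {k : ℕ} (i : Fin k) (e : ZMod q) : PMF (Fin k → ZMod q) :=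
  indep fun l => if l = i then PMF.pure e else berq q η

theorem sum_fixedNoise (h0 : 0 ≤ η) (h1 : η ≤ 1) {k : ℕ} (i : Fin k) (e : ZMod q) :
    (fixedNoise q η i e).map (fun es => ∑ l, es l) =
      (noiseSum q (coin η) (k - 1)).map (e + ·) := by
  have h := sum_indep_berq (q := q) (p := fun l : Fin k => if l = i then 0 else η)
    (fun l => by split_ifs <;> simp [h0]) (fun l => by split_ifs <;> simp [h1])
    (fun l => if l = i then e else 0)
  -- The prescribed value is treated as noise of rate zero with offset e.
  have e1 : (fun l => (berq q (if l = i then 0 else η)).map ((if l = i then e else 0) + ·)) =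
      fun l => if l = i then PMF.pure e else berq q η := by
    funext l
    split_ifs
    · simp [berq_zero, PMF.pure_map]
    · simp only [zero_add]; exact PMF.map_id _
  have e2 : ∏ l : Fin k, (1 - if l = i then 0 else η) = (1 - η) ^ (k - 1) := by
    rw [← Finset.mul_prod_erase _ _ (Finset.mem_univ i), if_pos rfl, sub_zero, one_mul]
    rw [Finset.prod_congr rfl fun l hl => by rw [if_neg (Finset.ne_of_mem_erase hl)],
      Finset.prod_const, Finset.card_erase_of_mem (Finset.mem_univ i), Finset.card_univ,
      Fintype.card_fin]
  rw [e1, e2] at h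
  rw [fixedNoise, h, noiseSum_eq h0 h1]
  simp

theorem sum_iid_berq (h0 : 0 ≤ η) (h1 : η ≤ 1) (k : ℕ) :
    (iid (berq q η) k).map (fun es => ∑ l, es l) = berq q (1 - (1 - η) ^ k) := by
  have h := sum_indep_berq (q := q) (p := fun _ : Fin k => η) (fun _ => h0) (fun _ => h1) fun _ => 0
  have e1 : (berq q η).map ((0 : ZMod q) + ·) = berq q η := by
    simp only [zero_add]; exact PMF.map_id _
  have e2 : (berq q (1 - (1 - η) ^ k)).map ((0 : ZMod q) + ·) = berq q (1 - (1 - η) ^ k) := by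
    simp only [zero_add]; exact PMF.map_id _
  simp only [e1, Finset.sum_const_zero, Finset.prod_const, Finset.card_univ, Fintype.card_fin,
    e2] at h
  rw [iid_eq_indep, h]

end noise

section samples
variable {q n k : ℕ} [NeZero q] {η : ℝ}

theorem blockIdx_eq (l : Fin k) (t : Fin n) : blockIdx l t = finProdFinEquiv (l, t) := by
  ext
  simp [blockIdx, finProdFinEquiv]
  ring

/-- Cut a row into blocks with noise values. -/
def splitRow (x : Fin (k * n) → ZMod q) (es : Fin k → ZMod q) : Fin k → Sample q n :=
  fun l => (fun t => x (blockIdx l t), es l)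

/-- Put the blocks together. -/
def joinRow (y : Fin k → Sample q n) : Fin (k * n) → ZMod q :=
  fun t => (y (finProdFinEquiv.symm t).1).1 (finProdFinEquiv.symm t).2

theorem join_split (x : Fin (k * n) → ZMod q) (es : Fin k → ZMod q) :
    joinRow (splitRow x es) = x := by
  ext t
  simp only [joinRow, splitRow, blockIdx_eq, Prod.mk.eta, Equiv.apply_symm_apply]

theorem split_join (y : Fin k → Sample q n) : splitRow (joinRow y) (fun l => (y l).2) = y := by
  ext l
  · simp only [joinRow, splitRow, blockIdx_eq, Equiv.symm_apply_apply]
  · rfl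

theorem hammingNorm_joinRow (y : Fin k → Sample q n) :
    hammingNorm (joinRow y) = ∑ l, hammingNorm (y l).1 := by
  simp only [hammingNorm_eq_sum]
  rw [← finProdFinEquiv.sum_comp, Fintype.sum_prod_type]
  simp [joinRow]

/-- The blocks of a uniform row of weight `w` with noise. -/
def fullRow (q n k w : ℕ) [NeZero q] (η : ℝ) : PMF (Fin k → Sample q n) :=
  (exactRow q (k * n) w).bind fun x => (iid (berq q η) k).map (splitRow x)

/-- The blocks of a row with a planted block and noise. -/
def plantRow (w : ℕ) (η : ℝ) (i : Fin k) (y : Sample q n) : PMF (Fin k → Sample q n) :=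
  (rowGen w i y.1).bind fun x => (fixedNoise q η i y.2).map (splitRow x)

/-- A block of a uniform row of weight `w` with noise. -/
def blockSample (hq : 2 ≤ q) {N w : ℕ} (hn : n ≤ N) (hw : w ≤ N) (η : ℝ) : PMF (Sample q n) :=
  (blockRow hq hn hw).bind fun a => (berq q η).map fun e => (a, e)

/-- Planting a block sample that follows the marginal gives the joint law of a full row and its i-th
block. This is the disintegration that `direct_product` needs. -/
theorem expect_plantRow (hq : 2 ≤ q) {w : ℕ} (hn : n ≤ k * n) (hw : w ≤ k * n) (i : Fin k)
    (F : Sample q n → (Fin k → Sample q n) → ℝ≥0∞) :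
    (expect (blockSample hq hn hw η) fun y => expect (plantRow w η i y) fun R => F y R) =
      expect (fullRow q n k w η) fun R => F (R i) R := by
  simp only [blockSample, plantRow, fullRow, expect_bind, expect_map]
  have h1 : ∀ a : Fin n → ZMod q, (expect (berq q η) fun e => expect (rowGen w i a) fun x =>
      expect (fixedNoise q η i e) fun es => F (a, e) (splitRow x es)) =
      expect (rowGen w i a) fun x => expect (iid (berq q η) k) fun es =>
        F (a, es i) (splitRow x es) := by
    intro a
    rw [expect_comm]
    refine expect_congr fun x _ => ?_
    rw [iid_eq_indep]
    exact expect_indep_fix (fun _ : Fin k => berq q η) i fun e es => F (a, e) (splitRow x es)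
  simp only [h1]
  exact expect_rowGen hq hn hw i fun a x => expect (iid (berq q η) k) fun es =>
    F (a, es i) (splitRow x es)

theorem fullRow_apply (w : ℕ) (y : Fin k → Sample q n) :
    fullRow q n k w η y = exactRow q (k * n) w (joinRow y) * ∏ l, berq q η (y l).2 := by
  classical
  have h : ∀ x es, (if splitRow x es = y then (1 : ℝ≥0∞) else 0) =
      (if x = joinRow y then 1 else 0) * if es = fun l => (y l).2 then 1 else 0 := by
    intro x es
    by_cases hy : splitRow x es = y
    · subst hy
      rw [join_split]
      simp [splitRow]
    · rw [if_neg hy]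
      by_cases hx : x = joinRow y
      · rw [if_neg (c := es = _), mul_zero]
        rintro rfl
        exact hy (by rw [hx, split_join])
      · simp [hx]
  rw [← expect_indicator, fullRow, expect_bind]
  simp only [expect_map, h]
  simp only [expect_const_mul, expect_mul_const, expect_indicator]
  rw [iid_eq_indep, indep_apply]

/-- The product inequality applies with a block together with its noise value as one component: the
noise masses sum to 1, so the class of weight u has mass C(n, u)(q - 1)^u, and γ = q - 1. -/
theorem expect_fullRow_prod_le (hq : 2 ≤ q) (hk : 3 ≤ k) (hn0 : 0 < n) {w : ℕ} (hn : n ≤ k * n)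
    (hw : w ≤ k * n) (f : Fin k → Sample q n → ℝ≥0∞)
    (hf : ∀ l x, f l x ≤ 1) :
    expect (fullRow q n k w η) (fun y => ∏ l, f l (y l)) ≤
      ∏ l, (expect (blockSample hq hn hw η) fun x => f l x ^ 2) ^ (1 / 2 : ℝ) := by
  refine (expect_blocks_le (s := w) hk hn0 (fun x : Sample q n => hammingNorm x.1)
    (μ := fun x => (berq q η x.2).toReal) (fun _ => ENNReal.toReal_nonneg) (γ := (q - 1 : ℕ))
    (C := ((weightCount q (k * n) w : ℕ) : ℝ)⁻¹) (by exact_mod_cast (by omega : 0 < q - 1)) ?_ ?_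
    hf).trans_eq ?_
  · intro u
    rw [Finset.sum_filter, Fintype.sum_prod_type]
    have : ∀ a : Fin n → ZMod q, (∑ e : ZMod q,
        if hammingNorm a = u then (berq q η e).toReal else 0) =
        if hammingNorm a = u then 1 else 0 := by
      intro a
      split_ifs
      · exact sum_toReal _
      · simp
    simp only [this]
    rw [← Finset.sum_filter, Finset.sum_const, nsmul_eq_mul, mul_one, mul_comm]
    have hc := card_weightSet (q := q) (n := n) u
    rw [weightSet] at hc
    rw [hc]
    push_cast
    rfl
  · intro y
    rw [fullRow_apply, ENNReal.toReal_mul, ENNReal.toReal_prod, exactRow_apply hq hw,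
      hammingNorm_joinRow]
    split_ifs
    · simp only [weightCount, ENNReal.toReal_inv, ENNReal.toReal_natCast]
    · simp
  · refine Finset.prod_congr rfl fun l _ => ?_
    rw [← expect_plantRow hq hn hw l fun y _ => f l y ^ 2]
    simp

/-- The secret at the position of a block. -/
def atBlock (i : Fin k) (s : Fin n → ZMod q) : Fin (k * n) → ZMod q :=
  fun t => if (finProdFinEquiv.symm t).1 = i then s (finProdFinEquiv.symm t).2 else 0

theorem sum_mul_atBlock (i : Fin k) (s : Fin n → ZMod q) (x : Fin (k * n) → ZMod q) :
    ∑ t, x t * atBlock i s t = ∑ t, x (blockIdx i t) * s t := by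
  rw [← finProdFinEquiv.sum_comp, Fintype.sum_prod_type]
  simp only [atBlock, Equiv.symm_apply_apply, blockIdx_eq]
  rw [Finset.sum_eq_single i]
  · simp
  · intro l _ hl
    simp [hl]
  · simp

/-- The sample with the secret `s`. -/
def labelled (s : Fin n → ZMod q) (y : Sample q n) : Sample q n := (y.1, ∑ t, y.1 t * s t + y.2)

/-- The sample for the oracle with the secret `u`. -/
def joined (u : Fin (k * n) → ZMod q) (y : Fin k → Sample q n) : Sample q (k * n) :=
  (joinRow y, ∑ t, joinRow y t * u t + ∑ l, (y l).2)

/-- The planted label already contains the inner product of block i with s. After the shift the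
sample is therefore one for the secret u plus s at block i, and its noise is the sum of all k
values. -/
theorem plantSample_labelled (h0 : 0 ≤ η) (h1 : η ≤ 1) (w : ℕ) (i : Fin k) (s : Fin n → ZMod q)
    (u : Fin (k * n) → ZMod q) (y : Sample q n) :
    plantSample (coin η) w i u (labelled s y) = (plantRow w η i y).map (joined (u + atBlock i s)) := by
  refine pmf_ext_expect fun f => ?_
  simp only [plantSample, plantRow, labelled, expect_bind, expect_map]
  refine expect_congr fun x hx => ?_
  have hb := rowGen_support hx
  simp only [joined, join_split]
  have e1 : ∀ es : Fin k → ZMod q, ∑ l, (splitRow x es l).2 = ∑ l, es l := fun es => rfl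
  simp only [e1]
  have e2 : (expect (fixedNoise q η i y.2) fun es => f (x, ∑ t, x t * (u + atBlock i s) t + ∑ l, es l)) =
      expect ((fixedNoise q η i y.2).map fun es => ∑ l, es l) fun e =>
        f (x, ∑ t, x t * (u + atBlock i s) t + e) := by rw [expect_map]
  rw [e2, sum_fixedNoise h0 h1, expect_map]
  refine expect_congr fun e _ => ?_
  have e3 : ∑ t, x t * (u + atBlock i s) t = ∑ t, x t * u t + ∑ t, y.1 t * s t := by
    simp only [Pi.add_apply, mul_add, Finset.sum_add_distrib, sum_mul_atBlock, hb]
  rw [e3]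
  congr 2
  ring

theorem fullRow_joined (h0 : 0 ≤ η) (h1 : η ≤ 1) (w : ℕ) (f : (Fin (k * n) → ZMod q) → ZMod q → ℝ≥0∞) :
    (expect (fullRow q n k w η) fun R => f (joinRow R) (∑ l, (R l).2)) =
      expect (exactRow q (k * n) w) fun x => expect (berq q (1 - (1 - η) ^ k)) fun e => f x e := by
  simp only [fullRow, expect_bind, expect_map, join_split]
  refine expect_congr fun x _ => ?_
  rw [← sum_iid_berq h0 h1, expect_map]
  rfl

end samples
end
end SparseLPN

/-! ### Success of a trial, repeated trials, and collecting accepted samples -/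

namespace SparseLPN
noncomputable section
open scoped ENNReal

section product
variable {α β γ : Type}

/-- Independent pairs with independent components. -/
theorem expect_iid_pair {ρ : PMF α} {D : PMF β} {D' : PMF γ} {a : α → β} {b : α → γ}
    (h : ∀ f : β → γ → ℝ≥0∞, (expect ρ fun y => f (a y) (b y)) =
      expect D fun x => expect D' fun e => f x e) {m : ℕ} (G : (Fin m → β) → (Fin m → γ) → ℝ≥0∞) :
    (expect (iid ρ m) fun R => G (fun j => a (R j)) fun j => b (R j)) =
      expect (iid D m) fun A => expect (iid D' m) fun e => G A e := by
  induction m with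
  | zero =>
    simp only [iid, expect_pure]
    congr 1 <;> exact Subsingleton.elim _ _
  | succ m ih =>
    simp only [iid_eq_indep, expect_indep_succ] at ih ⊢
    have hc : ∀ (y : α) (R : Fin m → α), G (fun j => a ((Fin.cons y R : Fin (m + 1) → α) j))
        (fun j => b ((Fin.cons y R : Fin (m + 1) → α) j)) =
        G (Fin.cons (a y) fun j => a (R j)) (Fin.cons (b y) fun j => b (R j)) := by
      intro y R
      congr 1 <;> (ext j; refine Fin.cases ?_ (fun j => ?_) j <;> simp)
    simp only [hc]
    have h1 : ∀ y, (expect (indep fun _ : Fin m => ρ) fun R =>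
        G (Fin.cons (a y) fun j => a (R j)) (Fin.cons (b y) fun j => b (R j))) =
        expect (indep fun _ : Fin m => D) fun A => expect (indep fun _ : Fin m => D') fun e =>
          G (Fin.cons (a y) A) (Fin.cons (b y) e) :=
      fun y => ih fun A e => G (Fin.cons (a y) A) (Fin.cons (b y) e)
    simp only [h1]
    rw [h fun x z => expect (indep fun _ : Fin m => D) fun A => expect (indep fun _ : Fin m => D')
      fun e => G (Fin.cons x A) (Fin.cons z e)]
    refine expect_congr fun x _ => ?_
    rw [expect_comm]

theorem expect_indep_map {N : ℕ} (D : Fin N → PMF α) (g : Fin N → α → β) (F : (Fin N → β) → ℝ≥0∞) :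
    expect (indep fun j => (D j).map (g j)) F = expect (indep D) fun x => F fun j => g j (x j) := by
  induction N with
  | zero =>
    simp only [indep, expect_pure]
    congr 1
    exact Subsingleton.elim _ _
  | succ N ih =>
    simp only [expect_indep_succ, expect_map]
    refine expect_congr fun x _ => ?_
    rw [ih (fun j => D j.succ) (fun j => g j.succ) fun f => F (Fin.cons (g 0 x) f)]
    refine expect_congr fun f _ => ?_
    congr 1
    ext j
    refine Fin.cases ?_ (fun j => ?_) j <;> simp

theorem iid_uniform [Fintype α] [Nonempty α] (N : ℕ) :
    iid (PMF.uniformOfFintype α) N = PMF.uniformOfFintype (Fin N → α) := by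
  classical
  ext x
  rw [iid_eq_indep, indep_apply]
  simp [ENNReal.inv_pow]

end product

section oracle
variable {q n k m : ℕ} [NeZero q] {η : ℝ}

/-- The success probability of the oracle on given rows and noise. -/
def rowsSuccess (O : Solver q (k * n) m) (R : Fin m → Fin k → Sample q n) : ℝ≥0∞ :=
  expect (PMF.uniformOfFintype (Fin (k * n) → ZMod q)) fun u =>
    O (Matrix.of fun j => (joined u (R j)).1) (fun j => (joined u (R j)).2) u

theorem rowsSuccess_le_one (O : Solver q (k * n) m) (R : Fin m → Fin k → Sample q n) :
    rowsSuccess O R ≤ 1 :=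
  expect_le_one fun u => PMF.coe_le_one _ u

theorem successProb_eq {N : ℕ} (row : PMF (Fin N → ZMod q)) (η : ℝ) (S : Solver q N m) :
    successProb row η S = expect (PMF.uniformOfFintype (Fin N → ZMod q)) fun s =>
      expect (iid row m) fun A => expect (iid (berq q η) m) fun e =>
        S (Matrix.of A) (fun j => ∑ t, A j t * s t + e j) s := by
  classical
  rw [successProb, ← expect_indicator]
  simp only [expect_bind, expect_map, decide_eq_true_eq]
  simp only [expect_indicator]
  rfl

/-- The oracle's noise has the law of a sum of k noise values, so its instance can be drawn with a
noise value for each block. -/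
theorem successExact_eq (h0 : 0 ≤ η) (h1 : η ≤ 1) (w : ℕ) (O : Solver q (k * n) m) :
    successExact w (1 - (1 - η) ^ k) O = expect (iid (fullRow q n k w η) m) (rowsSuccess O) := by
  rw [successExact, successProb_eq]
  change _ = expect _ fun R => rowsSuccess O R
  simp only [rowsSuccess]
  rw [expect_comm (iid (fullRow q n k w η) m)]
  refine expect_congr fun u _ => ?_
  exact (expect_iid_pair (fun f => fullRow_joined h0 h1 w f)
    fun A e => O (Matrix.of A) (fun j => ∑ t, A j t * u t + e j) u).symm

/-- If the oracle returns its whole secret, the candidate is right. The converse may fail, since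
only block i is read, hence an inequality. -/
theorem le_trial [NeZero k] (h0 : 0 ≤ η) (h1 : η ≤ 1) (O : Solver q (k * n) m) (w : ℕ)
    (s : Fin n → ZMod q) (f : Fin m → Sample q n) :
    (k : ℝ≥0∞)⁻¹ * ∑ i : Fin k, expect (indep fun j => plantRow w η i (f j)) (rowsSuccess O) ≤
      trial (coin η) O w (fun j => labelled s (f j)) s := by
  classical
  rw [← expect_indicator, trial, expect_bind, expect_uniform, Fintype.card_fin]
  gcongr with i _
  rw [iid_uniform]
  change (expect _ fun R => rowsSuccess O R) ≤ _
  simp only [rowsSuccess]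
  -- For uniform u, the secret u plus s at block i is uniform as well, whatever s and i are.
  rw [expect_comm, ← expect_uniform_equiv (Equiv.addRight (atBlock i s)), expect_bind]
  refine expect_mono fun u => ?_
  simp only [plantSample_labelled h0 h1]
  rw [expect_bind, expect_indep_map]
  refine expect_mono fun R => ?_
  simp only [expect_map, Equiv.coe_addRight]
  rw [← expect_indicator]
  refine expect_mono fun z => ?_
  split_ifs with hz hz' hz'
  · exact le_rfl
  · refine absurd (funext fun t => ?_) hz'
    simp [hz, atBlock, blockIdx_eq]
  · exact zero_le
  · exact zero_le

/-- For most noisy blocks, an oracle that succeeds on full rows succeeds in a trial. -/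
theorem oracle_direct_product (hq : 2 ≤ q) (hk : 3 ≤ k) (hn0 : 0 < n) {w : ℕ} (hn : n ≤ k * n)
    (hw : w ≤ k * n) (h0 : 0 ≤ η) (h1 : η ≤ 1) (O : Solver q (k * n) m) (t : ℝ≥0∞)
    (B : Set (Fin m → Sample q n)) [DecidablePred (· ∈ B)]
    (hB : ∀ f ∈ B, (k : ℝ≥0∞)⁻¹ * ∑ i : Fin k, expect (indep fun j => plantRow w η i (f j))
      (rowsSuccess O) ≤ t) :
    successExact w (1 - (1 - η) ^ k) O ≤
      (1 - expect (iid (blockSample hq hn hw η) m) fun f => if f ∈ B then 1 else 0) ^ ((k : ℝ) / 2) +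
        k * t := by
  rw [successExact_eq h0 h1]
  refine direct_product (fun i F => expect_plantRow hq hn hw i F)
    (fun f hf => expect_fullRow_prod_le hq hk hn0 hn hw f hf) (rowsSuccess O)
    (rowsSuccess_le_one O) t B fun f hf => ?_
  have hk0 : (k : ℝ≥0∞) ≠ 0 := Nat.cast_ne_zero.2 (by omega)
  calc _ = (k : ℝ≥0∞) * ((k : ℝ≥0∞)⁻¹ * ∑ i : Fin k,
        expect (indep fun j => plantRow w η i (f j)) (rowsSuccess O)) := by
        rw [← mul_assoc, ENNReal.mul_inv_cancel hk0 (ENNReal.natCast_ne_top k), one_mul]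
    _ ≤ _ := by gcongr; exact hB f hf

end oracle

section search
variable {q n k m M : ℕ} [NeZero q]

/-- If the secret has the best score, then the search finds it as soon as a trial does. -/
theorem expect_iter_better {A : Matrix (Fin M) (Fin n) (ZMod q)} {b : Fin M → ZMod q}
    {s : Fin n → ZMod q} (hs : ∀ z, z ≠ s → score A b s < score A b z) (D : PMF (Fin n → ZMod q))
    (T : ℕ) :
    (expect (iter (fun _ r => D.map (better A b r)) T (M + 1, 0)) fun r =>
      if r.2 = s then 0 else 1) ≤ (1 - D s) ^ T := by
  classical
  -- The stored score is either strictly worse than that of s, or s itself is stored. The initial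
  -- score M + 1 is worse than any real one, and s is never displaced because its score is the
  -- strict minimum.
  have hinv := iter_support (step := fun _ r => D.map (better A b r)) (a := (M + 1, 0))
    (I := fun _ r => score A b s < r.1 ∨ r = (score A b s, s)) ?_ ?_
  · have key : ∀ T, (expect (iter (fun _ r => D.map (better A b r)) T (M + 1, 0)) fun r =>
        if r = (score A b s, s) then 0 else 1) ≤ (1 - D s) ^ T := by
      intro T
      induction T with
      | zero =>
        simp only [iter, expect_pure, pow_zero]
        split_ifs <;> simp
      | succ T ih =>
        have hD : (expect D fun z => if z = s then (0 : ℝ≥0∞) else 1) = 1 - D s := by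
          refine ENNReal.eq_sub_of_add_eq (D.apply_ne_top s) ?_
          rw [← expect_indicator, ← expect_add, ← expect_const D 1]
          exact expect_congr fun z _ => by split_ifs <;> simp
        rw [iter, expect_bind, pow_succ]
        refine le_trans ?_ (mul_le_mul_left ih _)
        rw [← expect_mul_const]
        refine expect_mono_support fun r hr => ?_
        rw [expect_map]
        rcases hinv T r hr with h | rfl
        · have hne : r ≠ (score A b s, s) := fun e => by rw [e] at h; exact lt_irrefl _ h
          rw [if_neg hne, one_mul, ← hD]
          refine expect_mono fun z => ?_
          by_cases hz : z = s
          · subst hz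
            simp [better, h]
          · rw [if_neg hz]
            split_ifs <;> simp
        · rw [if_pos rfl, zero_mul]
          have : ∀ z, better A b (score A b s, s) z = (score A b s, s) := by
            intro z
            rw [better, if_neg]
            by_cases hz : z = s
            · rw [hz]; exact lt_irrefl _
            · exact (hs z hz).not_gt
          simp [this]
    refine le_trans (expect_mono fun r => ?_) (key T)
    by_cases hr : r = (score A b s, s)
    · subst hr; simp
    · rw [if_neg hr]; split_ifs <;> simp
  · left
    have : score A b s ≤ (Finset.univ : Finset (Fin M)).card := Finset.card_filter_le _ _
    simp only [Finset.card_univ, Fintype.card_fin] at this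
    exact Nat.lt_succ_of_le this
  · rintro t r hr r' hr'
    obtain ⟨z, -, rfl⟩ := (PMF.mem_support_map_iff _ _ _).1 hr'
    rw [better]
    split_ifs with h
    · by_cases hz : z = s
      · right; rw [hz]
      · left; exact hs z hz
    · exact hr

/-- Add a sample to the accepted ones. -/
def accept {m : ℕ} {X : Type} (p : ℕ × (Fin m → X)) (y : X) : ℕ × (Fin m → X) :=
  (p.1 + 1, fun i => if i.val = p.1 then y else p.2 i)

/-- The accepted samples are independent samples of the target distribution, unless there are too few
of them. -/
theorem expect_iter_accept {X : Type} {m M : ℕ} {step : ℕ → ℕ × (Fin m → X) → PMF (ℕ × (Fin m → X))}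
    {ν : PMF X} {α β : ℝ≥0∞} (hαβ : α + β = 1) (hβ : β ≤ 1 / 2)
    (hstep : ∀ j < M, ∀ p F, expect (step j p) F = α * expect ν (fun y => F (accept p y)) + β * F p)
    (x₀ : Fin m → X) {G : (Fin m → X) → ℝ≥0∞} (hG : ∀ f, G f ≤ 1) :
    (expect (iter step M (0, x₀)) fun p => G p.2) ≤
      2 ^ m * (3 / 4) ^ M + expect (iid ν m) G := by
  -- H fills the places that are still empty with fresh samples from ν. Accepting a sample only
  -- fixes one of them, so the expectation of H never changes.
  set H : ℕ × (Fin m → X) → ℝ≥0∞ := fun p =>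
    expect (indep fun _ : Fin m => ν) fun y => G fun i => if i.val < p.1 then p.2 i else y i with hH
  have hHstep : ∀ j < M, ∀ p, expect (step j p) H = H p := by
    intro j hj p
    have : expect ν (fun y => H (accept p y)) = H p := by
      by_cases hp : p.1 < m
      · simp only [hH]
        rw [← expect_indep_resample _ ⟨p.1, hp⟩]
        refine expect_congr fun x _ => expect_congr fun y _ => ?_
        congr 1
        ext i
        have hi : i = ⟨p.1, hp⟩ ↔ i.val = p.1 := Fin.ext_iff
        by_cases h1 : i.val = p.1
        · have h2 : i = ⟨p.1, hp⟩ := hi.2 h1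
          subst h2
          simp [accept]
        · rw [Function.update_of_ne (fun h => h1 (hi.1 h))]
          simp only [accept, h1, if_false]
          by_cases h2 : i.val < p.1
          · rw [if_pos h2, if_pos (by omega)]
          · rw [if_neg h2, if_neg (by omega)]
      · rw [← expect_const ν (H p)]
        refine expect_congr fun x _ => ?_
        simp only [hH]
        refine expect_congr fun y _ => ?_
        congr 1
        ext i
        have := i.isLt
        show (if i.val < p.1 + 1 then (if i.val = p.1 then x else p.2 i) else y i) = _
        rw [if_pos (by omega), if_neg (by omega), if_pos (by omega)]
    rw [hstep j hj, this, ← add_mul, hαβ, one_mul]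
  have hHiter : ∀ j ≤ M, expect (iter step j (0, x₀)) H = H (0, x₀) := by
    intro j
    induction j with
    | zero => intro _; simp [iter]
    | succ j ih =>
      intro hj
      rw [iter, expect_bind, ← ih (by omega)]
      exact expect_congr fun p _ => hHstep j (by omega) p
  -- In one step (1/2)^(number accepted) shrinks on average by α/2 + β = 1/2 + β/2 ≤ 3/4.
  have hcount : ∀ j ≤ M, (expect (iter step j (0, x₀)) fun p => (1 / 2 : ℝ≥0∞) ^ p.1) ≤ (3 / 4) ^ j := by
    intro j
    induction j with
    | zero => intro _; simp [iter]
    | succ j ih =>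
      intro hj
      rw [iter, expect_bind, pow_succ]
      refine le_trans ?_ (mul_le_mul_left (ih (by omega)) _)
      rw [← expect_mul_const]
      refine expect_mono fun p => ?_
      rw [hstep j (by omega)]
      simp only [accept, expect_const]
      have h1 : α * (1 / 2 : ℝ≥0∞) ^ (p.1 + 1) + β * (1 / 2) ^ p.1 =
          (1 / 2 : ℝ≥0∞) ^ p.1 * ((α + β) * (1 / 2) + β * (1 / 2)) := by
        have : (β : ℝ≥0∞) = β * (1 / 2) + β * (1 / 2) := by
          rw [← mul_add, ENNReal.add_halves, mul_one]
        conv_lhs => rw [this]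
        ring
      rw [h1, hαβ, one_mul]
      gcongr
      calc (1 / 2 : ℝ≥0∞) + β * (1 / 2) ≤ 1 / 2 + 1 / 2 * (1 / 2) := by gcongr
        _ = 3 / 4 := by
          rw [← ENNReal.toReal_eq_toReal_iff' (by finiteness) (by finiteness)]
          rw [ENNReal.toReal_add (by finiteness) (by finiteness)]
          simp
          norm_num
  -- If fewer than m samples were accepted, the first term alone is at least 1; otherwise H agrees
  -- with G.
  have hpt : ∀ p : ℕ × (Fin m → X), G p.2 ≤ 2 ^ m * (1 / 2 : ℝ≥0∞) ^ p.1 + H p := by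
    intro p
    by_cases hp : m ≤ p.1
    · refine le_add_left ?_
      simp only [hH]
      have : ∀ y : Fin m → X, (fun i : Fin m => if i.val < p.1 then p.2 i else y i) = p.2 := by
        intro y
        ext i
        rw [if_pos (by have := i.isLt; omega)]
      simp [this]
    · refine le_add_right ((hG _).trans ?_)
      have h2 : (2 : ℝ≥0∞) ^ p.1 * (1 / 2) ^ p.1 = 1 := by
        rw [← mul_pow, one_div, ENNReal.mul_inv_cancel (by simp) (by simp), one_pow]
      refine h2.symm.le.trans ?_
      have h3 : (2 : ℝ≥0∞) ^ p.1 ≤ 2 ^ m := pow_le_pow_right₀ (by norm_num) (by omega)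
      exact mul_le_mul_left h3 _
  refine (expect_mono hpt).trans ?_
  rw [expect_add, expect_const_mul, hHiter M le_rfl]
  refine add_le_add (mul_le_mul_right (hcount M le_rfl) _) ?_
  simp [hH, iid_eq_indep]

end search
end
end SparseLPN

/-! ### Acceptance probabilities -/

namespace SparseLPN
noncomputable section
open scoped ENNReal

section acceptance
variable {n k σ : ℕ}

theorem ratioCoin_true {a b : ℕ} (hb : 0 < b) (hab : a ≤ b) :
    (ratioCoin a b true).toReal = a / b := by
  classical
  obtain ⟨c, rfl⟩ : ∃ c, b = c + 1 := ⟨b - 1, by omega⟩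
  have hsum : ∑ u : Fin (c + 1), (if u.val < a then (1 : ℝ≥0∞) else 0) = a := by
    rw [← Finset.sum_filter, Finset.sum_const, card_fin_lt hab]
    simp
  rw [← expect_indicator, ratioCoin, expect_map, expect_uniform]
  simp only [decide_eq_true_eq, Nat.add_sub_cancel, Fintype.card_fin]
  trans (((c + 1 : ℕ) : ℝ≥0∞)⁻¹ * a).toReal
  · congr 2
  rw [ENNReal.toReal_mul, ENNReal.toReal_inv, ENNReal.toReal_natCast, ENNReal.toReal_natCast]
  field_simp

/-- The probability that a row of weight `w` is accepted. -/
def acceptProb (n k σ w : ℕ) : ℝ := (acceptCoin n k σ w true).toReal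

theorem acceptProb_eq (w : ℕ) :
    acceptProb n k σ w = ∏ v ∈ Finset.range n, (factorCoin n k σ w v true).toReal := by
  classical
  have h : acceptCoin n k σ w true = ∏ v : Fin n, factorCoin n k σ w v true := by
    rw [← expect_indicator, acceptCoin, expect_map]
    simp only [← expect_indicator (factorCoin n k σ w _)]
    rw [← expect_indep_prod]
    refine expect_congr fun f _ => ?_
    rw [Finset.prod_ite_zero]
    simp
  rw [acceptProb, h, ENNReal.toReal_prod]
  exact Fin.prod_univ_eq_prod_range (fun v => (factorCoin n k σ w v true).toReal) n

/-- Up to common factors, the ratio of the probabilities of the weights `w + 1` and `w` in a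
block of a row of fixed weight is `ratioNum` to `ratioDen`. -/
def ratioNum (n k σ w : ℕ) : ℕ := (n - σ) * (k * σ - w)
/-- See `ratioNum`. -/
def ratioDen (n k σ w : ℕ) : ℕ := σ * (k * n - n + 1 + w - k * σ)

/-- Weight σ is the reference point: all its coins are constant. Going away from σ in either
direction adds one genuine coin per unit of weight. -/
theorem acceptProb_self : acceptProb n k σ σ = 1 := by
  rw [acceptProb_eq]
  refine Finset.prod_eq_one fun v _ => ?_
  have : factorCoin n k σ σ v = PMF.pure true := by
    rw [factorCoin]
    split_ifs <;> first | rfl | omega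
  simp [this]

theorem acceptProb_up {w : ℕ} (hσ : σ ≤ w) (hw : w < n) : acceptProb n k σ (w + 1) =
    acceptProb n k σ w * (ratioCoin (ratioNum n k σ w) (ratioDen n k σ w) true).toReal := by
  rw [acceptProb_eq, acceptProb_eq]
  have : ∀ v ∈ Finset.range n, (factorCoin n k σ (w + 1) v true).toReal =
      (factorCoin n k σ w v true).toReal * if v = w then
        (ratioCoin (ratioNum n k σ w) (ratioDen n k σ w) true).toReal else 1 := by
    intro v _
    by_cases hv : v = w
    · subst hv
      simp [factorCoin, hσ, ratioNum, ratioDen]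
    · have : factorCoin n k σ (w + 1) v = factorCoin n k σ w v := by
        rw [factorCoin, factorCoin]
        split_ifs <;> first | rfl | omega
      simp [hv, this]
  rw [Finset.prod_congr rfl this, Finset.prod_mul_distrib, Finset.prod_ite_eq',
    if_pos (Finset.mem_range.2 hw)]

theorem acceptProb_down {w : ℕ} (hσ : w < σ) (hw : w < n) : acceptProb n k σ w =
    acceptProb n k σ (w + 1) * (ratioCoin (ratioDen n k σ w) (ratioNum n k σ w) true).toReal := by
  rw [acceptProb_eq, acceptProb_eq]
  have : ∀ v ∈ Finset.range n, (factorCoin n k σ w v true).toReal =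
      (factorCoin n k σ (w + 1) v true).toReal * if v = w then
        (ratioCoin (ratioDen n k σ w) (ratioNum n k σ w) true).toReal else 1 := by
    intro v _
    by_cases hv : v = w
    · subst hv
      simp [factorCoin, hσ.not_ge, ratioNum, ratioDen]
    · have : factorCoin n k σ w v = factorCoin n k σ (w + 1) v := by
        rw [factorCoin, factorCoin]
        split_ifs <;> first | rfl | omega
      simp [hv, this]
  rw [Finset.prod_congr rfl this, Finset.prod_mul_distrib, Finset.prod_ite_eq',
    if_pos (Finset.mem_range.2 hw)]

theorem acceptProb_mem (w : ℕ) : 0 ≤ acceptProb n k σ w ∧ acceptProb n k σ w ≤ 1 := by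
  refine ⟨ENNReal.toReal_nonneg, ?_⟩
  have := ENNReal.toReal_mono ENNReal.one_ne_top (PMF.coe_le_one (acceptCoin n k σ w) true)
  simpa [acceptProb] using this

section ratio
variable (hσ : 0 < σ) (hσn : σ < n) (hk : 1 < k)
include hσ hσn hk

/-- Without truncation the denominator exceeds the numerator by exactly σ + n(w - σ), which is
positive for w ≥ σ. Thus the ratio is a legitimate probability, and it is close to 1 near σ. -/
theorem ratio_bounds_up {w : ℕ} (hw : σ ≤ w) : 0 < ratioDen n k σ w ∧
    ratioNum n k σ w ≤ ratioDen n k σ w ∧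
    (ratioDen n k σ w : ℝ) = σ * ((k - 1) * n + 1 + w - k * σ) ∧
    1 - (ratioNum n k σ w : ℝ) / ratioDen n k σ w ≤
      (σ + n * (w - σ)) / ((k - 1) * σ * (n - σ)) := by
  have hkn : n ≤ k * n := Nat.le_mul_of_pos_left n (by omega)
  have hle : k * σ ≤ k * n - n + 1 + w := by
    have : (k - 1) * σ ≤ (k - 1) * n := Nat.mul_le_mul_left _ hσn.le
    rw [Nat.sub_mul, Nat.sub_mul, one_mul, one_mul] at this
    omega
  have hσR : (0 : ℝ) < σ := by exact_mod_cast hσ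
  have hkR : (1 : ℝ) < k := by exact_mod_cast hk
  have hnR : (0 : ℝ) < n - σ := by rw [sub_pos]; exact_mod_cast hσn
  have hwR : (σ : ℝ) ≤ w := by exact_mod_cast hw
  have hden : (ratioDen n k σ w : ℝ) = σ * ((k - 1) * n + 1 + w - k * σ) := by
    rw [ratioDen, Nat.cast_mul, Nat.cast_sub hle]
    push_cast [Nat.cast_sub hkn]
    ring
  have hD : 0 < ((k : ℝ) - 1) * σ * (n - σ) := by
    have := sub_pos.2 hkR
    positivity
  have hdenD : ((k : ℝ) - 1) * σ * (n - σ) ≤ ratioDen n k σ w := by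
    rw [hden]
    nlinarith
  have hpos : (0 : ℝ) < ratioDen n k σ w := hD.trans_le hdenD
  have hnum : (n - σ : ℝ) * (k * σ - w) ≤ ratioNum n k σ w := by
    rw [ratioNum, Nat.cast_mul, Nat.cast_sub hσn.le]
    refine mul_le_mul_of_nonneg_left ?_ hnR.le
    rw [sub_le_iff_le_add]
    have : k * σ ≤ (k * σ - w) + w := by omega
    exact_mod_cast this
  have hdiff : (ratioDen n k σ w : ℝ) - ratioNum n k σ w ≤ σ + n * (w - σ) := by
    rw [hden]
    nlinarith
  refine ⟨by exact_mod_cast hpos, ?_, hden, ?_⟩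
  · by_cases hwk : w ≤ k * σ
    · have : (ratioNum n k σ w : ℝ) ≤ ratioDen n k σ w := by
        rw [hden, ratioNum, Nat.cast_mul, Nat.cast_sub hσn.le, Nat.cast_sub hwk]
        push_cast
        nlinarith
      exact_mod_cast this
    · rw [ratioNum, Nat.sub_eq_zero_of_le (show k * σ ≤ w by omega), mul_zero]
      exact Nat.zero_le _
  · rw [one_sub_div hpos.ne']
    refine div_le_div₀ ?_ hdiff hD hdenD
    have : 0 ≤ (n : ℝ) * (w - σ) := mul_nonneg (Nat.cast_nonneg n) (sub_nonneg.2 hwR)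
    linarith

/-- Below σ the inverse ratio is used. Now the numerator is larger by n(σ - w) - σ, which is
nonnegative because σ - w ≥ 1 and n > σ. -/
theorem ratio_bounds_down {w : ℕ} (hw : w < σ) : 0 < ratioNum n k σ w ∧
    ratioDen n k σ w ≤ ratioNum n k σ w ∧
    (ratioNum n k σ w : ℝ) = (n - σ) * (k * σ - w) ∧
    1 - (ratioDen n k σ w : ℝ) / ratioNum n k σ w ≤
      (n * (σ - w) - σ) / ((k - 1) * σ * (n - σ)) := by
  have hkn : n ≤ k * n := Nat.le_mul_of_pos_left n (by omega)
  have hkσ : σ ≤ k * σ := Nat.le_mul_of_pos_left σ (by omega)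
  have hσR : (0 : ℝ) < σ := by exact_mod_cast hσ
  have hkR : (1 : ℝ) < k := by exact_mod_cast hk
  have hnR : (0 : ℝ) < n - σ := by rw [sub_pos]; exact_mod_cast hσn
  have hwR : (w : ℝ) + 1 ≤ σ := by exact_mod_cast hw
  have hnum : (ratioNum n k σ w : ℝ) = (n - σ) * (k * σ - w) := by
    rw [ratioNum, Nat.cast_mul, Nat.cast_sub hσn.le, Nat.cast_sub (by omega)]
    push_cast
    ring
  have hD : 0 < ((k : ℝ) - 1) * σ * (n - σ) := by
    have := sub_pos.2 hkR
    positivity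
  have hnumD : ((k : ℝ) - 1) * σ * (n - σ) ≤ ratioNum n k σ w := by
    rw [hnum]
    nlinarith
  have hpos : (0 : ℝ) < ratioNum n k σ w := hD.trans_le hnumD
  have hsub : ((k * n - n + 1 + w : ℕ) : ℝ) = (k - 1) * n + 1 + w := by
    push_cast [Nat.cast_sub hkn]
    ring
  have hden : (σ : ℝ) * ((k - 1) * n + 1 + w - k * σ) ≤ ratioDen n k σ w := by
    rw [ratioDen, Nat.cast_mul]
    refine mul_le_mul_of_nonneg_left ?_ hσR.le
    rw [← hsub, sub_le_iff_le_add]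
    have : k * n - n + 1 + w ≤ (k * n - n + 1 + w - k * σ) + k * σ := by omega
    exact_mod_cast this
  have hnonneg : 0 ≤ (n : ℝ) * (σ - w) - σ := by nlinarith
  have hdiff : (ratioNum n k σ w : ℝ) - ratioDen n k σ w ≤ n * (σ - w) - σ := by
    rw [hnum]
    nlinarith
  refine ⟨by exact_mod_cast hpos, ?_, hnum, ?_⟩
  · by_cases hwk : k * σ ≤ k * n - n + 1 + w
    · have : (ratioDen n k σ w : ℝ) ≤ ratioNum n k σ w := by
        rw [hnum, ratioDen, Nat.cast_mul, Nat.cast_sub hwk, hsub]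
        push_cast
        nlinarith
      exact_mod_cast this
    · rw [ratioDen, Nat.sub_eq_zero_of_le (show k * n - n + 1 + w ≤ k * σ by omega), mul_zero]
      exact Nat.zero_le _
  · rw [one_sub_div hpos.ne']
    exact div_le_div₀ hnonneg hdiff hD hnumD

/-- A union bound over the coins. Their failure probabilities grow linearly in the distance from σ,
so their sum is quadratic in w - σ, up to a remainder that is bounded by 1/(k - 1). -/
theorem one_sub_acceptProb_le {w : ℕ} (hw : w ≤ n) : 1 - acceptProb n k σ w ≤
    n * (w - σ) ^ 2 / (2 * ((k - 1) * σ * (n - σ))) + 1 / (k - 1) := by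
  have hσR : (0 : ℝ) < σ := by exact_mod_cast hσ
  have hkR : (1 : ℝ) < k := by exact_mod_cast hk
  have hnR : (0 : ℝ) < n - σ := by rw [sub_pos]; exact_mod_cast hσn
  have hk1 := sub_pos.2 hkR
  set D : ℝ := (k - 1) * σ * (n - σ) with hDdef
  have hD : 0 < D := by positivity
  have step : ∀ r d : ℝ, 0 ≤ r → r ≤ 1 → 0 ≤ 1 - d → 1 - r * d ≤ (1 - r) + (1 - d) := by
    intro r d h0 h1 h2
    nlinarith
  have hup : ∀ j, σ + j ≤ n → 1 - acceptProb n k σ (σ + j) ≤ (j * σ + n * (j * (j - 1) / 2)) / D := by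
    intro j
    induction j with
    | zero => intro _; simp [acceptProb_self]
    | succ j ih =>
      intro hj
      obtain ⟨h1, h2, -, h4⟩ := ratio_bounds_up hσ hσn hk (w := σ + j) (by omega)
      rw [← add_assoc, acceptProb_up (by omega) (by omega), ratioCoin_true h1 h2]
      have hm := acceptProb_mem (n := n) (k := k) (σ := σ) (σ + j)
      have hd : (ratioNum n k σ (σ + j) : ℝ) / ratioDen n k σ (σ + j) ≤ 1 :=
        div_le_one_of_le₀ (by exact_mod_cast h2) (Nat.cast_nonneg _)
      refine (step _ _ hm.1 hm.2 (by linarith)).trans ((add_le_add (ih (by omega)) h4).trans_eq ?_)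
      rw [← hDdef, ← add_div]
      push_cast
      ring
  have hdown : ∀ j ≤ σ, 1 - acceptProb n k σ (σ - j) ≤ (n * (j * (j + 1) / 2) - j * σ) / D := by
    intro j
    induction j with
    | zero => intro _; simp [acceptProb_self]
    | succ j ih =>
      intro hj
      obtain ⟨h1, h2, -, h4⟩ := ratio_bounds_down hσ hσn hk (w := σ - (j + 1)) (by omega)
      have e : σ - (j + 1) + 1 = σ - j := by omega
      rw [acceptProb_down (by omega) (by omega), ratioCoin_true h1 h2, e]
      have hm := acceptProb_mem (n := n) (k := k) (σ := σ) (σ - j)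
      have hd : (ratioDen n k σ (σ - (j + 1)) : ℝ) / ratioNum n k σ (σ - (j + 1)) ≤ 1 :=
        div_le_one_of_le₀ (by exact_mod_cast h2) (Nat.cast_nonneg _)
      refine (step _ _ hm.1 hm.2 (by linarith)).trans ((add_le_add (ih (by omega)) h4).trans_eq ?_)
      rw [← hDdef, ← add_div, Nat.cast_sub hj]
      push_cast
      ring
  -- Over the common denominator the term 1/(k - 1) is σ(n - σ), which absorbs the linear terms of
  -- both bounds.
  have hgoal : n * ((w : ℝ) - σ) ^ 2 / (2 * D) + 1 / (k - 1) =
      (n * ((w : ℝ) - σ) ^ 2 / 2 + σ * (n - σ)) / D := by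
    rw [hDdef]
    field_simp
  rw [hgoal]
  rcases le_total σ w with h | h
  · obtain ⟨j, rfl⟩ := Nat.exists_eq_add_of_le h
    refine (hup j hw).trans (div_le_div_of_nonneg_right ?_ hD.le)
    have hjn : (σ : ℝ) + j ≤ n := by exact_mod_cast hw
    have hj0 : (0 : ℝ) ≤ j := Nat.cast_nonneg j
    have hn0 : (0 : ℝ) ≤ n := Nat.cast_nonneg n
    push_cast
    nlinarith [mul_nonneg hn0 hj0, mul_nonneg hσR.le (sub_nonneg.2 hjn)]
  · obtain ⟨j, hj⟩ := Nat.exists_eq_add_of_le h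
    have hw' : w = σ - j := by omega
    have hcast : (w : ℝ) = σ - j := by rw [hj]; push_cast; ring
    have hd := hdown j (by omega)
    rw [← hw'] at hd
    refine hd.trans (div_le_div_of_nonneg_right ?_ hD.le)
    have hj0 : (0 : ℝ) ≤ j := Nat.cast_nonneg j
    have hjσ : (j : ℝ) ≤ σ := by exact_mod_cast (show j ≤ σ by omega)
    rw [hcast]
    nlinarith [mul_nonneg hj0 (sub_nonneg.2 hjσ), mul_nonneg hj0 hnR.le,
      mul_nonneg (sub_nonneg.2 hjσ) hnR.le]

end ratio
end acceptance
end
end SparseLPN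

/-! ### Exactness and acceptance rate of the rejection sampling -/

namespace SparseLPN
noncomputable section
open scoped ENNReal

section law
variable {n k σ : ℕ}

/-- The number of supports of size `k σ - w` outside of a block. -/
def outerSupports (n k σ w : ℕ) : ℕ :=
  if w ≤ k * σ then (k * n - n).choose (k * σ - w) else 0

theorem outerSupports_step (w : ℕ) : outerSupports n k σ w * (k * σ - w) =
    outerSupports n k σ (w + 1) * (k * n - n + 1 + w - k * σ) := by
  rw [outerSupports, outerSupports]
  by_cases h : w + 1 ≤ k * σ
  · obtain ⟨r, hr⟩ := Nat.exists_eq_add_of_le h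
    have := Nat.choose_succ_right_eq (k * n - n) r
    rw [if_pos (by omega), if_pos h, show k * σ - w = r + 1 by omega,
      show k * σ - (w + 1) = r by omega, this]
    congr 1
    omega
  · rw [if_neg h, show k * σ - w = 0 by omega]
    simp

variable (hσ : 0 < σ) (hσn : σ < n) (hk : 1 < k)
include hσ hσn hk

/-- Both sides change by the same factor from w to w + 1 and agree at w = σ. The induction runs
upwards and downwards from there, since the acceptance probability is built outwards from σ. -/
theorem acceptProb_law {w : ℕ} (hw : w ≤ n) :
    acceptProb n k σ w * ((σ : ℝ) / (n - σ)) ^ w * outerSupports n k σ σ =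
      outerSupports n k σ w * ((σ : ℝ) / (n - σ)) ^ σ := by
  have hσR : (0 : ℝ) < σ := by exact_mod_cast hσ
  have hnR : (0 : ℝ) < n - σ := by rw [sub_pos]; exact_mod_cast hσn
  set t : ℝ := σ / (n - σ) with ht
  have ht' : t * (n - σ) = σ := div_mul_cancel₀ _ hnR.ne'
  have htpos : 0 < t := by positivity
  have hstep : ∀ w, (outerSupports n k σ w : ℝ) * ratioNum n k σ w * t =
      outerSupports n k σ (w + 1) * ratioDen n k σ w := by
    intro w
    have := congrArg (Nat.cast (R := ℝ)) (outerSupports_step (n := n) (k := k) (σ := σ) w)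
    push_cast at this
    rw [ratioNum, ratioDen]
    push_cast [Nat.cast_sub hσn.le]
    linear_combination (σ : ℝ) * this +
      (outerSupports n k σ w : ℝ) * ((k * σ - w : ℕ) : ℝ) * ht'
  rcases le_total σ w with h | h
  · induction w, h using Nat.le_induction with
    | base => rw [acceptProb_self]; ring
    | succ w h ih =>
      obtain ⟨h1, h2, -⟩ := ratio_bounds_up hσ hσn hk h
      have h1R : (ratioDen n k σ w : ℝ) ≠ 0 := Nat.cast_ne_zero.2 h1.ne'
      rw [acceptProb_up h (by omega), ratioCoin_true h1 h2, pow_succ]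
      have hs := hstep w
      have ih := ih (by omega)
      calc _ = (acceptProb n k σ w * t ^ w * outerSupports n k σ σ) *
            (ratioNum n k σ w * t / ratioDen n k σ w) := by ring
        _ = (outerSupports n k σ w * ratioNum n k σ w * t) / ratioDen n k σ w * t ^ σ := by
            rw [ih]; ring
        _ = _ := by rw [hs, mul_div_cancel_right₀ _ h1R]
  · induction h using Nat.decreasingInduction with
    | self => rw [acceptProb_self]; ring
    | of_succ w h ih =>
      obtain ⟨h1, h2, -⟩ := ratio_bounds_down hσ hσn hk h
      have h1R : (ratioNum n k σ w : ℝ) ≠ 0 := Nat.cast_ne_zero.2 h1.ne'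
      rw [acceptProb_down h (by omega), ratioCoin_true h1 h2]
      have hs := hstep w
      have ih := ih (by omega)
      rw [pow_succ] at ih
      calc _ = (acceptProb n k σ (w + 1) * (t ^ w * t) * outerSupports n k σ σ) *
            (ratioDen n k σ w / (ratioNum n k σ w * t)) := by field_simp
        _ = (outerSupports n k σ (w + 1) * ratioDen n k σ w) / (ratioNum n k σ w * t) * t ^ σ := by
            rw [ih]; ring
        _ = _ := by rw [← hs]; field_simp

end law

section rows
variable {q n k σ : ℕ} [NeZero q]

theorem approxRow_apply (hq : 2 ≤ q) (hσn : σ < n)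
    (hp : (q : ℝ) * σ / (((q : ℝ) - 1) * n) ≤ 1) (a : Fin n → ZMod q) :
    (approxRow q n σ a).toReal =
      (1 - (σ : ℝ) / n) ^ n * ((σ : ℝ) / (n - σ) / (q - 1)) ^ hammingNorm a := by
  have hqR : (1 : ℝ) < q := by exact_mod_cast hq
  have hnR : (0 : ℝ) < n - σ := by rw [sub_pos]; exact_mod_cast hσn
  have hn0 : (0 : ℝ) < n := lt_of_le_of_lt (Nat.cast_nonneg σ) (sub_pos.1 hnR)
  have hq1 : (0 : ℝ) < q - 1 := sub_pos.2 hqR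
  rw [approxRow, iid_eq_indep, indep_apply, ENNReal.toReal_prod]
  have : ∀ v : ZMod q, (berq q ((q : ℝ) * σ / (((q : ℝ) - 1) * n)) v).toReal =
      (1 - (σ : ℝ) / n) * if v ≠ 0 then (σ : ℝ) / (n - σ) / (q - 1) else 1 := by
    intro v
    rw [berq_apply (by positivity) hp]
    split_ifs <;> first | contradiction | (field_simp; try ring)
  simp only [this]
  rw [Finset.prod_mul_distrib, Finset.prod_const, Finset.card_univ, Fintype.card_fin,
    ← Finset.prod_filter, Finset.prod_const]
  rfl

theorem acceptCoin_false (w : ℕ) : (acceptCoin n k σ w false).toReal = 1 - acceptProb n k σ w := by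
  have := sum_toReal (acceptCoin n k σ w)
  rw [Fintype.sum_bool] at this
  rw [acceptProb]
  linarith

theorem sum_variance (hq : 2 ≤ q) (hσn : σ < n)
    (hp : (q : ℝ) * σ / (((q : ℝ) - 1) * n) ≤ 1) :
    ∑ a : Fin n → ZMod q, (approxRow q n σ a).toReal * ((hammingNorm a : ℝ) - σ) ^ 2 =
      σ * (n - σ) / n := by
  have hqR : (1 : ℝ) < q := by exact_mod_cast hq
  have hnR : (0 : ℝ) < n - σ := by rw [sub_pos]; exact_mod_cast hσn
  have hn0 : (0 : ℝ) < n := lt_of_le_of_lt (Nat.cast_nonneg σ) (sub_pos.1 hnR)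
  have hq1 : (0 : ℝ) < q - 1 := sub_pos.2 hqR
  simp only [approxRow_apply hq hσn hp]
  have h := sum_by_weight (q := q) (n := n) fun w => (1 - (σ : ℝ) / n) ^ n *
    ((σ : ℝ) / (n - σ) / (q - 1)) ^ w * ((w : ℝ) - σ) ^ 2
  rw [h]
  -- The weight is binomial with success probability σ/n, and its variance is the identity for
  -- Bernstein polynomials at that point.
  have hv := congrArg (Polynomial.eval ((σ : ℝ) / n)) (bernsteinPolynomial.variance ℝ n)
  rw [Polynomial.eval_finsetSum] at hv
  simp only [bernsteinPolynomial, Polynomial.eval_mul, Polynomial.eval_pow, Polynomial.eval_sub,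
    Polynomial.eval_X, Polynomial.eval_natCast, Polynomial.eval_one,
    nsmul_eq_mul, mul_div_cancel₀ (σ : ℝ) hn0.ne'] at hv
  trans (σ : ℝ) * (1 - σ / n)
  · rw [← hv]
    refine Finset.sum_congr rfl fun w hw => ?_
    have hw : w ≤ n := Nat.lt_succ_iff.1 (Finset.mem_range.1 hw)
    have e1 : (1 - (σ : ℝ) / n) ^ n = (1 - (σ : ℝ) / n) ^ (n - w) * (1 - (σ : ℝ) / n) ^ w := by
      rw [← pow_add, Nat.sub_add_cancel hw]
    have e2 : ((σ : ℝ) / n) ^ w = ((q : ℝ) - 1) ^ w * ((1 - (σ : ℝ) / n) ^ w *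
        ((σ : ℝ) / (n - σ) / (q - 1)) ^ w) := by
      rw [← mul_pow, ← mul_pow]
      congr 1
      field_simp
    push_cast [Nat.cast_sub (show 1 ≤ q by omega)]
    rw [e1, e2]
    ring
  · field_simp

theorem reject_le (hq : 2 ≤ q) (hσ : 0 < σ) (hσn : σ < n) (hk : 4 ≤ k)
    (hp : (q : ℝ) * σ / (((q : ℝ) - 1) * n) ≤ 1) :
    (expect (approxRow q n σ) fun a => acceptCoin n k σ (hammingNorm a) false) ≤ 1 / 2 := by
  have hσR : (0 : ℝ) < σ := by exact_mod_cast hσ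
  have hkR : (4 : ℝ) ≤ k := by exact_mod_cast hk
  have hnR : (0 : ℝ) < n - σ := by rw [sub_pos]; exact_mod_cast hσn
  have hn0 : (0 : ℝ) < n := hσR.trans (sub_pos.1 hnR)
  have hk1 : (0 : ℝ) < k - 1 := by linarith
  have hfin : (expect (approxRow q n σ) fun a => acceptCoin n k σ (hammingNorm a) false) ≠ ∞ :=
    ne_top_of_le_ne_top ENNReal.one_ne_top (expect_le_one fun a => PMF.coe_le_one _ _)
  rw [← ENNReal.ofReal_toReal hfin, toReal_expect _ fun a => PMF.apply_ne_top _ _]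
  refine (ENNReal.ofReal_le_ofReal (q := 1 / 2) ?_).trans_eq (by
    rw [ENNReal.ofReal_div_of_pos two_pos]; simp)
  simp only [acceptCoin_false]
  calc ∑ a : Fin n → ZMod q, (approxRow q n σ a).toReal * (1 - acceptProb n k σ (hammingNorm a))
      ≤ ∑ a : Fin n → ZMod q, (approxRow q n σ a).toReal *
          (n * ((hammingNorm a : ℝ) - σ) ^ 2 / (2 * ((k - 1) * σ * (n - σ))) + 1 / (k - 1)) := by
        refine Finset.sum_le_sum fun a _ => ?_
        refine mul_le_mul_of_nonneg_left ?_ ENNReal.toReal_nonneg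
        refine one_sub_acceptProb_le hσ hσn (by omega) ?_
        exact hammingNorm_le_card_fintype.trans_eq (Fintype.card_fin n)
    _ = n / (2 * ((k - 1) * σ * (n - σ))) *
          ∑ a : Fin n → ZMod q, (approxRow q n σ a).toReal * ((hammingNorm a : ℝ) - σ) ^ 2 +
        1 / (k - 1) * ∑ a : Fin n → ZMod q, (approxRow q n σ a).toReal := by
        rw [Finset.mul_sum, Finset.mul_sum, ← Finset.sum_add_distrib]
        exact Finset.sum_congr rfl fun a _ => by ring
    -- The variance term contributes 1/(2(k - 1)) and the constant 1/(k - 1); the sum is at most 1/2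
    -- exactly from k = 4 on.
    _ = 3 / (2 * (k - 1)) := by
        rw [sum_variance hq hσn hp, sum_toReal]
        field_simp
        norm_num
    _ ≤ 1 / 2 := by
        rw [div_le_div_iff₀ (by positivity) (by positivity)]
        linarith

/-- An accepted row has exactly the law of a block: at weight w, the acceptance probability times
the odds (σ/(n - σ))^w is proportional to the number of supports outside the block, and the powers
of q - 1 combine to a constant. -/
theorem approxRow_mul_accept (hq : 2 ≤ q) (hσ : 0 < σ) (hσn : σ < n) (hk : 1 < k)
    (hp : (q : ℝ) * σ / (((q : ℝ) - 1) * n) ≤ 1) (hn : n ≤ k * n) (hw : k * σ ≤ k * n)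
    (a : Fin n → ZMod q) : approxRow q n σ a * acceptCoin n k σ (hammingNorm a) true =
      (expect (approxRow q n σ) fun a => acceptCoin n k σ (hammingNorm a) true) *
        blockRow hq hn hw a := by
  have hσR : (0 : ℝ) < σ := by exact_mod_cast hσ
  have hqR : (1 : ℝ) < q := by exact_mod_cast hq
  have hnR : (0 : ℝ) < n - σ := by rw [sub_pos]; exact_mod_cast hσn
  have hq1 : (0 : ℝ) < q - 1 := sub_pos.2 hqR
  have hkσ : σ ≤ k * σ := Nat.le_mul_of_pos_left σ (by omega)
  have hc : (outerSupports n k σ σ : ℝ) ≠ 0 := by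
    rw [outerSupports, if_pos hkσ, Nat.cast_ne_zero]
    refine (Nat.choose_pos ?_).ne'
    have : (k - 1) * σ ≤ (k - 1) * n := Nat.mul_le_mul_left _ hσn.le
    rwa [Nat.sub_mul, Nat.sub_mul, one_mul, one_mul] at this
  have hW : (weightCount q (k * n) (k * σ) : ℝ) ≠ 0 := Nat.cast_ne_zero.2
    (Nat.mul_pos (Nat.choose_pos hw) (Nat.pow_pos (by omega))).ne'
  set c : ℝ := (1 - (σ : ℝ) / n) ^ n * ((σ : ℝ) / (n - σ)) ^ σ * weightCount q (k * n) (k * σ) /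
    (outerSupports n k σ σ * (q - 1) ^ (k * σ)) with hcdef
  have key : ∀ a, (approxRow q n σ a * acceptCoin n k σ (hammingNorm a) true).toReal =
      c * (blockRow hq hn hw a).toReal := by
    intro a
    have hlaw := acceptProb_law hσ hσn hk (w := hammingNorm a)
      (hammingNorm_le_card_fintype.trans_eq (Fintype.card_fin n))
    have hcomp : (completions q (k * n) n (k * σ) (hammingNorm a) : ℝ) * (q - 1) ^ hammingNorm a =
        outerSupports n k σ (hammingNorm a) * (q - 1) ^ (k * σ) := by
      rw [completions, outerSupports]
      split_ifs with h
      · rw [weightCount]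
        push_cast [Nat.cast_sub (show 1 ≤ q by omega)]
        rw [mul_assoc, ← pow_add, Nat.sub_add_cancel h]
      · simp
    rw [ENNReal.toReal_mul, approxRow_apply hq hσn hp, blockRow, PMF.ofFintype_apply,
      ENNReal.toReal_mul, ENNReal.toReal_inv, ENNReal.toReal_natCast, ENNReal.toReal_natCast,
      hcdef, ← acceptProb, div_pow _ ((q : ℝ) - 1)]
    have hacc : acceptProb n k σ (hammingNorm a) * ((σ : ℝ) / (n - σ)) ^ hammingNorm a =
        outerSupports n k σ (hammingNorm a) * ((σ : ℝ) / (n - σ)) ^ σ / outerSupports n k σ σ := by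
      rw [← hlaw, mul_div_cancel_right₀ _ hc]
    have hcomp' : (completions q (k * n) n (k * σ) (hammingNorm a) : ℝ) =
        outerSupports n k σ (hammingNorm a) * (q - 1) ^ (k * σ) / (q - 1) ^ hammingNorm a := by
      rw [← hcomp, mul_div_cancel_right₀ _ (pow_pos hq1 _).ne']
    rw [hcomp']
    calc _ = (1 - (σ : ℝ) / n) ^ n / (q - 1) ^ hammingNorm a *
          (acceptProb n k σ (hammingNorm a) * ((σ : ℝ) / (n - σ)) ^ hammingNorm a) := by ring
      _ = _ := by
        rw [hacc]
        have := (pow_pos hq1 (k * σ)).ne'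
        generalize (1 - (σ : ℝ) / n) ^ n = x
        generalize ((σ : ℝ) / (n - σ)) ^ σ = y
        field_simp
  -- Summing over all rows shows that the constant of proportionality is the total acceptance
  -- probability.
  have htot : (expect (approxRow q n σ) fun a => acceptCoin n k σ (hammingNorm a) true).toReal
      = c := by
    rw [toReal_expect _ fun a => PMF.apply_ne_top _ _]
    simp only [← ENNReal.toReal_mul, key]
    rw [← Finset.mul_sum, sum_toReal, mul_one]
  refine (ENNReal.toReal_eq_toReal_iff' (ENNReal.mul_ne_top (PMF.apply_ne_top _ _)
    (PMF.apply_ne_top _ _)) (ENNReal.mul_ne_top ?_ (PMF.apply_ne_top _ _))).1 ?_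
  · exact ne_top_of_le_ne_top ENNReal.one_ne_top (expect_le_one fun a => PMF.coe_le_one _ _)
  · rw [key, ENNReal.toReal_mul, htot]

end rows
end
end SparseLPN

/-! ### Filtered samples, and why the secret has the best score -/

namespace SparseLPN
noncomputable section
open scoped ENNReal

section filtering
variable {q n k m σ : ℕ} [NeZero q]

/-- A row together with its noise. -/
def rawSample (q n σ : ℕ) [NeZero q] (η : ℝ) : PMF (Sample q n) :=
  (approxRow q n σ).bind fun a => (berq q η).map fun e => (a, e)

theorem expect_rawSample (η : ℝ) (f : Sample q n → ℝ≥0∞) : expect (rawSample q n σ η) f =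
    expect (approxRow q n σ) fun a => expect (berq q η) fun e => f (a, e) := by
  simp only [rawSample, expect_bind, expect_map]

theorem expect_filterStep (y : Sample q n) (p : ℕ × (Fin m → Sample q n))
    (F : ℕ × (Fin m → Sample q n) → ℝ≥0∞) :
    expect (filterStep k σ y p) F = acceptCoin n k σ (hammingNorm y.1) true * F (accept p y) +
      acceptCoin n k σ (hammingNorm y.1) false * F p := by
  rw [filterStep, expect_map, expect_fintype, Fintype.sum_bool]
  simp [accept]

/-- After filtering, the samples are blocks of rows of fixed weight, unless there are too few. -/
theorem expect_filter (hq : 2 ≤ q) (hσ : 0 < σ) (hσn : σ < n) (hk : 4 ≤ k)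
    (hp : (q : ℝ) * σ / (((q : ℝ) - 1) * n) ≤ 1) (hn : n ≤ k * n) (hw : k * σ ≤ k * n)
    (η : ℝ) (s : Fin n → ZMod q) (M : ℕ) (x₀ : Fin m → Sample q n)
    {G : (Fin m → Sample q n) → ℝ≥0∞} (hG : ∀ f, G f ≤ 1) :
    (expect (iid (rawSample q n σ η) M) fun R =>
      expect (drive (filterStep k σ) (fun j => labelled s (R j)) M (0, x₀)) fun p => G p.2) ≤
      2 ^ m * (3 / 4) ^ M +
        expect (iid (blockSample hq hn hw η) m) fun f => G fun j => labelled s (f j) := by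
  set α := expect (approxRow q n σ) fun a => acceptCoin n k σ (hammingNorm a) true with hα
  set β := expect (approxRow q n σ) fun a => acceptCoin n k σ (hammingNorm a) false with hβ
  have hαβ : α + β = 1 := by
    rw [hα, hβ, ← expect_add]
    trans expect (approxRow q n σ) fun _ => 1
    · refine expect_congr fun a _ => ?_
      have := (acceptCoin n k σ (hammingNorm a)).tsum_coe
      rwa [tsum_fintype, Fintype.sum_bool] at this
    · exact expect_const _ _
  -- The samples may be drawn as they are read. Acceptance depends on the row only, so a step
  -- accepts a sample of the target law with probability α and otherwise keeps the list.
  have hdrive := expect_indep_drive (fun _ : Fin M => rawSample q n σ η)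
    (fun y p => filterStep k σ (labelled s y) p) (0, x₀) fun p => G p.2
  rw [iid_eq_indep]
  refine Eq.trans_le hdrive ?_
  refine (expect_iter_accept (ν := (blockSample hq hn hw η).map (labelled s)) hαβ
    (reject_le hq hσ hσn hk hp) ?_ x₀ hG).trans_eq ?_
  · intro j hj p F
    rw [dif_pos hj, expect_bind, expect_rawSample, expect_map, blockSample]
    simp only [expect_filterStep, expect_bind, expect_map]
    have h1 : ∀ a : Fin n → ZMod q, (labelled s (a, 0)).1 = a := fun _ => rfl
    trans ∑ a, (approxRow q n σ a * acceptCoin n k σ (hammingNorm a) true *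
        (expect (berq q η) fun e => F (accept p (labelled s (a, e)))) +
      approxRow q n σ a * acceptCoin n k σ (hammingNorm a) false * F p)
    · rw [expect_fintype]
      refine Finset.sum_congr rfl fun a _ => ?_
      simp only [labelled, expect_add, expect_const_mul, expect_const]
      ring
    · rw [Finset.sum_add_distrib, hβ, expect_fintype (approxRow q n σ), Finset.sum_mul]
      congr 1
      rw [expect_fintype, Finset.mul_sum]
      refine Finset.sum_congr rfl fun a _ => ?_
      rw [approxRow_mul_accept hq hσ hσn (by omega) hp hn hw, hα]
      ring
  · rw [iid_eq_indep, expect_indep_map, iid_eq_indep]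

end filtering

section scoring
variable {q n σ : ℕ} [Fact q.Prime]

theorem berq_le {p : ℝ} (h0 : 0 ≤ p) (h1 : p ≤ 1) (v : ZMod q) :
    (berq q p v).toReal ≤ p / q + (1 - p) := by
  rw [berq_apply h0 h1]
  split_ifs <;> linarith

/-- With all entries fixed but one where d does not vanish, orthogonality prescribes that entry. Its
likeliest value is 0, of probability 1 - σ/n. -/
theorem prob_orthogonal_le (hn : 0 < n) (hp : (q : ℝ) * σ / (((q : ℝ) - 1) * n) ≤ 1)
    {d : Fin n → ZMod q} (hd : d ≠ 0) :
    (expect (approxRow q n σ) fun a => if ∑ t, a t * d t = 0 then 1 else 0) ≤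
      ENNReal.ofReal (1 - σ / n) := by
  classical
  obtain ⟨t₀, ht⟩ := Function.ne_iff.1 hd
  have hqR : (1 : ℝ) < q := by exact_mod_cast (Fact.out : q.Prime).one_lt
  have hnR : (0 : ℝ) < n := by exact_mod_cast hn
  have hq1 : (0 : ℝ) < q - 1 := sub_pos.2 hqR
  rw [approxRow, iid_eq_indep, ← expect_indep_resample _ t₀, expect_comm]
  refine (expect_mono fun y => ?_).trans_eq (expect_const _ _)
  set r := ∑ t ∈ Finset.univ.erase t₀, y t * d t with hr
  have hsum : ∀ x, ∑ t, Function.update y t₀ x t * d t = x * d t₀ + r := by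
    intro x
    rw [← Finset.add_sum_erase _ _ (Finset.mem_univ t₀), Function.update_self, hr]
    congr 1
    refine Finset.sum_congr rfl fun t h => ?_
    rw [Function.update_of_ne (Finset.ne_of_mem_erase h)]
  have hiff : ∀ x, x * d t₀ + r = 0 ↔ x = -r / d t₀ := by
    intro x
    rw [eq_div_iff ht, eq_neg_iff_add_eq_zero]
  simp only [hsum, hiff]
  rw [expect_indicator, ← ENNReal.ofReal_toReal (PMF.apply_ne_top _ _)]
  refine ENNReal.ofReal_le_ofReal ((berq_le (by positivity) hp _).trans_eq ?_)
  field_simp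
  ring

/-- The factor by which a sample changes `3 ^ (score of the secret - score of a candidate)`; `c` is
the difference of the labels. -/
def tilt (c e : ZMod q) : ℝ := (if e ≠ 0 then 3 else 1) * if c ≠ e then 1 / 3 else 1

theorem tilt_nonneg (c e : ZMod q) : 0 ≤ tilt c e := by
  rw [tilt]
  split_ifs <;> norm_num

theorem tilt_eq {c : ZMod q} (hc : c ≠ 0) (e : ZMod q) :
    tilt c e = 1 + (if e = c then 2 else 0) - if e = 0 then 2 / 3 else 0 := by
  rw [tilt]
  split_ifs <;> first | (subst_vars; contradiction) | norm_num
  all_goals simp_all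

/-- If the candidate and the secret give the same label, the factor is always 1. Otherwise its mean
is 1/3 + 2η/3 + 4η/(3q), which is at most 1/2 for q ≥ 2 and η < 1/8; the bound on the noise rate
comes from here. -/
theorem expect_tilt_le {η : ℝ} (h0 : 0 < η) (h1 : η < 1 / 8) (c : ZMod q) :
    (expect (berq q η) fun e => ENNReal.ofReal (tilt c e)) ≤
      ENNReal.ofReal (1 / 2) + ENNReal.ofReal (1 / 2) * if c = 0 then 1 else 0 := by
  by_cases hc : c = 0
  · subst hc
    rw [if_pos rfl, mul_one, ← ENNReal.ofReal_add (by norm_num) (by norm_num)]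
    refine (expect_mono (g := fun _ => ENNReal.ofReal (1 / 2 + 1 / 2)) fun e => ?_).trans_eq
      (expect_const _ _)
    refine ENNReal.ofReal_le_ofReal ?_
    rw [tilt]
    by_cases he : e = 0
    · simp [he]; norm_num
    · simp [he, Ne.symm he]; norm_num
  · have hqR : (2 : ℝ) ≤ q := by exact_mod_cast (Fact.out : q.Prime).two_le
    have hfin : (expect (berq q η) fun e => ENNReal.ofReal (tilt c e)) ≠ ∞ := by
      rw [expect_fintype]
      exact (ENNReal.sum_lt_top.2 fun e _ => ENNReal.mul_lt_top
        (PMF.apply_ne_top _ _).lt_top ENNReal.ofReal_lt_top).ne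
    rw [if_neg hc, mul_zero, add_zero, ← ENNReal.ofReal_toReal hfin]
    refine ENNReal.ofReal_le_ofReal ?_
    rw [toReal_expect_berq h0.le (by linarith) fun _ => ENNReal.ofReal_ne_top]
    simp only [ENNReal.toReal_ofReal (tilt_nonneg c _)]
    simp only [tilt_eq hc, if_neg (Ne.symm hc)]
    rw [Finset.sum_sub_distrib, Finset.sum_add_distrib]
    simp only [Finset.sum_const, Finset.card_univ, ZMod.card, Finset.sum_ite_eq', Finset.mem_univ,
      if_true, nsmul_eq_mul, mul_one]
    have : (q : ℝ)⁻¹ * (q + 2 - 2 / 3) = 1 + 4 / 3 * (q : ℝ)⁻¹ := by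
      field_simp
      ring
    rw [this]
    have hinv : (q : ℝ)⁻¹ ≤ 1 / 2 := by
      rw [inv_le_comm₀ (by linarith) (by norm_num)]
      simpa using hqR
    nlinarith

/-- The labels agree with probability at most 1 - σ/n, and 1/2 + (1 - σ/n)/2 = 1 - σ/(2n). -/
theorem expect_rawSample_tilt_le (hn : 0 < n) (hσn : σ < n)
    (hp : (q : ℝ) * σ / (((q : ℝ) - 1) * n) ≤ 1)
    {η : ℝ} (h0 : 0 < η) (h1 : η < 1 / 8) {d : Fin n → ZMod q} (hd : d ≠ 0) :
    (expect (rawSample q n σ η) fun y => ENNReal.ofReal (tilt (∑ t, y.1 t * d t) y.2)) ≤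
      ENNReal.ofReal (1 - σ / (2 * n)) := by
  have hnR : (0 : ℝ) < n := by exact_mod_cast hn
  have h1σ : 0 ≤ 1 - (σ : ℝ) / n := by
    rw [sub_nonneg, div_le_one hnR]
    exact_mod_cast hσn.le
  rw [expect_rawSample]
  calc _ ≤ expect (approxRow q n σ) fun a => ENNReal.ofReal (1 / 2) +
        ENNReal.ofReal (1 / 2) * if ∑ t, a t * d t = 0 then 1 else 0 :=
        expect_mono fun a => expect_tilt_le h0 h1 (∑ t, a t * d t)
    _ = ENNReal.ofReal (1 / 2) + ENNReal.ofReal (1 / 2) *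
        expect (approxRow q n σ) fun a => if ∑ t, a t * d t = 0 then 1 else 0 := by
        rw [expect_add, expect_const, expect_const_mul]
    _ ≤ ENNReal.ofReal (1 / 2) + ENNReal.ofReal (1 / 2) * ENNReal.ofReal (1 - σ / n) := by
        gcongr
        exact prob_orthogonal_le hn hp hd
    _ = _ := by
        rw [← ENNReal.ofReal_mul (by norm_num),
          ← ENNReal.ofReal_add (by norm_num) (mul_nonneg (by norm_num) h1σ)]
        congr 1
        field_simp
        ring

/-- The secret has the best score. -/
theorem expect_score_le (hn : 0 < n) (hσn : σ < n)
    (hp : (q : ℝ) * σ / (((q : ℝ) - 1) * n) ≤ 1)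
    {η : ℝ} (h0 : 0 < η) (h1 : η < 1 / 8) (s : Fin n → ZMod q) (M : ℕ)
    (P : (Fin M → Sample q n) → Prop) [DecidablePred P]
    (hP : ∀ R, P R ↔ ∀ z ≠ s,
      score (Matrix.of fun j => (R j).1) (fun j => (labelled s (R j)).2) s <
      score (Matrix.of fun j => (R j).1) (fun j => (labelled s (R j)).2) z) :
    (expect (iid (rawSample q n σ η) M) fun R => if P R then 0 else 1) ≤
      ENNReal.ofReal ((q : ℝ) ^ n * (1 - σ / (2 * n)) ^ M) := by
  classical
  have hnR : (0 : ℝ) < n := by exact_mod_cast hn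
  have h1σ : 0 ≤ 1 - (σ : ℝ) / (2 * n) := by
    have : (σ : ℝ) ≤ n := by exact_mod_cast hσn.le
    rw [sub_nonneg, div_le_one (by positivity)]
    linarith
  -- A wrong candidate that scores at least as well as s makes 3^(score of s - score of z) at least
  -- 1. This is Markov's inequality together with a union bound over all z.
  have hpt : ∀ R : Fin M → Sample q n, (if P R then (0 : ℝ≥0∞) else 1) ≤
      ∑ z, if z = s then 0 else
        ∏ j, ENNReal.ofReal (tilt (∑ t, (R j).1 t * (z - s) t) (R j).2) := by
    intro R
    split_ifs with hR
    · exact zero_le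
    rw [hP] at hR
    push Not at hR
    obtain ⟨z, hz, hle⟩ := hR
    refine le_trans ?_ (Finset.single_le_sum (fun _ _ => zero_le) (Finset.mem_univ z))
    rw [if_neg hz, ← ENNReal.ofReal_prod_of_nonneg fun _ _ => tilt_nonneg _ _, ENNReal.one_le_ofReal]
    simp only [tilt]
    rw [Finset.prod_mul_distrib, ← Finset.prod_filter, ← Finset.prod_filter, Finset.prod_const,
      Finset.prod_const]
    have e1 : score (Matrix.of fun j => (R j).1) (fun j => (labelled s (R j)).2) s =
        (Finset.univ.filter fun j => (R j).2 ≠ 0).card := by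
      simp [score, labelled]
    have e2 : score (Matrix.of fun j => (R j).1) (fun j => (labelled s (R j)).2) z =
        (Finset.univ.filter fun j => ∑ t, (R j).1 t * (z - s) t ≠ (R j).2).card := by
      rw [score]
      congr 1
      ext j
      rw [Finset.mem_filter, Finset.mem_filter]
      simp [labelled, mul_sub, sub_eq_iff_eq_add']
    rw [← e1, ← e2, one_div, inv_pow, ← div_eq_mul_inv, one_le_div (by positivity)]
    exact pow_le_pow_right₀ (by norm_num) hle
  refine (expect_mono hpt).trans ?_
  rw [expect_sum]
  have hz : ∀ z : Fin n → ZMod q, (expect (iid (rawSample q n σ η) M) fun R => if z = s then 0 else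
        ∏ j, ENNReal.ofReal (tilt (∑ t, (R j).1 t * (z - s) t) (R j).2)) ≤
      ENNReal.ofReal (1 - σ / (2 * n)) ^ M := by
    intro z
    by_cases h : z = s
    · simp [h]
    · simp only [if_neg h]
      rw [iid_eq_indep, expect_indep_prod (fun _ : Fin M => rawSample q n σ η) fun _ y =>
        ENNReal.ofReal (tilt (∑ t, y.1 t * (z - s) t) y.2), Finset.prod_const, Finset.card_univ,
        Fintype.card_fin]
      exact pow_le_pow_left' (expect_rawSample_tilt_le hn hσn hp h0 h1 (sub_ne_zero.2 h)) _
  refine (Finset.sum_le_sum fun z _ => hz z).trans_eq ?_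
  rw [Finset.sum_const, Finset.card_univ, Fintype.card_fun, ZMod.card, Fintype.card_fin,
    nsmul_eq_mul, ENNReal.ofReal_mul (by positivity), ENNReal.ofReal_pow h1σ,
    ENNReal.ofReal_pow (Nat.cast_nonneg q), ENNReal.ofReal_natCast]
  push_cast
  rfl

end scoring
end
end SparseLPN

/-! ### Numerical estimates and the failure budget -/

namespace SparseLPN
noncomputable section
open scoped ENNReal

section analysis

/-- The bound on the probability that the secret does not have the best score. -/
theorem score_bound {q n σ M : ℕ} {m : ℝ} (hq : 2 ≤ q) (hσ : 0 < σ) (hσn : σ < n)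
    (hm : 48 * (n : ℝ) ^ 3 * Real.log q / (σ : ℝ) ^ 2 ≤ m) (hM : 3 * m ≤ M) :
    (q : ℝ) ^ n * (1 - σ / (2 * n)) ^ M ≤ ((2 : ℝ) ^ (2 * n - 1))⁻¹ := by
  have hσR : (0 : ℝ) < σ := by exact_mod_cast hσ
  have hσnR : (σ : ℝ) ≤ n := by exact_mod_cast hσn.le
  have hnR : (0 : ℝ) < n := hσR.trans_le hσnR
  have hqR : (2 : ℝ) ≤ q := by exact_mod_cast hq
  have hlog2 : 0 < Real.log 2 := Real.log_pos (by norm_num)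
  have hlog : Real.log 2 ≤ Real.log q := Real.log_le_log (by norm_num) hqR
  have h1 : 0 ≤ 1 - (σ : ℝ) / (2 * n) := by
    rw [sub_nonneg, div_le_one (by positivity)]
    linarith
  have h2 : 1 - (σ : ℝ) / (2 * n) ≤ Real.exp (-(σ / (2 * n))) := by
    linarith [Real.add_one_le_exp (-((σ : ℝ) / (2 * n)))]
  -- Since σ ≤ n, replacing nσ by σ² in the denominator only helps. The rate 72 n log q beats both
  -- the n log q of the union bound and the target 2n log 2.
  have hrate : 72 * (n * Real.log q) ≤ M * (σ / (2 * n)) := by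
    calc 72 * (n * Real.log q) = 3 * (48 * (n : ℝ) ^ 3 * Real.log q / (n * σ)) * (σ / (2 * n)) := by
          field_simp
          ring
      _ ≤ 3 * (48 * (n : ℝ) ^ 3 * Real.log q / (σ : ℝ) ^ 2) * (σ / (2 * n)) := by
          have : (0 : ℝ) ≤ 48 * (n : ℝ) ^ 3 * Real.log q := by
            have := hlog2.le.trans hlog
            positivity
          rw [pow_two]
          gcongr
      _ ≤ M * (σ / (2 * n)) := by
          gcongr
          linarith
  have hqexp : (q : ℝ) ^ n = Real.exp (n * Real.log q) := by
    rw [Real.exp_nat_mul, Real.exp_log (by linarith)]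
  have h2exp : ((2 : ℝ) ^ (2 * n - 1))⁻¹ = Real.exp (-((2 * n - 1 : ℕ) * Real.log 2)) := by
    rw [Real.exp_neg, Real.exp_nat_mul, Real.exp_log (by norm_num)]
  calc (q : ℝ) ^ n * (1 - σ / (2 * n)) ^ M
      ≤ Real.exp (n * Real.log q) * Real.exp (-(σ / (2 * n))) ^ M := by
        rw [hqexp]
        gcongr
    _ = Real.exp (n * Real.log q - M * (σ / (2 * n))) := by
        rw [← Real.exp_nat_mul, ← Real.exp_add]
        congr 1
        ring
    _ ≤ ((2 : ℝ) ^ (2 * n - 1))⁻¹ := by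
        rw [h2exp, Real.exp_le_exp]
        have hle : ((2 * n - 1 : ℕ) : ℝ) ≤ 2 * n := by
          exact_mod_cast Nat.sub_le (2 * n) 1
        nlinarith [mul_le_mul_of_nonneg_left hlog hnR.le, mul_pos hnR hlog2]

/-- The bound on the probability that too few samples are accepted. -/
theorem filter_bound {n m M : ℕ} (hm : 1200 * n ≤ m) (hM : 3 * m ≤ M) :
    (2 : ℝ≥0∞) ^ m * (3 / 4) ^ M ≤ ENNReal.ofReal ((2 : ℝ) ^ (2 * n - 1))⁻¹ := by
  have h2 : (2 : ℝ≥0∞) = ENNReal.ofReal 2 := by simp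
  have h34 : (3 / 4 : ℝ≥0∞) = ENNReal.ofReal (3 / 4) := by
    rw [ENNReal.ofReal_div_of_pos (by norm_num)]
    simp
  rw [h2, h34, ← ENNReal.ofReal_pow (by norm_num), ← ENNReal.ofReal_pow (by norm_num),
    ← ENNReal.ofReal_mul (by positivity)]
  refine ENNReal.ofReal_le_ofReal ?_
  calc (2 : ℝ) ^ m * (3 / 4) ^ M ≤ 2 ^ m * (3 / 4) ^ (3 * m) :=
        mul_le_mul_of_nonneg_left (pow_le_pow_of_le_one (by norm_num) (by norm_num) hM)
          (by positivity)
    _ = (27 / 32 : ℝ) ^ m := by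
        rw [pow_mul, ← mul_pow]
        norm_num
    -- (27/32)⁵ < 1/2, and m ≥ 1200 n is far more than the five factors needed per halving.
    _ ≤ (27 / 32 : ℝ) ^ (5 * (2 * n - 1)) :=
        pow_le_pow_of_le_one (by norm_num) (by norm_num) (by omega)
    _ ≤ ((2 : ℝ) ^ (2 * n - 1))⁻¹ := by
        rw [pow_mul, ← inv_pow]
        exact pow_le_pow_left₀ (by positivity) (by norm_num) _

/-- If the oracle succeeds with probability `ε`, then few planted instances are bad. -/
theorem bad_bound {k : ℕ} {ε δ : ℝ} {x : ℝ≥0∞} (hε : 0 < ε) (hε1 : ε ≤ 1) (hδ : 0 < δ)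
    (hk : 192 / δ * Real.log (16 / ε) < k)
    (h : ENNReal.ofReal ε ≤ (1 - x) ^ ((k : ℝ) / 2) + ENNReal.ofReal (ε / 2)) :
    x ≤ ENNReal.ofReal (δ / 2) := by
  by_contra! hx
  have h1 : 1 - x ≤ ENNReal.ofReal (Real.exp (-(δ / 2))) := by
    refine (tsub_le_tsub_left hx.le 1).trans ?_
    rw [← ENNReal.ofReal_one, ← ENNReal.ofReal_sub _ (by positivity)]
    exact ENNReal.ofReal_le_ofReal (by linarith [Real.add_one_le_exp (-(δ / 2))])
  -- The exponent is kδ/4, more than 48 log(16/ε). Already ε/16 contradicts the assumption, since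
  -- ε/16 + ε/2 < ε.
  have hexp : Real.exp (-(δ / 2)) ^ ((k : ℝ) / 2) ≤ ε / 16 := by
    have h16 : 0 < 16 / ε := by positivity
    have hlog : 0 ≤ Real.log (16 / ε) := Real.log_nonneg (by
      rw [le_div_iff₀ hε]; linarith)
    have hk' : 192 * Real.log (16 / ε) < k * δ := by
      rwa [div_mul_eq_mul_div, div_lt_iff₀ hδ] at hk
    rw [← Real.exp_mul, show ε / 16 = Real.exp (-Real.log (16 / ε)) by
      rw [Real.exp_neg, Real.exp_log h16, inv_div], Real.exp_le_exp]
    nlinarith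
  have h2 : (1 - x) ^ ((k : ℝ) / 2) ≤ ENNReal.ofReal (ε / 16) := by
    refine (ENNReal.rpow_le_rpow h1 (by positivity)).trans ?_
    rw [ENNReal.ofReal_rpow_of_pos (Real.exp_pos _)]
    exact ENNReal.ofReal_le_ofReal hexp
  have h3 := h.trans (add_le_add_left h2 _)
  rw [← ENNReal.ofReal_add (by positivity) (by positivity),
    ENNReal.ofReal_le_ofReal_iff (by positivity)] at h3
  linarith

/-- The bound on the probability that no trial on a good planted instance succeeds. -/
theorem trials_bound {k E D T : ℕ} {ε δ : ℝ} (hk : 0 < k) (hε : 0 < ε) (hδ : 0 < δ)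
    (hE : 1 / ε ≤ E) (hD : 1 / δ ≤ D) (hT : T = 12 * (k * (E * D))) :
    (1 - ENNReal.ofReal (ε / (2 * k))) ^ T ≤ ENNReal.ofReal (δ / 6) := by
  have hkR : (0 : ℝ) < k := by exact_mod_cast hk
  have h1 : 1 - ENNReal.ofReal (ε / (2 * k)) ≤ ENNReal.ofReal (Real.exp (-(ε / (2 * k)))) := by
    rw [← ENNReal.ofReal_one, ← ENNReal.ofReal_sub _ (by positivity)]
    exact ENNReal.ofReal_le_ofReal (by linarith [Real.add_one_le_exp (-(ε / (2 * k)))])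
  refine (pow_le_pow_left' h1 T).trans ?_
  rw [← ENNReal.ofReal_pow (Real.exp_pos _).le, ← Real.exp_nat_mul]
  refine ENNReal.ofReal_le_ofReal ?_
  -- With T = 12kED the product is 6(Eε)D, and Eε ≥ 1, D ≥ 1/δ. The weak bound exp(-x) ≤ 1/x at x =
  -- 6/δ then suffices.
  have hrate : 6 / δ ≤ T * (ε / (2 * k)) := by
    rw [hT]
    push_cast
    calc 6 / δ = 6 * ((1 / ε) * ε) * (1 / δ) := by field_simp
      _ ≤ 6 * (E * ε) * D := by gcongr
      _ = _ := by field_simp; ring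
  calc Real.exp (T * -(ε / (2 * k))) ≤ Real.exp (-(6 / δ)) := by
        rw [Real.exp_le_exp]; linarith
    _ = (Real.exp (6 / δ))⁻¹ := Real.exp_neg _
    _ ≤ (6 / δ)⁻¹ := inv_anti₀ (by positivity) (by linarith [Real.add_one_le_exp (6 / δ)])
    _ = δ / 6 := inv_div _ _

end analysis

section correctness
variable {q n k m M σ : ℕ} [Fact q.Prime] [NeZero k]

/-- For a fixed input the search fails only if the secret is not the strict minimum of the score or
if none of the T trials finds it. -/
theorem expect_searchSpec_le (O : Solver q (k * n) m) (η : ℝ) (T : ℕ) (s : Fin n → ZMod q)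
    (R : Fin M → Sample q n) (P : Prop) [Decidable P]
    (hP : P ↔ ∀ z ≠ s,
      score (Matrix.of fun j => (R j).1) (fun j => (labelled s (R j)).2) s <
      score (Matrix.of fun j => (R j).1) (fun j => (labelled s (R j)).2) z) :
    (expect (searchSpec (coin η) O σ T (Matrix.of fun j => (R j).1)
      fun j => (labelled s (R j)).2) fun z => if z = s then 0 else 1) ≤
      (if P then 0 else 1) +
      expect (drive (filterStep k σ) (fun j => labelled s (R j)) M (0, fun _ => (0, 0))) fun p =>
        (1 - trial (coin η) O (k * σ) p.2 s) ^ T := by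
  split_ifs with h
  · rw [zero_add, searchSpec, expect_bind]
    refine expect_mono fun p => ?_
    rw [expect_map]
    exact expect_iter_better (hP.1 h) _ T
  · exact (expect_le_one fun z => by split_ifs <;> simp).trans le_self_add

/-- Four sources of failure are added up: the score (δ/6), too few accepted samples (δ/6), a bad
list of accepted samples (δ/2), and no successful trial on a good list (δ/6). -/
theorem expect_fail_le (hσ : 0 < σ) (hσn : σ < n) (hk : 4 ≤ k)
    (hp : (q : ℝ) * σ / (((q : ℝ) - 1) * n) ≤ 1)
    {η ε δ : ℝ} {E D : ℕ} (h0 : 0 < η) (h1 : η < 1 / 8) (hε : 0 < ε) (hε1 : ε ≤ 1)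
    (hδ : 6 * ((2 : ℝ) ^ (2 * n - 1))⁻¹ < δ) (hkδ : 192 / δ * Real.log (16 / ε) < k)
    (hm : 48 * (n : ℝ) ^ 3 * Real.log q / (σ : ℝ) ^ 2 ≤ m) (hmn : 1200 * n ≤ m) (hM : 3 * m ≤ M)
    (hE : 1 / ε ≤ E) (hD : 1 / δ ≤ D) (O : Solver q (k * n) m)
    (hO : ENNReal.ofReal ε ≤ successExact (k * σ) (1 - (1 - η) ^ k) O) (s : Fin n → ZMod q) :
    (expect (iid (rawSample q n σ η) M) fun R =>
      expect (searchSpec (coin η) O σ (12 * (k * (E * D))) (Matrix.of fun j => (R j).1)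
        fun j => (labelled s (R j)).2) fun z => if z = s then 0 else 1) ≤ ENNReal.ofReal δ := by
  classical
  have hq : 2 ≤ q := (Fact.out : q.Prime).two_le
  have hn : n ≤ k * n := Nat.le_mul_of_pos_left n (by omega)
  have hw : k * σ ≤ k * n := Nat.mul_le_mul_left k hσn.le
  have hpow : 0 < ((2 : ℝ) ^ (2 * n - 1))⁻¹ := by positivity
  have hδ0 : 0 < δ := by linarith
  have hkR : (0 : ℝ) < k := by exact_mod_cast (show 0 < k by omega)
  set T := 12 * (k * (E * D)) with hT
  set g : (Fin m → Sample q n) → ℝ≥0∞ := fun f => (k : ℝ≥0∞)⁻¹ * ∑ i : Fin k,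
    expect (indep fun j => plantRow (k * σ) η i (f j)) (rowsSuccess O) with hg
  -- The threshold makes the contribution of bad columns k · t = ε/2, half of the oracle's success.
  set t : ℝ≥0∞ := ENNReal.ofReal (ε / (2 * k)) with ht
  set B : Set (Fin m → Sample q n) := {f | g f ≤ t} with hB
  have hbad := bad_bound (x := expect (iid (blockSample hq hn hw η) m) fun f =>
      if f ∈ B then 1 else 0) hε hε1 hδ0 hkδ (by
    refine hO.trans ((oracle_direct_product hq (by omega) (by omega) hn hw h0.le (by linarith)
      O t B fun f hf => hf).trans_eq ?_)
    congr 1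
    rw [ht, ← ENNReal.ofReal_natCast k, ← ENNReal.ofReal_mul hkR.le,
      show (k : ℝ) * (ε / (2 * k)) = ε / 2 by field_simp])
  have hgood : ∀ f : Fin m → Sample q n,
      (1 - trial (coin η) O (k * σ) (fun j => labelled s (f j)) s) ^ T ≤
      (if f ∈ B then 1 else 0) + ENNReal.ofReal (δ / 6) := by
    intro f
    split_ifs with hf
    · exact (pow_le_one' tsub_le_self T).trans le_self_add
    · rw [zero_add]
      refine le_trans (pow_le_pow_left' (tsub_le_tsub_left ?_ 1) T)
        (trials_bound (show 0 < k by omega) hε hδ0 hE hD hT)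
      exact (not_le.1 hf).le.trans (le_trial h0.le (by linarith) O (k * σ) s f)
  set P : (Fin M → Sample q n) → Prop := fun R => ∀ z ≠ s,
    score (Matrix.of fun j => (R j).1) (fun j => (labelled s (R j)).2) s <
    score (Matrix.of fun j => (R j).1) (fun j => (labelled s (R j)).2) z with hP
  refine (expect_mono fun R => expect_searchSpec_le O η T s R (P R) Iff.rfl).trans ?_
  rw [expect_add]
  have hscore := expect_score_le (by omega) hσn hp h0 h1 s M P fun R => Iff.rfl
  have hfilter := expect_filter hq hσ hσn hk hp hn hw η s M (fun _ : Fin m => (0, 0))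
    (G := fun f => (1 - trial (coin η) O (k * σ) f s) ^ T) fun f => pow_le_one' tsub_le_self T
  have hrest : (expect (iid (blockSample hq hn hw η) m) fun f =>
      (1 - trial (coin η) O (k * σ) (fun j => labelled s (f j)) s) ^ T) ≤
      ENNReal.ofReal (δ / 2) + ENNReal.ofReal (δ / 6) := by
    refine (expect_mono hgood).trans ?_
    rw [expect_add, expect_const]
    exact add_le_add_left hbad _
  have hsc := score_bound hq hσ hσn hm (by exact_mod_cast hM : 3 * (m : ℝ) ≤ M)
  have hδ6 : ((2 : ℝ) ^ (2 * n - 1))⁻¹ ≤ δ / 6 := by linarith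
  calc _ ≤ ENNReal.ofReal (δ / 6) + (ENNReal.ofReal (δ / 6) +
        (ENNReal.ofReal (δ / 2) + ENNReal.ofReal (δ / 6))) :=
        add_le_add (hscore.trans (ENNReal.ofReal_le_ofReal (hsc.trans hδ6)))
          (hfilter.trans (add_le_add
            ((filter_bound hmn hM).trans (ENNReal.ofReal_le_ofReal hδ6)) hrest))
    _ = ENNReal.ofReal δ := by
        rw [← ENNReal.ofReal_add (by positivity) (by positivity),
          ← ENNReal.ofReal_add (by positivity) (by positivity),
          ← ENNReal.ofReal_add (by positivity) (by positivity)]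
        congr 1
        ring

/-- A failure bound valid for every secret passes to the average; success and failure probabilities
add up to 1. -/
theorem successApprox_ge {η δ : ℝ} (hδ : 0 ≤ δ) {S : Solver q n M}
    (h : ∀ s, (expect (iid (rawSample q n σ η) M) fun R =>
      expect (S (Matrix.of fun j => (R j).1) fun j => (labelled s (R j)).2)
        fun z => if z = s then 0 else 1) ≤ ENNReal.ofReal δ) :
    ENNReal.ofReal (1 - δ) ≤ successApprox σ η S := by
  classical
  rw [successApprox, successProb_eq]
  refine (expect_const (PMF.uniformOfFintype (Fin n → ZMod q)) _).symm.trans_le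
    (expect_mono fun s => ?_)
  have hpair := expect_iid_pair (ρ := rawSample q n σ η) (D := approxRow q n σ) (D' := berq q η)
    (a := Prod.fst) (b := Prod.snd) (fun f => expect_rawSample η fun y => f y.1 y.2) (m := M)
    fun A e => S (Matrix.of A) (fun j => ∑ t, A j t * s t + e j) s
  rw [← hpair, ENNReal.ofReal_sub _ hδ, ENNReal.ofReal_one, tsub_le_iff_right]
  refine le_trans ?_ (add_le_add_right (h s) _)
  rw [← expect_add]
  refine (expect_const (iid (rawSample q n σ η) M) 1).symm.trans_le (expect_mono fun R => ?_)
  rw [← expect_indicator]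
  change _ ≤ expect (S (Matrix.of fun j => (R j).1) fun j => (labelled s (R j)).2)
    (fun z => if z = s then 1 else 0) + _
  rw [← expect_add]
  refine (expect_const _ 1).symm.trans_le (expect_mono fun z => ?_)
  split_ifs <;> simp

end correctness
end
end SparseLPN

/-! ### Assembly of the reduction theorem -/

theorem mainTheorem8 :
    ∃ (P : SparseLPN.Prog) (C d : ℕ),
      ∀ (q : ℕ) [Fact q.Prime] (m n k σ M : ℕ) (ε δ η : ℝ),
        0 < m → 0 < n → 0 < k → 0 < σ →
        (q : ℝ) * σ / (((q : ℝ) - 1) * n) ≤ 1 →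
        max (48 * (n : ℝ) ^ 3 * Real.log q / (σ : ℝ) ^ 2) (1200 * (n : ℝ)) ≤ (m : ℝ) →
        M = ⌈3 * Real.sqrt σ * m⌉₊ →
        0 < ε → 6 * ((2 : ℝ) ^ (2 * n - 1))⁻¹ < δ → 0 < η → η < 1 / 8 →
        192 / δ * Real.log (16 / ε) < k → (k : ℝ) < 2 ^ (2 * n - 2) * ε →
        ∀ O : SparseLPN.Solver q (k * n) m,
          (∀ (A : Matrix (Fin M) (Fin n) (ZMod q)) (b : Fin M → ZMod q),
            ∀ S ∈ (SparseLPN.run P [q, n, k, σ, m, M, ⌈1 / ε⌉₊, ⌈1 / δ⌉₊] η O A b).support,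
              (S.time : ℝ) ≤ C * m * (n + k + 1 / ε + 1 / δ) ^ d) ∧
          (ENNReal.ofReal ε ≤ SparseLPN.successExact (k * σ) (1 - (1 - η) ^ k) O →
            ENNReal.ofReal (1 - δ) ≤
              SparseLPN.successApprox (n := n) (m := M) σ η
                (SparseLPN.reductionSolver P [q, n, k, σ, m, M, ⌈1 / ε⌉₊, ⌈1 / δ⌉₊] η O)) := by
  -- 6400000 = 100000 · 2⁶, where the 2 pays for rounding up 1/ε and 1/δ.
  refine ⟨SparseLPN.Prog.reduction, 6400000, 6, ?_⟩
  intro q _ m n k σ M ε δ η hm hn hk hσ hp hmax hM hε hδ h0 h1 hkδ _ O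
  have : NeZero k := ⟨hk.ne'⟩
  have hq : 2 ≤ q := (Fact.out : q.Prime).two_le
  have hqR : (2 : ℝ) ≤ q := by exact_mod_cast hq
  have hnR : (0 : ℝ) < n := by exact_mod_cast hn
  have hmR : (1 : ℝ) ≤ m := by exact_mod_cast hm
  have hσR : (1 : ℝ) ≤ σ := by exact_mod_cast hσ
  have hkR : (1 : ℝ) ≤ k := by exact_mod_cast hk
  have hδ0 : 0 < δ := lt_trans (by positivity) hδ
  -- The entry probability qσ/((q - 1)n) is at most 1 and q > q - 1, so σ is strictly less than n.
  have hσn : σ < n := by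
    rw [div_le_one (by nlinarith)] at hp
    have : (σ : ℝ) < n := by nlinarith
    exact_mod_cast this
  have hsqrt1 : 1 ≤ Real.sqrt σ := Real.one_le_sqrt.2 hσR
  have hsqrtσ : Real.sqrt σ ≤ σ := Real.sqrt_le_self_iff.2 (Or.inr hσR)
  have h3m : 3 * m ≤ M := by
    have : 3 * (m : ℝ) ≤ M := by
      rw [hM]
      exact le_trans (by nlinarith) (Nat.le_ceil _)
    exact_mod_cast this
  refine ⟨fun A b S hS => ?_, fun hO => ?_⟩
  · set a := n + k + ⌈1 / ε⌉₊ + ⌈1 / δ⌉₊ with ha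
    -- Of √σ only the bounds 1 ≤ √σ ≤ σ are used: the lower one gives M ≥ 3m, the upper one the
    -- running time.
    have hMa : M ≤ 4 * a * m := by
      have hlt : (M : ℝ) < 3 * Real.sqrt σ * m + 1 := by
        rw [hM]
        exact Nat.ceil_lt_add_one (by positivity)
      have hσa : (σ : ℝ) + 1 ≤ a := by exact_mod_cast (show σ + 1 ≤ a by omega)
      have : (M : ℝ) ≤ 4 * a * m := by nlinarith
      exact_mod_cast this
    have htime := SparseLPN.reduction_time hm (a := a) (by omega) (by omega) (by omega) (by omega)
      (by omega) (by omega) hMa S hS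
    have haX : (a : ℝ) ≤ 2 * (n + k + 1 / ε + 1 / δ) := by
      have e1 := Nat.ceil_lt_add_one (one_div_pos.2 hε).le
      have e2 := Nat.ceil_lt_add_one (one_div_pos.2 hδ0).le
      have e3 := one_div_pos.2 hε
      have e4 := one_div_pos.2 hδ0
      have e5 : (1 : ℝ) ≤ n := by exact_mod_cast hn
      rw [ha]
      push_cast
      linarith
    calc (S.time : ℝ) ≤ 100000 * m * (a : ℝ) ^ 6 := by exact_mod_cast htime
      _ ≤ 100000 * m * (2 * (n + k + 1 / ε + 1 / δ)) ^ 6 := by gcongr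
      _ = _ := by push_cast; ring
  -- For δ ≥ 1 nothing is claimed; below, δ < 1 and ε ≤ 1 are available.
  · rcases le_or_gt 1 δ with hδ1 | hδ1
    · rw [ENNReal.ofReal_of_nonpos (by linarith)]
      exact zero_le
    have hε1 : ε ≤ 1 := by
      have := hO.trans (PMF.coe_le_one _ _)
      simpa using this
    -- ε ≤ 1 gives log(16/ε) ≥ 1 and δ < 1 gives 192/δ ≥ 192, so the lower bound on k is far above
    -- the 4 that filtering needs.
    have hk4 : 4 ≤ k := by
      have hlog : 1 ≤ Real.log (16 / ε) := by
        rw [Real.le_log_iff_exp_le (by positivity), le_div_iff₀ hε]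
        nlinarith [Real.exp_one_lt_d9, Real.exp_pos 1]
      have hd : 192 ≤ 192 / δ := by
        rw [le_div_iff₀ hδ0]
        linarith
      have : (4 : ℝ) ≤ k := by nlinarith
      exact_mod_cast this
    refine SparseLPN.successApprox_ge hδ0.le fun s => ?_
    have hrun : ∀ A b, SparseLPN.reductionSolver SparseLPN.Prog.reduction
        [q, n, k, σ, m, M, ⌈1 / ε⌉₊, ⌈1 / δ⌉₊] η O A b =
        SparseLPN.searchSpec (SparseLPN.coin η) O σ (12 * (k * (⌈1 / ε⌉₊ * ⌈1 / δ⌉₊))) A b :=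
      fun A b => SparseLPN.reduction_run hq (by omega)
    simp only [hrun]
    exact SparseLPN.expect_fail_le hσ hσn hk4 hp h0 h1 hε hε1 hδ hkδ
      ((le_max_left _ _).trans hmax) (by exact_mod_cast (le_max_right _ _).trans hmax) h3m
      (Nat.le_ceil _) (Nat.le_ceil _) O hO s
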